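/- Let $\alpha>0$ and let $dA$ be Lebesgue measure on $\mathbb C$. A weight is a non-negative locally integrable function $w$ on $\mathbb C$, not almost everywhere zero; write $w(E)=\int_E w\,dA$, and $D(z,r)$ for the open disk with center $z$ and radius $r$. For $1<p<\infty$ and $p'=p/(p-1)$, $w\in A_p^{\rm res}$ means that for some $r>0$ $$\sup_{\ell(Q)=r}\Big(\frac1{A(Q)}\int_Q w\,dA\Big)\Big(\frac1{A(Q)}\int_Q w^{-p'/p}dA\Big)^{p/p'}<\infty ,$$ the supremum being over all squares $Q$ with sides parallel to the axes and side length $r$; $w\in A_1^{\rm res}$ means that for some $r>0$, $\sup_{\ell(Q)=r}\big(\frac1{A(Q)}\int_Q w\,dA\big)\|w^{-1}\|_{L^\infty(Q)}<\infty$; and $A_\infty^{\rm res}=\bigcup_{1\le p<\infty}A_p^{\rm res}$. Let $w\in A_\infty^{\rm res}$. Let $F^2_{\alpha,w}$ be the Hilbert space of entire functions $f$ with $\|f\|^2=\int_{\mathbb C}|f(z)|^2e^{-\alpha|z|^2}w(z)\,dA(z)<\infty$, let $B_z$ be its reproducing kernel at $z$, and let $b_z=B_z/\|B_z\|$. For a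 positive Borel measure $\mu$ on $\mathbb C$ put $$\widetilde\mu(z)=\int_{\mathbb C}|b_z(\xi)|^2e^{-\alpha|\xi|^2}d\mu(\xi),\qquad \widehat\mu_{w,r}(z)=\frac{\mu(D(z,r))}{w(D(z,r))}.$$ The Toeplitz operator $T_\mu$ is bounded (respectively compact) on $F^2_{\alpha,w}$ if for all $f\in F^2_{\alpha,w}$ and $z\in\mathbb C$ the integral $$T_\mu f(z)=\int_{\mathbb C}f(\xi)\overline{B_z(\xi)}e^{-\alpha|\xi|^2}d\mu(\xi)$$ converges absolutely and $f\mapsto T_\mu f$ is a bounded (respectively compact) operator on $F^2_{\alpha,w}$. The singular values $s_1(T)\ge s_2(T)\ge\dots\ge0$ of a compact operator $T$ are the numbers, tending to $0$, in a canonical decomposition $Tx=\sum_{n\ge1}s_n(T)\langle x,e_n\rangle\sigma_n$ with orthonormal sequences $(e_n)$ and $(\sigma_n)$. Call $\delta\in(0,1)$ a kernel radius for $(\alpha,w)$ if for every $r>0$ there is $c>0$ such that $$|B_a(z)|\ge c\,\frac{e^{\frac\alpha2|a|^2+\frac\alpha2|z|^2}}{w(D(a,r))}\qquad\text{for all }a\in\mathbb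 C,\ z\in D(a,\delta).$$ Then a kernel radius $\delta$ exists. Moreover, for every kernel radius $\delta$, the following holds. Let $\mu$ be a positive Borel measure on $\mathbb C$ such that $T_\mu$ is compact on $F^2_{\alpha,w}$. Let $\eta:[1,\infty)\to(0,\infty)$ be a continuous decreasing function with $\eta(t)\to0$ and $\eta(t\log t)\asymp\eta(t)$ as $t\to\infty$, and let $h_\eta:[0,\infty)\to[0,\infty)$ be any convex function with $h_\eta(0)=0$ and $h_\eta(\eta(t))=1/t$ for all $t\ge1$. Then the following conditions are equivalent: (a) there is $K>0$ with $s_n(T_\mu)\le K\eta(n)$ for all $n\ge1$; (b) there is $C>0$ with $\int_{\mathbb C}h_\eta(C\widetilde\mu(z))\,dA(z)<\infty$; (c) for some $r\in(0,\delta)$ there is $C>0$ with $\int_{\mathbb C}h_\eta(C\widehat\mu_{w,r}(z))\,dA(z)<\infty$; (d) for every $r\in(0,\delta)$ there is $C>0$ with $\int_{\mathbb C}h_\eta(C\widehat\mu_{w,r}(z))\,dA(z)<\infty$. -/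

import Mathlib

open MeasureTheory Set Filter Topology Asymptotics
open scoped ENNReal NNReal ComplexConjugate

noncomputable section

namespace WeightedFock

/-! ### Weights -/

/-- A weight on the plane: a non-negative, locally integrable function. The zero weight (for which
all weighted norms vanish) is excluded. -/
structure IsWeight (w : ℂ → ℝ) : Prop where
  nonneg : ∀ z, 0 ≤ w z
  locallyIntegrable : LocallyIntegrable w volume
  not_ae_zero : ¬ w =ᵐ[volume] 0

/-- The square with center `c` and side length `r`, with sides parallel to the axes. -/
def square (c : ℂ) (r : ℝ) : Set ℂ :=
  {z | |z.re - c.re| ≤ r / 2 ∧ |z.im - c.im| ≤ r / 2}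

/-- The restricted `A_p` quantity of `w` at scale `r`, for `1 < p`. Here `p' = p / (p - 1)`, so that
`p' / p = 1 / (p - 1)` and `p / p' = p - 1`. All quantities are in `[0, ∞]`, and `0` to a negative
power is `∞`. -/
def apConst (p r : ℝ) (w : ℂ → ℝ) : ℝ≥0∞ :=
  ⨆ c : ℂ, ((volume (square c r))⁻¹ * ∫⁻ z in square c r, ENNReal.ofReal (w z)) *
    ((volume (square c r))⁻¹ *
      ∫⁻ z in square c r, ENNReal.ofReal (w z) ^ (-(1 / (p - 1)))) ^ (p - 1)

/-- The restricted `A_1` quantity of `w` at scale `r`. -/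
def aOneConst (r : ℝ) (w : ℂ → ℝ) : ℝ≥0∞ :=
  ⨆ c : ℂ, ((volume (square c r))⁻¹ * ∫⁻ z in square c r, ENNReal.ofReal (w z)) *
    essSup (fun z => (ENNReal.ofReal (w z))⁻¹) (volume.restrict (square c r))

/-- The restricted class `A_p`, for `1 ≤ p < ∞`. -/
def RestrictedAp (p : ℝ) (w : ℂ → ℝ) : Prop :=
  IsWeight w ∧ ∃ r : ℝ, 0 < r ∧
    ((p = 1 ∧ aOneConst r w < ∞) ∨ (1 < p ∧ apConst p r w < ∞))

/-- The restricted class `A_∞`, the union of the restricted classes `A_p`, `1 ≤ p < ∞`. -/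
def RestrictedAInfty (w : ℂ → ℝ) : Prop :=
  ∃ p : ℝ, 1 ≤ p ∧ RestrictedAp p w

/-- The measure `w dA`, so that `weightMeasure w E` is `w(E) = ∫_E w dA`. -/
def weightMeasure (w : ℂ → ℝ) : Measure ℂ :=
  volume.withDensity fun z => ENNReal.ofReal (w z)

/-! ### The weighted Fock space and its reproducing kernel -/

/-- The measure `e^{-α|z|²} w(z) dA(z)`. -/
def fockMeasure (α : ℝ) (w : ℂ → ℝ) : Measure ℂ :=
  volume.withDensity fun z => ENNReal.ofReal (Real.exp (-α * ‖z‖ ^ 2) * w z)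

/-- The weighted Fock space `F²_{α,w}`: the entire functions in
`L²_{α,w} = L²(e^{-α|z|²} w(z) dA(z))`, with the inherited Hilbert space structure. -/
def FockSpace (α : ℝ) (w : ℂ → ℝ) : Submodule ℂ (Lp ℂ 2 (fockMeasure α w)) where
  carrier := {f | ∃ g : ℂ → ℂ, Differentiable ℂ g ∧ f =ᵐ[fockMeasure α w] g}
  add_mem' := by
    rintro f₁ f₂ ⟨g₁, hg₁, h₁⟩ ⟨g₂, hg₂, h₂⟩
    exact ⟨g₁ + g₂, hg₁.add hg₂, (Lp.coeFn_add f₁ f₂).trans (h₁.add h₂)⟩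
  zero_mem' := ⟨0, differentiable_const 0, Lp.coeFn_zero ℂ 2 _⟩
  smul_mem' := by
    rintro c f ⟨g, hg, h⟩
    exact ⟨c • g, hg.const_smul c, (Lp.coeFn_smul c f).trans (h.const_smul c)⟩

variable {α : ℝ} {w : ℂ → ℝ}

/-- The entire function that represents an element of the Fock space (it is unique, because a
weight is not almost everywhere zero and the zero set of a nonzero entire function is a null
set). -/
def entireRep (f : FockSpace α w) : ℂ → ℂ := Classical.choose f.2

open Classical in
/-- The reproducing kernel `B_z` of `F²_{α,w}` at `z`: the element with `f(z) = ⟨f, B_z⟩` for all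
`f`. (Mathlib's inner product is conjugate-linear in its first argument.) It exists and is unique
for `α > 0` and `w` in the restricted class `A_∞`; the value `0` is used if there is none. -/
def reproKernel (α : ℝ) (w : ℂ → ℝ) (z : ℂ) : FockSpace α w :=
  if h : ∃ B : FockSpace α w, ∀ f : FockSpace α w, entireRep f z = inner ℂ B f then
    Classical.choose h
  else 0

/-- The normalized reproducing kernel `b_z = B_z / ‖B_z‖`. -/
def normalizedKernel (α : ℝ) (w : ℂ → ℝ) (z : ℂ) : FockSpace α w :=
  ((‖reproKernel α w z‖⁻¹ : ℝ) : ℂ) • reproKernel α w z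

/-- `δ ∈ (0,1)` is a radius of the local lower estimate for the reproducing kernel:
`|B_a(z)| ≳ e^{α|a|²/2 + α|z|²/2} / w(D(a,r))` for `a ∈ ℂ` and `z ∈ D(a,δ)`, for every `r > 0`, with
a constant independent of `a` and `z`. -/
def IsKernelRadius (α : ℝ) (w : ℂ → ℝ) (δ : ℝ) : Prop :=
  0 < δ ∧ δ < 1 ∧ ∀ r : ℝ, 0 < r → ∃ c : ℝ, 0 < c ∧ ∀ a z : ℂ, z ∈ Metric.ball a δ →
    c * (Real.exp (α / 2 * ‖a‖ ^ 2 + α / 2 * ‖z‖ ^ 2) /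
      (weightMeasure w (Metric.ball a r)).toReal) ≤ ‖entireRep (reproKernel α w a) z‖

/-! ### Toeplitz operators, averages, Berezin transform -/

/-- The bounded operator `T` on `F²_{α,w}` is the Toeplitz operator `T_μ`: for every `f` in
`F²_{α,w}` and every `z`, the integral below converges absolutely and
`T f(z) = ∫ f(ξ) conj(B_z(ξ)) e^{-α|ξ|²} dμ(ξ)`. -/
def IsToeplitz (μ : Measure ℂ) (T : FockSpace α w →L[ℂ] FockSpace α w) : Prop :=
  ∀ (f : FockSpace α w) (z : ℂ),
    Integrable (fun ξ => entireRep f ξ * conj (entireRep (reproKernel α w z) ξ) *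
      (Real.exp (-α * ‖ξ‖ ^ 2) : ℂ)) μ ∧
    entireRep (T f) z = ∫ ξ, entireRep f ξ * conj (entireRep (reproKernel α w z) ξ) *
      (Real.exp (-α * ‖ξ‖ ^ 2) : ℂ) ∂μ

/-- The average function `μ(D(z,r)) / w(D(z,r))`. -/
def averageFn (w : ℂ → ℝ) (μ : Measure ℂ) (r : ℝ) (z : ℂ) : ℝ≥0∞ :=
  μ (Metric.ball z r) / weightMeasure w (Metric.ball z r)

/-- The Berezin transform `∫ |b_z(ξ)|² e^{-α|ξ|²} dμ(ξ)`. -/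
def berezin (α : ℝ) (w : ℂ → ℝ) (μ : Measure ℂ) (z : ℂ) : ℝ≥0∞ :=
  ∫⁻ ξ, ENNReal.ofReal (‖entireRep (normalizedKernel α w z) ξ‖ ^ 2 * Real.exp (-α * ‖ξ‖ ^ 2)) ∂μ

/-! ### Singular values -/

/-- `s` is the sequence of singular values in a canonical decomposition
`T x = ∑ s_n ⟨x, e_n⟩ σ_n`, with `(e_n)` and `(σ_n)` orthonormal and `s_n` non-negative,
non-increasing, tending to `0`. The index starts at `0`: `s n` is the `(n+1)`-st singular value. -/
def IsSingularValueSeq {H : Type*} [NormedAddCommGroup H] [InnerProductSpace ℂ H]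
    (T : H →L[ℂ] H) (s : ℕ → ℝ) : Prop :=
  (∀ n, 0 ≤ s n) ∧ Antitone s ∧ Tendsto s atTop (𝓝 0) ∧
    ∃ e σ : ℕ → H, Orthonormal ℂ e ∧ Orthonormal ℂ σ ∧
      ∀ x, HasSum (fun n => ((s n : ℂ) * inner ℂ (e n) x) • σ n) (T x)

open Classical in
/-- `singularValue T n` is the `(n+1)`-st singular value of `T`. A compact operator on an
infinite-dimensional Hilbert space has exactly one singular value sequence; the value `0` is used
if `T` has none. -/
def singularValue {H : Type*} [NormedAddCommGroup H] [InnerProductSpace ℂ H]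
    (T : H →L[ℂ] H) : ℕ → ℝ :=
  if h : ∃ s, IsSingularValueSeq T s then Classical.choose h else 0

/-! ### Rates of decay -/

/-- `η : [1,∞) → (0,∞)` is continuous and decreasing, `η(+∞) = 0`, and `η(t log t) ≍ η(t)` as
`t → +∞`. -/
structure IsDecayRate (η : ℝ → ℝ) : Prop where
  pos : ∀ t, 1 ≤ t → 0 < η t
  continuousOn : ContinuousOn η (Ici 1)
  antitoneOn : AntitoneOn η (Ici 1)
  tendsto_zero : Tendsto η atTop (𝓝 0)
  isTheta : (fun t => η (t * Real.log t)) =Θ[atTop] η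

/-- `h : [0,∞) → [0,∞)` is a convex function with `h(0) = 0` and `h(η(t)) = 1/t` for `t ≥ 1`. The
last equation determines `h` on `(0, η(1)]`; any convex continuation beyond `η(1)` is allowed. -/
structure IsConvexProfile (η h : ℝ → ℝ) : Prop where
  nonneg : ∀ x, 0 ≤ x → 0 ≤ h x
  zero : h 0 = 0
  apply_rate : ∀ t, 1 ≤ t → h (η t) = 1 / t
  convexOn : ConvexOn ℝ (Ici 0) h

open Classical in
/-- `h : [0,∞) → [0,∞)`, extended to `[0,∞]` by the value `∞` at `∞`. -/
def extendTop (h : ℝ → ℝ) (x : ℝ≥0∞) : ℝ≥0∞ :=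
  if x = ∞ then ∞ else ENNReal.ofReal (h x.toReal)

end WeightedFock

end

noncomputable section

namespace WeightedFock

/-! ### The sub-mean value property of `|f|^q` -/

/-! Restricted `A_∞` weights enter only through the dual inequality `(∫_Q g^{1/p})^p w(Q) ≤ C ∫_Q g
w dA`, a consequence of Hölder (`RestrictedAInfty.exists_lintegral_le`). For `g` an indicator it
gives local doubling, hence at most exponential growth of `w(D(z,1))`, which a Gaussian absorbs. For
`g = |F|²` with `F` entire, together with subharmonicity of `|F|^{2/p}`, it gives the weighted
sub-mean value property `RestrictedAInfty.exists_fockDensity_le`: `|f(z)|² e^{-α|z|²} w(D(z,1))` is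
controlled by the integral of `|f|² e^{-α|u|²} w` near `z`. It follows that the Fock space is a
reproducing kernel Hilbert space and, testing with `e^{αξ z̄}`, that `‖B_z‖² ≍ e^{α|z|²} /
w(D(z,1))`. A Schwarz lemma argument then keeps `B_a` away from zero near `a`.

On the span of the kernels, `⟨T_μ f, f⟩ = ∫ |f|² e^{-α|ξ|²} dμ`. So `T_μ` is positive; when it is
compact, the spectral theorem gives a decomposition with vectors `e_n`, `σ_n`. The hypothesis on
`η`, applied twice, gives `η(t) ≲ η(t log² t)`. Therefore `s_n ≲ η(n)` is equivalent to `∑ h(C s_n)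
< ∞` for some `C > 0`: one direction compares with `∑ 1/(n log² n)`, the other uses monotonicity of
`s_n` and convexity of `h`.

The rest is Jensen's inequality, used twice. From singular values to the Berezin transform: `μ̃(z) =
⟨T b_z, b_z⟩` is at most a combination of the `s_n` with coefficients of sum at most one, and each
coefficient has bounded integral in `z`. From averages to singular values: `s_n` is bounded by the
`L²(μ)` norms of `e_n` and `σ_n`, each of which is at most a mean of averages of `μ` against the
probability measure `|e_n|² e^{-α|u|²} w dA` (or the one of `σ_n`); Bessel's inequality `∑ |e_n(u)|²
≤ ‖B_u‖²` sums the resulting bounds. Between the two, the lower bound of the kernel gives `μ̂_{w,r}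
≲ μ̃` for `r < δ`. -/

/-- The integral over a disk centered at the origin in polar coordinates. -/
lemma lintegral_ball_eq_polar {F : ℂ → ℝ≥0∞} (hF : Measurable F) (r : ℝ) :
    ∫⁻ z in Metric.ball (0 : ℂ) r, F z = ∫⁻ s in Ioi (0 : ℝ), ENNReal.ofReal s *
      (if s < r then ∫⁻ θ in Ioo (-Real.pi) Real.pi, F (circleMap 0 s θ) else 0) := by
  have hG : Measurable ((Metric.ball (0 : ℂ) r).indicator F) := hF.indicator measurableSet_ball
  have hm : Measurable fun p : ℝ × ℝ => ENNReal.ofReal p.1 •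
      (Metric.ball (0 : ℂ) r).indicator F (circleMap 0 p.1 p.2) := by
    refine (ENNReal.measurable_ofReal.comp measurable_fst).smul (hG.comp ?_)
    unfold circleMap
    fun_prop
  have hcm : ∀ p : ℝ × ℝ, Complex.polarCoord.symm p = circleMap 0 p.1 p.2 := fun p => by
    rw [Complex.polarCoord_symm_apply, circleMap_zero, Complex.exp_mul_I, Complex.ofReal_cos,
      Complex.ofReal_sin]
  rw [← lintegral_indicator measurableSet_ball, ← Complex.lintegral_comp_polarCoord_symm]
  simp_rw [hcm]
  rw [polarCoord_target, Measure.volume_eq_prod, ← Measure.prod_restrict,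
    lintegral_prod _ hm.aemeasurable]
  refine setLIntegral_congr_fun measurableSet_Ioi fun s hs => ?_
  have hs' : (0 : ℝ) < s := hs
  have hmem : ∀ θ, circleMap 0 s θ ∈ Metric.ball (0 : ℂ) r ↔ s < r := fun θ => by
    rw [mem_ball_zero_iff, norm_circleMap_zero, abs_of_pos hs']
  by_cases hsr : s < r
  · simp only [hsr, if_true, smul_eq_mul, indicator, hmem]
    rw [lintegral_const_mul]
    exact hF.comp (by unfold circleMap; fun_prop)
  · simp [hsr, hmem, indicator]

/-- A function whose averages over circles around `0` dominate its value there satisfies the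
sub-mean value inequality on disks. -/
lemma volume_ball_mul_le_lintegral {F : ℂ → ℝ≥0∞} (hFm : Measurable F) {a : ℝ≥0∞}
    (hF : ∀ s : ℝ, 0 < s → ENNReal.ofReal (2 * Real.pi) * a ≤
      ∫⁻ θ in Ioo (-Real.pi) Real.pi, F (circleMap 0 s θ)) (r : ℝ) :
    volume (Metric.ball (0 : ℂ) r) * a ≤ ∫⁻ z in Metric.ball (0 : ℂ) r, F z := by
  have h1 : volume (Metric.ball (0 : ℂ) r) * a = ∫⁻ _ in Metric.ball (0 : ℂ) r, a := by
    rw [setLIntegral_const, mul_comm]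
  rw [h1, lintegral_ball_eq_polar measurable_const, lintegral_ball_eq_polar hFm]
  refine setLIntegral_mono' measurableSet_Ioi fun s hs => ?_
  gcongr
  split_ifs
  · refine le_trans (le_of_eq ?_) (hF s hs)
    rw [setLIntegral_const, Real.volume_Ioo, mul_comm]
    congr 2; ring
  · exact le_rfl

/-- The circle averages of `|f|^q` dominate `|f(c)|^q`. -/
lemma rpow_norm_le_circleAverage {f : ℂ → ℂ} (hf : Differentiable ℂ f) {q : ℝ} (hq : 0 < q)
    (c : ℂ) {s : ℝ} (hs : 0 < s) :
    ‖f c‖ ^ q ≤ Real.circleAverage (fun z => ‖f z‖ ^ q) c s := by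
  by_cases h0 : f c = 0
  · rw [h0, norm_zero, Real.zero_rpow hq.ne']
    exact Real.circleAverage_nonneg_of_nonneg fun z _ => by positivity
  have hcont : Continuous fun z => ‖f z‖ ^ q :=
    hf.continuous.norm.rpow_const fun _ => Or.inr hq.le
  have han : AnalyticOnNhd ℂ f univ := fun z _ => hf.analyticAt z
  set m := Real.log ‖f c‖ with hm
  -- `L` is the tangent line of `t ↦ e^{qt}` at `m`, evaluated at `log |f|`. Away from the zeros of
  -- `f` it lies below `|f|^q`, and Jensen's formula bounds its circle average from below by `e^{qm}
  -- = |f(c)|^q`.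
  set L : ℂ → ℝ := fun z => Real.exp (q * m) * (1 + q * (Real.log ‖f z‖ - m)) with hL
  have hLint : CircleIntegrable (fun z => Real.log ‖f z‖) c s :=
    MeromorphicOn.circleIntegrable_log_norm fun z _ => (hf.analyticAt z).meromorphicAt
  have hLint' : CircleIntegrable L c s := by
    have : L = fun z => Real.exp (q * m) * (1 - q * m) +
        (Real.exp (q * m) * q) * Real.log ‖f z‖ := by
      funext z; simp only [hL]; ring
    rw [this]
    exact (circleIntegrable_const _ _ _).add (hLint.const_fun_smul (a := Real.exp (q * m) * q))
  have hjensen : m ≤ Real.circleAverage (fun z => Real.log ‖f z‖) c s := by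
    rw [AnalyticOnNhd.circleAverage_log_norm hs.ne' (han.mono (subset_univ _)) h0]
    -- In Jensen's formula the zeros in the disk contribute non-negatively, and there are no poles.
    have : 0 ≤ ∑ᶠ u, (MeromorphicOn.divisor f (Metric.closedBall c |s|) u : ℝ) *
        Real.log (s * ‖c - u‖⁻¹) := by
      refine finsum_nonneg fun u => ?_
      by_cases hu : u ∈ Metric.closedBall c |s|
      · have h1 : (0 : ℤ) ≤ MeromorphicOn.divisor f (Metric.closedBall c |s|) u :=
          (MeromorphicOn.AnalyticOnNhd.divisor_nonneg (han.mono (subset_univ _))) u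
        by_cases hcu : c = u
        · simp [hcu]
        · refine mul_nonneg (by exact_mod_cast h1) (Real.log_nonneg ?_)
          have h2 : ‖c - u‖ ≤ s := by
            rw [Metric.mem_closedBall, abs_of_pos hs, dist_comm, dist_eq_norm] at hu
            exact hu
          have h3 : 0 < ‖c - u‖ := norm_pos_iff.2 (sub_ne_zero.2 hcu)
          rw [← div_eq_mul_inv, le_div_iff₀ h3]
          linarith
      · simp [hu]
    linarith
  have hpow : ‖f c‖ ^ q = Real.exp (q * m) := by
    rw [Real.rpow_def_of_pos (norm_pos_iff.2 h0), mul_comm]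
  have hLavg : ‖f c‖ ^ q ≤ Real.circleAverage L c s := by
    have : L = fun z => Real.exp (q * m) * (1 - q * m) +
        (Real.exp (q * m) * q) • Real.log ‖f z‖ := by
      funext z; simp only [hL, smul_eq_mul]; ring
    rw [this, Real.circleAverage_fun_add (circleIntegrable_const _ _ _)
      (hLint.const_fun_smul (a := Real.exp (q * m) * q)), Real.circleAverage_const,
      Real.circleAverage_fun_smul, hpow, smul_eq_mul]
    have := mul_le_mul_of_nonneg_left hjensen (mul_pos (Real.exp_pos (q * m)) hq).le
    nlinarith
  classical
  -- Since `Real.log 0 = 0`, the bound `L ≤ |f|^q` can fail at zeros of `f`. Replacing `L` by `0`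
  -- there does not change the circle average, the zeros being discrete.
  set G : ℂ → ℝ := fun z => if f z = 0 then 0 else L z with hG
  have hcod : G =ᶠ[codiscreteWithin (Metric.sphere c |s|)] L := by
    have h1 : ∀ᶠ z in codiscreteWithin (univ : Set ℂ), f z ≠ 0 := by
      have := AnalyticOnNhd.eqOn_zero_or_eventually_ne_zero_of_preconnected han
        isPreconnected_univ
      rcases this with h | h
      · exact absurd (h (mem_univ c)) h0
      · exact h
    filter_upwards [codiscreteWithin_mono (subset_univ (Metric.sphere c |s|)) h1] with z hz
    have hz' : f z ≠ 0 := hz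
    simp [hG, hz']
  rw [Real.circleAverage_congr_codiscreteWithin hcod.symm hs.ne'] at hLavg
  refine hLavg.trans (Real.circleAverage_mono (hLint'.congr_codiscreteWithin hcod.symm)
    (hcont.continuousOn.circleIntegrable hs.le) fun z _ => ?_)
  by_cases hz : f z = 0
  · simp only [hG, hz, if_true]; positivity
  · simp only [hG, hz, if_false, hL]
    rw [Real.rpow_def_of_pos (norm_pos_iff.2 hz)]
    have h1 := Real.add_one_le_exp (q * (Real.log ‖f z‖ - m))
    have h2 : Real.exp (Real.log ‖f z‖ * q) =
        Real.exp (q * m) * Real.exp (q * (Real.log ‖f z‖ - m)) := by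
      rw [← Real.exp_add]; ring_nf
    rw [h2]
    have := Real.exp_pos (q * m)
    nlinarith

/-- The sub-mean value property of `|f|^q` over disks. -/
lemma volume_ball_mul_rpow_le_lintegral {f : ℂ → ℂ} (hf : Differentiable ℂ f) {q : ℝ}
    (hq : 0 < q) (c : ℂ) (r : ℝ) :
    volume (Metric.ball c r) * ‖f c‖ₑ ^ q ≤ ∫⁻ z in Metric.ball c r, ‖f z‖ₑ ^ q := by
  have hg : Differentiable ℂ fun z => f (z + c) := hf.comp (differentiable_id.add_const c)
  have hgc : Continuous fun z => ‖f (z + c)‖ ^ q :=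
    hg.continuous.norm.rpow_const fun _ => Or.inr hq.le
  have hme : Measurable fun z => ‖f z‖ₑ ^ q := hf.continuous.enorm.measurable.pow_const q
  have hmeg : Measurable fun z => ‖f (z + c)‖ₑ ^ q := hg.continuous.enorm.measurable.pow_const q
  have henn : ∀ z, ‖f z‖ₑ ^ q = ENNReal.ofReal (‖f z‖ ^ q) := fun z => by
    rw [← ENNReal.ofReal_rpow_of_nonneg (norm_nonneg _) hq.le, ofReal_norm]
  have htrans : ∫⁻ z in Metric.ball c r, ‖f z‖ₑ ^ q =
      ∫⁻ z in Metric.ball (0 : ℂ) r, ‖f (z + c)‖ₑ ^ q := by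
    rw [← lintegral_indicator measurableSet_ball, ← lintegral_indicator measurableSet_ball,
      ← lintegral_add_right_eq_self _ c]
    congr 1
    funext z
    simp [indicator, dist_eq_norm]
  have hvol : volume (Metric.ball c r) = volume (Metric.ball (0 : ℂ) r) := by
    rw [Complex.volume_ball, Complex.volume_ball]
  rw [htrans, hvol]
  refine volume_ball_mul_le_lintegral hmeg (fun s hs => ?_) r
  have h1 := rpow_norm_le_circleAverage hg hq 0 hs
  rw [zero_add, Real.circleAverage_eq_integral_add (-Real.pi), smul_eq_mul] at h1
  have hcc : Continuous fun θ => ‖f (circleMap 0 s θ + c)‖ ^ q :=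
    hgc.comp (continuous_circleMap 0 s)
  have h2 : (2 * Real.pi) * ‖f c‖ ^ q ≤
      ∫ θ in Ioo (-Real.pi) Real.pi, ‖f (circleMap 0 s θ + c)‖ ^ q := by
    rw [← integral_Ioc_eq_integral_Ioo, ← intervalIntegral.integral_of_le
      (by linarith [Real.pi_pos])]
    -- Circle averages run over `[0, 2π]`, polar coordinates over `(-π, π)`.
    have h3 := intervalIntegral.integral_comp_add_right (a := 0) (b := 2 * Real.pi)
      (fun θ => ‖f (circleMap 0 s θ + c)‖ ^ q) (-Real.pi)
    rw [h3] at h1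
    have h4 := mul_le_mul_of_nonneg_left h1 (by positivity : 0 ≤ 2 * Real.pi)
    rw [← mul_assoc, mul_inv_cancel₀ (by positivity), one_mul] at h4
    rwa [zero_add, show 2 * Real.pi + -Real.pi = Real.pi by ring] at h4
  rw [henn, ← ENNReal.ofReal_mul (by positivity)]
  refine (ENNReal.ofReal_le_ofReal h2).trans ?_
  rw [ofReal_integral_eq_lintegral_ofReal]
  · exact le_of_eq (by simp_rw [henn])
  · exact (hcc.integrableOn_Icc (a := -Real.pi) (b := Real.pi)).mono_set Ioo_subset_Icc_self
  · exact ae_of_all _ fun θ => by positivity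

/-! ### Restricted `A_∞` weights -/

lemma IsWeight.aemeasurable {w : ℂ → ℝ} (hw : IsWeight w) :
    AEMeasurable (fun z => ENNReal.ofReal (w z)) volume :=
  hw.locallyIntegrable.aestronglyMeasurable.aemeasurable.ennreal_ofReal

lemma IsWeight.setLIntegral_weightMeasure {w : ℂ → ℝ} (hw : IsWeight w) {g : ℂ → ℝ≥0∞}
    (hg : Measurable g) {s : Set ℂ} (hs : MeasurableSet s) :
    ∫⁻ z in s, g z ∂(weightMeasure w) = ∫⁻ z in s, ENNReal.ofReal (w z) * g z := by
  rw [weightMeasure, restrict_withDensity hs,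
    lintegral_withDensity_eq_lintegral_mul₀ hw.aemeasurable.restrict hg.aemeasurable]
  rfl

lemma weightMeasure_apply (w : ℂ → ℝ) {s : Set ℂ} (hs : MeasurableSet s) :
    weightMeasure w s = ∫⁻ z in s, ENNReal.ofReal (w z) := withDensity_apply _ hs

lemma IsWeight.weightMeasure_lt_top {w : ℂ → ℝ} (hw : IsWeight w) {s : Set ℂ}
    (hs : Bornology.IsBounded s) : weightMeasure w s < ∞ := by
  refine (measure_mono subset_closure).trans_lt ?_
  rw [weightMeasure_apply w isClosed_closure.measurableSet]
  have := (hw.locallyIntegrable.integrableOn_isCompact hs.isCompact_closure)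
  refine lt_of_le_of_lt ?_ this.2
  refine lintegral_mono fun z => ?_
  rw [← ofReal_norm]
  exact ENNReal.ofReal_le_ofReal (le_abs_self _)

instance (w : ℂ → ℝ) : SFinite (weightMeasure w) := by unfold weightMeasure; infer_instance

lemma measurableSet_square (c : ℂ) (r : ℝ) : MeasurableSet (square c r) := by
  refine IsClosed.measurableSet ?_
  have h1 : IsClosed {z : ℂ | |z.re - c.re| ≤ r / 2} :=
    isClosed_le (by fun_prop) continuous_const
  have h2 : IsClosed {z : ℂ | |z.im - c.im| ≤ r / 2} :=
    isClosed_le (by fun_prop) continuous_const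
  exact h1.inter h2

lemma ball_subset_square {b c : ℂ} {r ρ : ℝ} (h : ‖b - c‖ + ρ ≤ r / 2) :
    Metric.ball b ρ ⊆ square c r := by
  intro z hz
  rw [mem_ball_iff_norm] at hz
  have h3 : ‖z - c‖ ≤ r / 2 := by
    calc ‖z - c‖ = ‖(z - b) + (b - c)‖ := by ring_nf
      _ ≤ ‖z - b‖ + ‖b - c‖ := norm_add_le _ _
      _ ≤ r / 2 := by linarith
  exact ⟨by simpa using (Complex.abs_re_le_norm (z - c)).trans h3,
    by simpa using (Complex.abs_im_le_norm (z - c)).trans h3⟩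

lemma square_subset_ball {c : ℂ} {r : ℝ} (hr : 0 < r) : square c r ⊆ Metric.ball c (2 * r) := by
  intro z hz
  rw [mem_ball_iff_norm]
  have h1 := Complex.norm_le_abs_re_add_abs_im (z - c)
  simp only [Complex.sub_re, Complex.sub_im] at h1
  linarith [hz.1, hz.2]

lemma volume_ball_ne_zero {c : ℂ} {r : ℝ} (hr : 0 < r) : volume (Metric.ball c r) ≠ 0 :=
  (Metric.measure_ball_pos _ _ hr).ne'

lemma volume_ball_ne_top {c : ℂ} {r : ℝ} : volume (Metric.ball c r) ≠ ∞ :=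
  measure_ball_lt_top.ne

lemma volume_ball_eq (c : ℂ) (r : ℝ) : volume (Metric.ball c r) = volume (Metric.ball (0 : ℂ) r) := by
  rw [Complex.volume_ball, Complex.volume_ball]

lemma volume_square_inv_ge {c : ℂ} {r : ℝ} (hr : 0 < r) :
    (volume (Metric.ball (0 : ℂ) (2 * r)))⁻¹ ≤ (volume (square c r))⁻¹ := by
  rw [← volume_ball_eq c]
  exact ENNReal.inv_le_inv.2 (measure_mono (square_subset_ball hr))

/-- The dual form of the restricted `A_1` condition. -/
lemma exists_lintegral_le_of_aOneConst {w : ℂ → ℝ} (hw : IsWeight w) {r : ℝ} (hr : 0 < r)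
    (h : aOneConst r w < ∞) :
    ∃ C : ℝ≥0, ∀ (c : ℂ) (g : ℂ → ℝ≥0∞), Measurable g →
      (∫⁻ z in square c r, g z) * weightMeasure w (square c r) ≤
        C * ∫⁻ z in square c r, g z ∂(weightMeasure w) := by
  -- A lower bound for `1 / A(Q)` that does not depend on the center of the square.
  set a := (volume (Metric.ball (0 : ℂ) (2 * r)))⁻¹ with ha
  have ha0 : a ≠ 0 := ENNReal.inv_ne_zero.2 volume_ball_ne_top
  have hat : a ≠ ∞ := ENNReal.inv_ne_top.2 (volume_ball_ne_zero (by positivity))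
  refine ⟨(a⁻¹ * aOneConst r w).toNNReal, fun c g hg => ?_⟩
  rw [ENNReal.coe_toNNReal (ENNReal.mul_ne_top (ENNReal.inv_ne_top.2 ha0) h.ne)]
  set M := essSup (fun z => (ENNReal.ofReal (w z))⁻¹) (volume.restrict (square c r)) with hM
  have hc : a * weightMeasure w (square c r) * M ≤ aOneConst r w := by
    rw [weightMeasure_apply w (measurableSet_square c r)]
    refine le_trans ?_ (le_iSup _ c)
    gcongr
    exact volume_square_inv_ge hr
  by_cases h0 : weightMeasure w (square c r) = 0
  · simp [h0]
  have hMt : M ≠ ∞ := by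
    rintro hMt
    rw [hMt, ENNReal.mul_top (mul_ne_zero ha0 h0)] at hc
    exact h.not_ge hc
  have hle : ∫⁻ z in square c r, g z ≤ M * ∫⁻ z in square c r, g z ∂(weightMeasure w) := by
    rw [hw.setLIntegral_weightMeasure hg (measurableSet_square c r), ← lintegral_const_mul' _ _ hMt]
    refine lintegral_mono_ae ?_
    filter_upwards [ENNReal.ae_le_essSup (μ := volume.restrict (square c r))
      (fun z => (ENNReal.ofReal (w z))⁻¹)] with z hz
    have h1 : ENNReal.ofReal (w z) ≠ 0 := fun h1 => by
      rw [h1, ENNReal.inv_zero] at hz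
      exact hMt (top_le_iff.1 hz)
    calc g z = (ENNReal.ofReal (w z))⁻¹ * (ENNReal.ofReal (w z) * g z) := by
          rw [← mul_assoc, ENNReal.inv_mul_cancel h1 ENNReal.ofReal_ne_top, one_mul]
      _ ≤ M * (ENNReal.ofReal (w z) * g z) := by gcongr
  calc _ ≤ (M * ∫⁻ z in square c r, g z ∂(weightMeasure w)) * weightMeasure w (square c r) := by
        gcongr
    _ = a⁻¹ * (a * weightMeasure w (square c r) * M) *
          ∫⁻ z in square c r, g z ∂(weightMeasure w) := by
        rw [← mul_assoc a⁻¹, ← mul_assoc a⁻¹, ENNReal.inv_mul_cancel ha0 hat, one_mul]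
        ring
    _ ≤ _ := by gcongr

/-- The dual form of the restricted `A_p` condition for `1 < p`. -/
lemma exists_lintegral_le_of_apConst {w : ℂ → ℝ} (hw : IsWeight w) {r p : ℝ} (hr : 0 < r)
    (hp : 1 < p) (h : apConst p r w < ∞) :
    ∃ C : ℝ≥0, ∀ (c : ℂ) (g : ℂ → ℝ≥0∞), Measurable g →
      (∫⁻ z in square c r, g z ^ (1 / p)) ^ p * weightMeasure w (square c r) ≤
        C * ∫⁻ z in square c r, g z ∂(weightMeasure w) := by
  have hp0 : 0 < p := by linarith
  have hp1 : 0 < p - 1 := by linarith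
  set a := (volume (Metric.ball (0 : ℂ) (2 * r)))⁻¹ with ha
  have ha0 : a ≠ 0 := ENNReal.inv_ne_zero.2 volume_ball_ne_top
  have hat : a ≠ ∞ := ENNReal.inv_ne_top.2 (volume_ball_ne_zero (by positivity))
  have hap0 : a * a ^ (p - 1) ≠ 0 :=
    mul_ne_zero ha0 (ENNReal.rpow_pos (pos_iff_ne_zero.2 ha0) hat).ne'
  have hapt : a * a ^ (p - 1) ≠ ∞ :=
    ENNReal.mul_ne_top hat (ENNReal.rpow_ne_top_of_nonneg hp1.le hat)
  refine ⟨((a * a ^ (p - 1))⁻¹ * apConst p r w).toNNReal, fun c g hg => ?_⟩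
  rw [ENNReal.coe_toNNReal (ENNReal.mul_ne_top (ENNReal.inv_ne_top.2 hap0) h.ne)]
  set M := ∫⁻ z in square c r, ENNReal.ofReal (w z) ^ (-(1 / (p - 1))) with hM
  have hc : (a * a ^ (p - 1)) * (weightMeasure w (square c r) * M ^ (p - 1)) ≤ apConst p r w := by
    rw [weightMeasure_apply w (measurableSet_square c r)]
    refine le_trans ?_ (le_iSup _ c)
    calc _ = (a * ∫⁻ z in square c r, ENNReal.ofReal (w z)) * (a * M) ^ (p - 1) := by
          rw [ENNReal.mul_rpow_of_nonneg _ _ hp1.le]; ring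
      _ ≤ _ := by
          have := volume_square_inv_ge (c := c) hr
          gcongr
  by_cases h0 : weightMeasure w (square c r) = 0
  · simp [h0]
  have hMt : M ≠ ∞ := by
    rintro hMt
    rw [hMt, ENNReal.top_rpow_of_pos hp1, ENNReal.mul_top h0, ENNReal.mul_top hap0] at hc
    exact h.not_ge hc
  have hwm : AEMeasurable (fun z => ENNReal.ofReal (w z)) (volume.restrict (square c r)) :=
    hw.aemeasurable.restrict
  -- Finiteness of `M` forces `w > 0` almost everywhere on the square, so the factorization `g^{1/p}
  -- = (w g)^{1/p} w^{-1/p}` used in Hölder's inequality is legitimate.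
  have hpos : ∀ᵐ z ∂(volume.restrict (square c r)), ENNReal.ofReal (w z) ≠ 0 := by
    filter_upwards [ae_lt_top' (hwm.pow_const _) hMt] with z hz h1
    rw [h1, ENNReal.zero_rpow_of_neg (by rw [neg_lt_zero]; positivity)] at hz
    exact lt_irrefl _ hz
  have hconj : p.HolderConjugate (p / (p - 1)) := Real.HolderConjugate.conjExponent hp
  have hholder : ∫⁻ z in square c r, g z ^ (1 / p) ≤
      (∫⁻ z in square c r, g z ∂(weightMeasure w)) ^ (1 / p) * M ^ ((p - 1) / p) := by
    have h1 := ENNReal.lintegral_mul_le_Lp_mul_Lq (volume.restrict (square c r)) hconj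
      (f := fun z => (ENNReal.ofReal (w z) * g z) ^ (1 / p))
      (g := fun z => ENNReal.ofReal (w z) ^ (-(1 / p)))
      ((hwm.mul hg.aemeasurable).pow_const _) (hwm.pow_const _)
    have h2 : ∫⁻ z in square c r, ((ENNReal.ofReal (w z) * g z) ^ (1 / p)) ^ p =
        ∫⁻ z in square c r, g z ∂(weightMeasure w) := by
      rw [hw.setLIntegral_weightMeasure hg (measurableSet_square c r)]
      refine lintegral_congr fun z => ?_
      rw [← ENNReal.rpow_mul, one_div_mul_cancel hp0.ne', ENNReal.rpow_one]
    have h3 : ∫⁻ z in square c r, (ENNReal.ofReal (w z) ^ (-(1 / p))) ^ (p / (p - 1)) = M := by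
      refine lintegral_congr fun z => ?_
      rw [← ENNReal.rpow_mul]
      congr 1
      field_simp
    rw [h2, h3, one_div_div] at h1
    refine le_trans (lintegral_mono_ae ?_) h1
    filter_upwards [hpos] with z hz
    simp only [Pi.mul_apply]
    rw [ENNReal.mul_rpow_of_nonneg _ _ (by positivity), mul_comm, ← mul_assoc,
      ← ENNReal.rpow_add _ _ hz ENNReal.ofReal_ne_top]
    simp
  calc _ ≤ ((∫⁻ z in square c r, g z ∂(weightMeasure w)) ^ (1 / p) * M ^ ((p - 1) / p)) ^ p *
        weightMeasure w (square c r) := by gcongr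
    _ = (∫⁻ z in square c r, g z ∂(weightMeasure w)) *
        (weightMeasure w (square c r) * M ^ (p - 1)) := by
        rw [ENNReal.mul_rpow_of_nonneg _ _ hp0.le, ← ENNReal.rpow_mul, ← ENNReal.rpow_mul,
          one_div_mul_cancel hp0.ne', div_mul_cancel₀ _ hp0.ne', ENNReal.rpow_one]
        ring
    _ = (a * a ^ (p - 1))⁻¹ * ((a * a ^ (p - 1)) * (weightMeasure w (square c r) * M ^ (p - 1))) *
          ∫⁻ z in square c r, g z ∂(weightMeasure w) := by
        rw [← mul_assoc (a * a ^ (p - 1))⁻¹, ENNReal.inv_mul_cancel hap0 hapt, one_mul]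
        ring
    _ ≤ _ := by gcongr

lemma RestrictedAInfty.isWeight {w : ℂ → ℝ} (hw : RestrictedAInfty w) : IsWeight w :=
  hw.choose_spec.2.1

/-- The dual form of the restricted `A_∞` condition. -/
lemma RestrictedAInfty.exists_lintegral_le {w : ℂ → ℝ} (hw : RestrictedAInfty w) :
    ∃ p : ℝ, 1 ≤ p ∧ ∃ r : ℝ, 0 < r ∧ ∃ C : ℝ≥0, ∀ (c : ℂ) (g : ℂ → ℝ≥0∞), Measurable g →
      (∫⁻ z in square c r, g z ^ (1 / p)) ^ p * weightMeasure w (square c r) ≤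
        C * ∫⁻ z in square c r, g z ∂(weightMeasure w) := by
  obtain ⟨p, hp, hW, r, hr, ⟨rfl, h⟩ | ⟨hp1, h⟩⟩ := hw
  · obtain ⟨C, hC⟩ := exists_lintegral_le_of_aOneConst hW hr h
    exact ⟨1, le_rfl, r, hr, C, fun c g hg => by simpa using hC c g hg⟩
  · obtain ⟨C, hC⟩ := exists_lintegral_le_of_apConst hW hr hp1 h
    exact ⟨p, hp, r, hr, C, hC⟩

/-- The dual inequality is tested on the indicator of the disk, whose powers are itself. This local
doubling is the source of all later comparisons between weights of disks. -/
lemma RestrictedAInfty.exists_square_le_ball {w : ℂ → ℝ} (hw : RestrictedAInfty w) :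
    ∃ r : ℝ, 0 < r ∧ ∀ ρ : ℝ, 0 < ρ → ∃ K : ℝ≥0, ∀ b c : ℂ, ‖b - c‖ + ρ ≤ r / 2 →
      weightMeasure w (square c r) ≤ K * weightMeasure w (Metric.ball b ρ) := by
  obtain ⟨p, hp, r, hr, C, hC⟩ := hw.exists_lintegral_le
  have hp0 : 0 < p := by linarith
  refine ⟨r, hr, fun ρ hρ => ?_⟩
  set v := volume (Metric.ball (0 : ℂ) ρ) ^ p with hv
  have hv0 : v ≠ 0 :=
    (ENNReal.rpow_pos (pos_iff_ne_zero.2 (volume_ball_ne_zero hρ)) volume_ball_ne_top).ne'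
  have hvt : v ≠ ∞ := ENNReal.rpow_ne_top_of_nonneg hp0.le volume_ball_ne_top
  refine ⟨(v⁻¹ * C).toNNReal, fun b c hbc => ?_⟩
  rw [ENNReal.coe_toNNReal (ENNReal.mul_ne_top (ENNReal.inv_ne_top.2 hv0) ENNReal.coe_ne_top)]
  have hsub := ball_subset_square hbc
  have h1 := hC c ((Metric.ball b ρ).indicator 1) (measurable_one.indicator measurableSet_ball)
  have h2 : ∀ z, (Metric.ball b ρ).indicator (1 : ℂ → ℝ≥0∞) z ^ (1 / p) =
      (Metric.ball b ρ).indicator 1 z := fun z => by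
    by_cases hz : z ∈ Metric.ball b ρ
    · simp [hz]
    · simp [hz, hp0]
  simp_rw [h2] at h1
  rw [lintegral_indicator_one measurableSet_ball, lintegral_indicator_one measurableSet_ball,
    Measure.restrict_apply measurableSet_ball, Measure.restrict_apply measurableSet_ball,
    inter_eq_left.2 hsub, volume_ball_eq b] at h1
  calc weightMeasure w (square c r) = v⁻¹ * (v * weightMeasure w (square c r)) := by
        rw [← mul_assoc, ENNReal.inv_mul_cancel hv0 hvt, one_mul]
    _ ≤ v⁻¹ * (C * weightMeasure w (Metric.ball b ρ)) := by gcongr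
    _ = _ := by ring

/-- A restricted `A_∞` weight grows at most exponentially, in the sense of its values on squares,
and these are comparable to its values on concentric disks. -/
lemma RestrictedAInfty.exists_square_growth {w : ℂ → ℝ} (hw : RestrictedAInfty w) :
    ∃ r : ℝ, 0 < r ∧ (∀ ρ : ℝ, 0 < ρ → ∃ K : ℝ≥0, ∀ c : ℂ,
      weightMeasure w (square c r) ≤ K * weightMeasure w (Metric.ball c ρ)) ∧
    ∃ K : ℝ≥0, 1 ≤ K ∧ ∀ (n : ℕ) (z u : ℂ), ‖z - u‖ ≤ n * (r / 2) →
      weightMeasure w (square z r) ≤ K ^ n * weightMeasure w (square u r) := by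
  obtain ⟨r, hr, h⟩ := hw.exists_square_le_ball
  refine ⟨r, hr, fun ρ hρ => ?_, ?_⟩
  · obtain ⟨K, hK⟩ := h (min ρ (r / 2)) (by positivity)
    refine ⟨K, fun c => (hK c c (by simp)).trans ?_⟩
    gcongr
    exact min_le_left _ _
  · obtain ⟨K, hK⟩ := h (r / 4) (by positivity)
    -- Both squares contain the disk of radius `r / 4` about the midpoint of `z` and `u`.
    have hstep : ∀ z u : ℂ, ‖z - u‖ ≤ r / 2 →
        weightMeasure w (square z r) ≤ (max K 1 : ℝ≥0) * weightMeasure w (square u r) := by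
      intro z u hzu
      have e1 : ‖(z + u) / 2 - z‖ = ‖z - u‖ / 2 := by
        rw [show (z + u) / 2 - z = -((z - u) / 2) by ring, norm_neg, norm_div]; simp
      have e2 : ‖(z + u) / 2 - u‖ = ‖z - u‖ / 2 := by
        rw [show (z + u) / 2 - u = (z - u) / 2 by ring, norm_div]; simp
      refine (hK ((z + u) / 2) z (by linarith)).trans ?_
      gcongr
      · exact le_max_left _ _
      · exact ball_subset_square (by linarith)
    refine ⟨max K 1, le_max_right _ _, fun n => ?_⟩
    induction n with
    | zero =>
      intro z u hzu
      have : z = u := sub_eq_zero.1 (norm_le_zero_iff.1 (by simpa using hzu))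
      simp [this]
    | succ n ih =>
      intro z u hzu
      push_cast at hzu
      have hn : (0 : ℝ) < n + 1 := by positivity
      -- The last intermediate point when the segment from `u` to `z` is cut into `n + 1` equal
      -- steps.
      set v : ℂ := u + ((n / (n + 1) : ℝ) : ℂ) * (z - u) with hv
      have h1 : ‖v - u‖ ≤ n * (r / 2) := by
        rw [hv, add_sub_cancel_left, norm_mul, Complex.norm_real, Real.norm_of_nonneg (by positivity)]
        calc (n / (n + 1) : ℝ) * ‖z - u‖ ≤ (n / (n + 1) : ℝ) * ((n + 1) * (r / 2)) := by gcongr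
          _ = n * (r / 2) := by field_simp
      have h2 : ‖z - v‖ ≤ r / 2 := by
        have : z - v = ((1 / (n + 1) : ℝ) : ℂ) * (z - u) := by
          rw [hv]
          have : (n : ℂ) + 1 ≠ 0 := by exact_mod_cast hn.ne'
          push_cast
          field_simp
          ring
        rw [this, norm_mul, Complex.norm_real, Real.norm_of_nonneg (by positivity)]
        calc (1 / (n + 1) : ℝ) * ‖z - u‖ ≤ (1 / (n + 1) : ℝ) * ((n + 1) * (r / 2)) := by gcongr
          _ = r / 2 := by field_simp
      calc weightMeasure w (square z r) ≤ (max K 1 : ℝ≥0) * weightMeasure w (square v r) :=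
            hstep z v h2
        _ ≤ (max K 1 : ℝ≥0) * ((max K 1 : ℝ≥0) ^ n * weightMeasure w (square u r)) := by
            gcongr; exact ih v u h1
        _ = _ := by rw [pow_succ]; ring

/-- Upper bound for the weight of a disk by the weight of a square. -/
lemma RestrictedAInfty.exists_ball_le_square {w : ℂ → ℝ} {r : ℝ} (hr : 0 < r) {K : ℝ≥0}
    (hK : ∀ (n : ℕ) (z u : ℂ), ‖z - u‖ ≤ n * (r / 2) →
      weightMeasure w (square z r) ≤ K ^ n * weightMeasure w (square u r)) (R : ℝ) :
    ∃ C : ℝ≥0, ∀ z : ℂ, weightMeasure w (Metric.ball z R) ≤ C * weightMeasure w (square z r) := by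
  obtain ⟨t, -, ht⟩ := (isCompact_closedBall (0 : ℂ) R).elim_nhds_subcover
    (fun ζ => Metric.ball ζ (r / 2)) (fun ζ _ => Metric.ball_mem_nhds ζ (by positivity))
  have hn : ∀ ζ : ℂ, ∃ n : ℕ, ‖ζ‖ ≤ n * (r / 2) := fun ζ => by
    obtain ⟨n, hn⟩ := exists_nat_ge (‖ζ‖ / (r / 2))
    exact ⟨n, by rwa [div_le_iff₀ (by positivity)] at hn⟩
  choose n hn using hn
  refine ⟨∑ ζ ∈ t, K ^ n ζ, fun z => ?_⟩
  have hcov : Metric.ball z R ⊆ ⋃ ζ ∈ t, square (z + ζ) r := by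
    intro u hu
    have : u - z ∈ Metric.closedBall (0 : ℂ) R := by
      rw [mem_closedBall_zero_iff]; exact (mem_ball_iff_norm.1 hu).le
    obtain ⟨ζ, hζ, hζu⟩ := mem_iUnion₂.1 (ht this)
    refine mem_iUnion₂.2 ⟨ζ, hζ, ball_subset_square (b := z + ζ) (ρ := r / 2) (by simp) ?_⟩
    rw [mem_ball_iff_norm] at hζu ⊢
    rwa [show u - (z + ζ) = u - z - ζ by ring]
  calc weightMeasure w (Metric.ball z R) ≤ weightMeasure w (⋃ ζ ∈ t, square (z + ζ) r) :=
        measure_mono hcov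
    _ ≤ ∑ ζ ∈ t, weightMeasure w (square (z + ζ) r) := measure_biUnion_finset_le _ _
    _ ≤ ∑ ζ ∈ t, K ^ n ζ * weightMeasure w (square z r) := by
        gcongr with ζ hζ
        exact hK _ _ _ (by simpa using hn ζ)
    _ = _ := by rw [← Finset.sum_mul]; push_cast; rfl

/-- If one square were null, the growth bound would make every square null, and the weight would
vanish almost everywhere. -/
lemma RestrictedAInfty.square_pos {w : ℂ → ℝ} (hw : RestrictedAInfty w) {r : ℝ} (hr : 0 < r)
    {K : ℝ≥0} (hK : ∀ (n : ℕ) (z u : ℂ), ‖z - u‖ ≤ n * (r / 2) →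
      weightMeasure w (square z r) ≤ K ^ n * weightMeasure w (square u r)) (c : ℂ) :
    0 < weightMeasure w (square c r) := by
  refine pos_iff_ne_zero.2 fun h0 => hw.isWeight.not_ae_zero ?_
  have h1 : ∀ z, weightMeasure w (square z r) = 0 := fun z => by
    obtain ⟨n, hn⟩ := exists_nat_ge (‖z - c‖ / (r / 2))
    rw [div_le_iff₀ (by positivity)] at hn
    simpa [h0] using hK n z c hn
  have h2 : weightMeasure w univ = 0 := by
    refine measure_null_of_locally_null _ fun x _ => ⟨Metric.ball x (r / 2), ?_, ?_⟩
    · exact mem_nhdsWithin_of_mem_nhds (Metric.ball_mem_nhds x (by positivity))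
    · exact measure_mono_null (ball_subset_square (by simp)) (h1 x)
  rw [weightMeasure_apply w MeasurableSet.univ, Measure.restrict_univ,
    lintegral_eq_zero_iff' hw.isWeight.aemeasurable] at h2
  filter_upwards [h2] with z hz
  exact le_antisymm (by simpa using hz) (hw.isWeight.nonneg z)

lemma RestrictedAInfty.ball_pos {w : ℂ → ℝ} (hw : RestrictedAInfty w) (c : ℂ) {r : ℝ}
    (hr : 0 < r) : 0 < weightMeasure w (Metric.ball c r) := by
  obtain ⟨s, hs, h1, K, -, hK⟩ := hw.exists_square_growth
  obtain ⟨K', hK'⟩ := h1 r hr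
  refine pos_iff_ne_zero.2 fun h0 => (hw.square_pos hs hK c).ne' ?_
  simpa [h0] using hK' c

lemma RestrictedAInfty.ball_ne_zero {w : ℂ → ℝ} (hw : RestrictedAInfty w) (c : ℂ) {r : ℝ}
    (hr : 0 < r) : weightMeasure w (Metric.ball c r) ≠ 0 := (hw.ball_pos c hr).ne'

lemma RestrictedAInfty.ball_ne_top {w : ℂ → ℝ} (hw : RestrictedAInfty w) (c : ℂ) (r : ℝ) :
    weightMeasure w (Metric.ball c r) ≠ ∞ :=
  (hw.isWeight.weightMeasure_lt_top Metric.isBounded_ball).ne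

/-- Disks with radii and distance of centers in a bounded range have comparable weights. -/
lemma RestrictedAInfty.exists_ball_le_ball {w : ℂ → ℝ} (hw : RestrictedAInfty w)
    (R : ℝ) {r : ℝ} (hr : 0 < r) (d : ℝ) :
    ∃ C : ℝ≥0, ∀ z u : ℂ, ‖z - u‖ ≤ d →
      weightMeasure w (Metric.ball z R) ≤ C * weightMeasure w (Metric.ball u r) := by
  obtain ⟨s, hs, h1, K, hK1, hK⟩ := hw.exists_square_growth
  obtain ⟨K', hK'⟩ := h1 r hr
  obtain ⟨K'', hK''⟩ := RestrictedAInfty.exists_ball_le_square hs hK R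
  obtain ⟨n, hn⟩ := exists_nat_ge (d / (s / 2))
  rw [div_le_iff₀ (by positivity)] at hn
  refine ⟨K'' * (K ^ n * K'), fun z u hzu => ?_⟩
  calc _ ≤ K'' * weightMeasure w (square z s) := hK'' z
    _ ≤ K'' * (K ^ n * weightMeasure w (square u s)) := by
        gcongr; exact hK n z u (hzu.trans hn)
    _ ≤ K'' * (K ^ n * (K' * weightMeasure w (Metric.ball u r))) := by gcongr; exact hK' u
    _ = _ := by push_cast; ring

/-- The weight of unit disks grows at most exponentially. -/
lemma RestrictedAInfty.exists_ball_growth {w : ℂ → ℝ} (hw : RestrictedAInfty w) :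
    ∃ κ C : ℝ, 0 ≤ κ ∧ 0 ≤ C ∧ ∀ z u : ℂ, weightMeasure w (Metric.ball z 1) ≤
      ENNReal.ofReal (C * Real.exp (κ * ‖z - u‖)) * weightMeasure w (Metric.ball u 1) := by
  obtain ⟨s, hs, h1, K, hK1, hK⟩ := hw.exists_square_growth
  obtain ⟨K', hK'⟩ := h1 1 one_pos
  obtain ⟨K'', hK''⟩ := RestrictedAInfty.exists_ball_le_square hs hK 1
  have hK1' : (1 : ℝ) ≤ K := by exact_mod_cast hK1
  have hlog : 0 ≤ Real.log K := Real.log_nonneg hK1'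
  -- About `‖z - u‖ / (s / 2)` steps are needed, each costing a factor `K`; the extra `K` pays for
  -- rounding up.
  refine ⟨Real.log K / (s / 2), K'' * K * K', by positivity, by positivity, fun z u => ?_⟩
  set n := ⌈‖z - u‖ / (s / 2)⌉₊ with hn
  have hn1 : ‖z - u‖ ≤ n * (s / 2) := by
    rw [← div_le_iff₀ (by positivity)]; exact Nat.le_ceil _
  have hn2 : (n : ℝ) ≤ ‖z - u‖ / (s / 2) + 1 := (Nat.ceil_lt_add_one (by positivity)).le
  have hpow : (K : ℝ) ^ n ≤ K * Real.exp (Real.log K / (s / 2) * ‖z - u‖) := by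
    have hKpos : (0 : ℝ) < K := by linarith
    rw [← Real.exp_log (pow_pos hKpos n), Real.log_pow]
    nth_rewrite 2 [← Real.exp_log hKpos]
    rw [← Real.exp_add]
    refine Real.exp_le_exp.2 ?_
    calc n * Real.log K ≤ (‖z - u‖ / (s / 2) + 1) * Real.log K := by gcongr
      _ = _ := by ring
  calc _ ≤ K'' * weightMeasure w (square z s) := hK'' z
    _ ≤ K'' * (K ^ n * weightMeasure w (square u s)) := by
        gcongr; exact hK n z u hn1
    _ ≤ K'' * (K ^ n * (K' * weightMeasure w (Metric.ball u 1))) := by gcongr; exact hK' u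
    _ = ENNReal.ofReal (K'' * K ^ n * K') * weightMeasure w (Metric.ball u 1) := by
        rw [ENNReal.ofReal_mul (by positivity), ENNReal.ofReal_mul (by positivity),
          ENNReal.ofReal_pow (by positivity)]
        simp only [ENNReal.ofReal_coe_nnreal]
        ring
    _ ≤ _ := by
        refine mul_le_mul' (ENNReal.ofReal_le_ofReal ?_) le_rfl
        calc (K'' : ℝ) * K ^ n * K' ≤ K'' * (K * Real.exp (Real.log K / (s / 2) * ‖z - u‖)) * K' := by
              gcongr
          _ = _ := by ring

/-! ### The weighted sub-mean value property. -/

/-- The density `|f|² e^{-α|z|²}`. -/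
def fockDensity (α : ℝ) (f : ℂ → ℂ) (z : ℂ) : ℝ≥0∞ :=
  ‖f z‖ₑ ^ 2 * ENNReal.ofReal (Real.exp (-α * ‖z‖ ^ 2))

lemma measurable_fockDensity (α : ℝ) {f : ℂ → ℂ} (hf : Continuous f) :
    Measurable (fockDensity α f) := by
  unfold fockDensity
  exact (hf.enorm.measurable.pow_const 2).mul (by fun_prop)

lemma fockDensity_eq_ofReal (α : ℝ) (f : ℂ → ℂ) (z : ℂ) :
    fockDensity α f z = ENNReal.ofReal (‖f z‖ ^ 2 * Real.exp (-α * ‖z‖ ^ 2)) := by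
  rw [fockDensity, ENNReal.ofReal_mul (by positivity), ENNReal.ofReal_pow (by positivity),
    ofReal_norm]

/-- This is `|u - z|² = |u|² + |z|² - 2 Re(u z̄)`. It makes the Gaussian locally holomorphic: for
`u` near `z`, `|f(u)|² e^{-α|u|²}` is comparable, up to a factor depending on `z` alone, with the
squared modulus of the holomorphic function `f(u) e^{-αu z̄}`. -/
lemma norm_cexp_mul_conj (α : ℝ) (z u : ℂ) :
    ‖Complex.exp (-α * u * conj z)‖ ^ 2 =
      Real.exp (-α * ‖u‖ ^ 2) * Real.exp (-α * ‖z‖ ^ 2) * Real.exp (α * ‖u - z‖ ^ 2) := by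
  rw [Complex.norm_exp, ← Real.exp_nat_mul, ← Real.exp_add, ← Real.exp_add]
  congr 1
  have h := Complex.normSq_sub u z
  rw [Complex.normSq_eq_norm_sq, Complex.normSq_eq_norm_sq, Complex.normSq_eq_norm_sq] at h
  rw [h, mul_assoc]
  have : ((-α : ℂ) * (u * conj z)).re = -α * (u * conj z).re := by
    rw [← Complex.ofReal_neg, Complex.re_ofReal_mul]
  rw [this]; push_cast; ring

/-- The weighted sub-mean value property of entire functions. -/
lemma RestrictedAInfty.exists_fockDensity_le {w : ℂ → ℝ} (hw : RestrictedAInfty w) {α : ℝ}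
    (hα : 0 < α) {ρ : ℝ} (hρ : 0 < ρ) :
    ∃ C : ℝ≥0, ∀ f : ℂ → ℂ, Differentiable ℂ f → ∀ z : ℂ,
      fockDensity α f z * weightMeasure w (Metric.ball z 1) ≤
        C * ∫⁻ u in Metric.ball z ρ, fockDensity α f u ∂(weightMeasure w) := by
  obtain ⟨p, hp, r, hr, C, hC⟩ := hw.exists_lintegral_le
  have hp0 : 0 < p := by linarith
  set s := min ρ (r / 2) with hs
  have hs0 : 0 < s := by positivity
  obtain ⟨D, hD⟩ := hw.exists_ball_le_ball 1 (r := r / 2) (by positivity) 0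
  set v := volume (Metric.ball (0 : ℂ) s) ^ p with hv
  have hv0 : v ≠ 0 :=
    (ENNReal.rpow_pos (pos_iff_ne_zero.2 (volume_ball_ne_zero hs0)) volume_ball_ne_top).ne'
  have hvt : v ≠ ∞ := ENNReal.rpow_ne_top_of_nonneg hp0.le volume_ball_ne_top
  refine ⟨(D * v⁻¹ * C * ENNReal.ofReal (Real.exp (α * s ^ 2))).toNNReal, fun f hf z => ?_⟩
  rw [ENNReal.coe_toNNReal (by
    refine ENNReal.mul_ne_top (ENNReal.mul_ne_top (ENNReal.mul_ne_top ENNReal.coe_ne_top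
      (ENNReal.inv_ne_top.2 hv0)) ENNReal.coe_ne_top) ENNReal.ofReal_ne_top)]
  set F : ℂ → ℂ := fun u => f u * Complex.exp (-α * u * conj z) with hF
  have hFd : Differentiable ℂ F := hf.mul (by fun_prop)
  have hFn : ∀ u, ‖F u‖ₑ ^ 2 = fockDensity α f u *
      ENNReal.ofReal (Real.exp (-α * ‖z‖ ^ 2) * Real.exp (α * ‖u - z‖ ^ 2)) := fun u => by
    rw [fockDensity_eq_ofReal, ← ENNReal.ofReal_mul (by positivity), ← ofReal_norm,
      ← ENNReal.ofReal_pow (by positivity), hF, norm_mul, mul_pow, norm_cexp_mul_conj]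
    congr 1; ring
  have hsub : Metric.ball z s ⊆ square z r := ball_subset_square (by simp [hs])
  have hgm : Measurable ((Metric.ball z s).indicator fun u => ‖F u‖ₑ ^ 2) :=
    (hFd.continuous.enorm.measurable.pow_const 2).indicator measurableSet_ball
  have h1 := hC z _ hgm
  have h2 : ∀ u, (Metric.ball z s).indicator (fun u => ‖F u‖ₑ ^ 2) u ^ (1 / p) =
      (Metric.ball z s).indicator (fun u => ‖F u‖ₑ ^ (2 / p)) u := fun u => by
    by_cases hu : u ∈ Metric.ball z s
    · simp only [hu, indicator_of_mem]
      rw [← ENNReal.rpow_natCast, ← ENNReal.rpow_mul]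
      congr 1; push_cast; ring
    · simp [hu, hp0]
  simp_rw [h2] at h1
  rw [setLIntegral_indicator measurableSet_ball, setLIntegral_indicator measurableSet_ball,
    inter_eq_left.2 hsub] at h1
  -- The exponent `2 / p` may be less than `1`; this is why subharmonicity of `|F|^q` is needed for
  -- all `q > 0`.
  have h3 := volume_ball_mul_rpow_le_lintegral hFd (q := 2 / p) (by positivity) z s
  have h4 : v * ‖F z‖ₑ ^ 2 * weightMeasure w (square z r) ≤
      C * ∫⁻ u in Metric.ball z s, ‖F u‖ₑ ^ 2 ∂(weightMeasure w) := by
    refine le_trans ?_ h1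
    gcongr
    calc v * ‖F z‖ₑ ^ 2 = (volume (Metric.ball z s) * ‖F z‖ₑ ^ (2 / p)) ^ p := by
          rw [ENNReal.mul_rpow_of_nonneg _ _ hp0.le, ← ENNReal.rpow_mul, div_mul_cancel₀ _ hp0.ne',
            volume_ball_eq z, ← ENNReal.rpow_natCast]
          rfl
      _ ≤ _ := by gcongr
  have h5 : ∫⁻ u in Metric.ball z s, ‖F u‖ₑ ^ 2 ∂(weightMeasure w) ≤
      ENNReal.ofReal (Real.exp (-α * ‖z‖ ^ 2)) * (ENNReal.ofReal (Real.exp (α * s ^ 2)) *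
        ∫⁻ u in Metric.ball z ρ, fockDensity α f u ∂(weightMeasure w)) := by
    rw [← mul_assoc, ← ENNReal.ofReal_mul (by positivity)]
    calc _ ≤ ∫⁻ u in Metric.ball z s, ENNReal.ofReal
            (Real.exp (-α * ‖z‖ ^ 2) * Real.exp (α * s ^ 2)) * fockDensity α f u
              ∂(weightMeasure w) := by
          refine setLIntegral_mono' measurableSet_ball fun u hu => ?_
          rw [hFn, mul_comm]
          have : ‖u - z‖ ≤ s := (mem_ball_iff_norm.1 hu).le
          gcongr
      _ = ENNReal.ofReal (Real.exp (-α * ‖z‖ ^ 2) * Real.exp (α * s ^ 2)) *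
            ∫⁻ u in Metric.ball z s, fockDensity α f u ∂(weightMeasure w) :=
          lintegral_const_mul _ (measurable_fockDensity α hf.continuous)
      _ ≤ _ := by
          gcongr
          exact min_le_left _ _
  set e := ENNReal.ofReal (Real.exp (-α * ‖z‖ ^ 2)) with he
  have he0 : e ≠ 0 := by simp [he, Real.exp_pos]
  have het : e ≠ ∞ := ENNReal.ofReal_ne_top
  have h6 : ‖F z‖ₑ ^ 2 = fockDensity α f z * e := by
    rw [hFn]; simp [he]
  set I := ∫⁻ u in Metric.ball z ρ, fockDensity α f u ∂(weightMeasure w)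
  calc fockDensity α f z * weightMeasure w (Metric.ball z 1)
      ≤ fockDensity α f z * (D * weightMeasure w (square z r)) := by
        gcongr
        refine (hD z z (by simp)).trans ?_
        gcongr
        exact ball_subset_square (by simp)
    _ = D * v⁻¹ * e⁻¹ * (v * (fockDensity α f z * e) * weightMeasure w (square z r)) := by
        rw [show D * v⁻¹ * e⁻¹ * (v * (fockDensity α f z * e) * weightMeasure w (square z r)) =
          (v⁻¹ * v) * (e⁻¹ * e) * (fockDensity α f z * (D * weightMeasure w (square z r))) by ring,
          ENNReal.inv_mul_cancel hv0 hvt, ENNReal.inv_mul_cancel he0 het, one_mul, one_mul]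
    _ ≤ D * v⁻¹ * e⁻¹ * (C * (e * (ENNReal.ofReal (Real.exp (α * s ^ 2)) * I))) := by
        rw [h6] at h4
        exact mul_le_mul' le_rfl (h4.trans (mul_le_mul' le_rfl h5))
    _ = (e⁻¹ * e) * (D * v⁻¹ * C * ENNReal.ofReal (Real.exp (α * s ^ 2)) * I) := by ring
    _ = _ := by rw [ENNReal.inv_mul_cancel he0 het, one_mul]

/-- The inner product of an inner product space. (For complex spaces instance search may otherwise
find the one of the corresponding Hilbert C⋆-module, to which the lemmas on inner product spaces do
not apply syntactically.) -/
instance innerProductSpaceInner {H : Type*} [NormedAddCommGroup H] [InnerProductSpace ℂ H] :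
    Inner ℂ H := InnerProductSpace.toInner

/-! ### Averaging over disks -/

lemma measurableSet_dist_lt (ρ : ℝ) : MeasurableSet {p : ℂ × ℂ | dist p.2 p.1 < ρ} :=
  measurableSet_lt (by fun_prop) measurable_const

/-- Integrals over disks, integrated over their centers. -/
lemma lintegral_lintegral_ball {ν τ : Measure ℂ} [SFinite ν] [SFinite τ] {F : ℂ → ℝ≥0∞}
    (hF : Measurable F) (ρ : ℝ) :
    ∫⁻ u, ∫⁻ ξ in Metric.ball u ρ, F ξ ∂ν ∂τ = ∫⁻ ξ, F ξ * τ (Metric.ball ξ ρ) ∂ν := by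
  have h1 : ∀ u, ∫⁻ ξ in Metric.ball u ρ, F ξ ∂ν =
      ∫⁻ ξ, {p : ℂ × ℂ | dist p.2 p.1 < ρ}.indicator (fun p => F p.2) (u, ξ) ∂ν := fun u => by
    rw [← lintegral_indicator measurableSet_ball]; rfl
  simp_rw [h1]
  have h3 : Measurable (Function.uncurry fun u ξ : ℂ =>
      {p : ℂ × ℂ | dist p.2 p.1 < ρ}.indicator (fun p => F p.2) (u, ξ)) :=
    (hF.comp measurable_snd).indicator (measurableSet_dist_lt ρ)
  rw [lintegral_lintegral_swap h3.aemeasurable]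
  refine lintegral_congr fun ξ => ?_
  have h2 : ∀ u, {p : ℂ × ℂ | dist p.2 p.1 < ρ}.indicator (fun p => F p.2) (u, ξ) =
      (Metric.ball ξ ρ).indicator (fun _ => F ξ) u := fun u => by
    simp [indicator, dist_comm]
  simp_rw [h2]
  rw [lintegral_indicator_const measurableSet_ball]

lemma lintegral_lintegral_ball_volume {ν : Measure ℂ} [SFinite ν] {F : ℂ → ℝ≥0∞}
    (hF : Measurable F) (ρ : ℝ) : ∫⁻ u, ∫⁻ ξ in Metric.ball u ρ, F ξ ∂ν =
      volume (Metric.ball (0 : ℂ) ρ) * ∫⁻ ξ, F ξ ∂ν := by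
  rw [lintegral_lintegral_ball hF, ← lintegral_const_mul _ hF]
  refine lintegral_congr fun ξ => ?_
  rw [volume_ball_eq ξ, mul_comm]

lemma measurable_measure_ball (ν : Measure ℂ) [SFinite ν] (ρ : ℝ) :
    Measurable fun z => ν (Metric.ball z ρ) :=
  measurable_measure_prodMk_left (measurableSet_dist_lt ρ)

/-- The Gaussian average of a restricted `A_∞` weight. -/
lemma RestrictedAInfty.exists_gaussian_le {w : ℂ → ℝ} (hw : RestrictedAInfty w) {α : ℝ}
    (hα : 0 < α) : ∃ C : ℝ≥0, ∀ z : ℂ,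
      ∫⁻ ξ, ENNReal.ofReal (Real.exp (-α * ‖ξ - z‖ ^ 2)) ∂(weightMeasure w) ≤
        C * weightMeasure w (Metric.ball z 1) := by
  obtain ⟨κ, C, hκ, hC, hgr⟩ := hw.exists_ball_growth
  -- For `ξ ∈ D(u,1)`, `-α|ξ - z|² ≤ α - (α/2)|u - z|²`. Half of this Gaussian decay absorbs the
  -- growth of the weight, by `κt ≤ (α/4)t² + κ²/α`; the other half remains integrable.
  set A := C * Real.exp (α + κ ^ 2 / α) with hA
  have hint : Integrable (fun u : ℂ => Real.exp (-(α / 4) * ‖u‖ ^ 2)) := by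
    have h := GaussianFourier.integrable_cexp_neg_mul_sq_norm_add (V := ℂ) (b := ((α / 4 : ℝ) : ℂ))
      (by rw [Complex.ofReal_re]; positivity) 0 0
    refine h.norm.congr (ae_of_all _ fun u => ?_)
    simp [Complex.norm_exp]
    norm_cast
    simp
  set I := ∫⁻ u : ℂ, ENNReal.ofReal (Real.exp (-(α / 4) * ‖u‖ ^ 2)) with hI
  have hIt : I ≠ ∞ := by
    have := hint.2
    rw [hasFiniteIntegral_iff_ofReal (ae_of_all _ fun u => (Real.exp_pos _).le)] at this
    exact this.ne
  set v := volume (Metric.ball (0 : ℂ) 1) with hv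
  have hv0 : v ≠ 0 := volume_ball_ne_zero one_pos
  have hvt : v ≠ ∞ := volume_ball_ne_top
  refine ⟨(v⁻¹ * (ENNReal.ofReal A * I)).toNNReal, fun z => ?_⟩
  rw [ENNReal.coe_toNNReal (ENNReal.mul_ne_top (ENNReal.inv_ne_top.2 hv0)
    (ENNReal.mul_ne_top ENNReal.ofReal_ne_top hIt))]
  set J := ∫⁻ ξ, ENNReal.ofReal (Real.exp (-α * ‖ξ - z‖ ^ 2)) ∂(weightMeasure w) with hJ
  have h1 : v * J ≤ ENNReal.ofReal A * I * weightMeasure w (Metric.ball z 1) := by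
    rw [hv, hJ, ← lintegral_lintegral_ball_volume (by fun_prop)]
    have h2 : ∀ u, ∫⁻ ξ in Metric.ball u 1, ENNReal.ofReal (Real.exp (-α * ‖ξ - z‖ ^ 2))
        ∂(weightMeasure w) ≤ ENNReal.ofReal A * ENNReal.ofReal (Real.exp (-(α / 4) * ‖u - z‖ ^ 2)) *
          weightMeasure w (Metric.ball z 1) := fun u => by
      calc _ ≤ ∫⁻ ξ in Metric.ball u 1, ENNReal.ofReal (Real.exp (α - α / 2 * ‖u - z‖ ^ 2))
              ∂(weightMeasure w) := by
            refine setLIntegral_mono' measurableSet_ball fun ξ hξ => ?_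
            refine ENNReal.ofReal_le_ofReal (Real.exp_le_exp.2 ?_)
            have h3 : ‖u - ξ‖ < 1 := by rw [norm_sub_rev]; exact mem_ball_iff_norm.1 hξ
            have h4 : ‖u - z‖ ≤ ‖u - ξ‖ + ‖ξ - z‖ := by
              simpa using norm_add_le (u - ξ) (ξ - z)
            have h5 : ‖u - z‖ ^ 2 ≤ 2 + 2 * ‖ξ - z‖ ^ 2 := by
              nlinarith [sq_nonneg (‖ξ - z‖ - 1), norm_nonneg (u - z), norm_nonneg (ξ - z),
                norm_nonneg (u - ξ)]
            nlinarith
        _ = ENNReal.ofReal (Real.exp (α - α / 2 * ‖u - z‖ ^ 2)) *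
              weightMeasure w (Metric.ball u 1) := by rw [setLIntegral_const]
        _ ≤ ENNReal.ofReal (Real.exp (α - α / 2 * ‖u - z‖ ^ 2)) *
              (ENNReal.ofReal (C * Real.exp (κ * ‖u - z‖)) *
                weightMeasure w (Metric.ball z 1)) := by gcongr; exact hgr u z
        _ ≤ _ := by
            rw [← mul_assoc, ← ENNReal.ofReal_mul (by positivity),
              ← ENNReal.ofReal_mul (by positivity)]
            refine mul_le_mul' (ENNReal.ofReal_le_ofReal ?_) le_rfl
            rw [hA, mul_left_comm, mul_assoc, ← Real.exp_add, ← Real.exp_add]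
            refine mul_le_mul_of_nonneg_left (Real.exp_le_exp.2 ?_) hC
            have h6 : κ * ‖u - z‖ ≤ α / 4 * ‖u - z‖ ^ 2 + κ ^ 2 / α := by
              have : 0 ≤ (α / 2 * ‖u - z‖ - κ) ^ 2 / α := by positivity
              have h7 : (α / 2 * ‖u - z‖ - κ) ^ 2 / α =
                  α / 4 * ‖u - z‖ ^ 2 - κ * ‖u - z‖ + κ ^ 2 / α := by field_simp; ring
              linarith
            linarith
    refine (lintegral_mono h2).trans (le_of_eq ?_)
    rw [lintegral_mul_const _ (by fun_prop), lintegral_const_mul _ (by fun_prop)]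
    congr 2
    exact lintegral_sub_right_eq_self
      (fun u : ℂ => ENNReal.ofReal (Real.exp (-(α / 4) * ‖u‖ ^ 2))) z
  calc J = v⁻¹ * (v * J) := by rw [← mul_assoc, ENNReal.inv_mul_cancel hv0 hvt, one_mul]
    _ ≤ v⁻¹ * (ENNReal.ofReal A * I * weightMeasure w (Metric.ball z 1)) := by gcongr
    _ = _ := by ring

/-! ### The weighted Fock space -/

lemma differentiable_entireRep {α : ℝ} {w : ℂ → ℝ} (f : FockSpace α w) :
    Differentiable ℂ (entireRep f) := (Classical.choose_spec f.2).1

lemma coeFn_ae_eq_entireRep {α : ℝ} {w : ℂ → ℝ} (f : FockSpace α w) :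
    (f : Lp ℂ 2 (fockMeasure α w)) =ᵐ[fockMeasure α w] entireRep f :=
  (Classical.choose_spec f.2).2

lemma measurable_fockDensity_entireRep {α : ℝ} {w : ℂ → ℝ} (f : FockSpace α w) :
    Measurable (fockDensity α (entireRep f)) :=
  measurable_fockDensity α (differentiable_entireRep f).continuous

lemma IsWeight.fockMeasure_eq {w : ℂ → ℝ} (hw : IsWeight w) (α : ℝ) :
    fockMeasure α w = (weightMeasure w).withDensity
      fun z => ENNReal.ofReal (Real.exp (-α * ‖z‖ ^ 2)) := by
  rw [fockMeasure, weightMeasure, ← withDensity_mul₀ hw.aemeasurable (by fun_prop)]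
  congr 1
  funext z
  rw [Pi.mul_apply, ENNReal.ofReal_mul (Real.exp_pos _).le, mul_comm]

lemma IsWeight.lintegral_fockMeasure {w : ℂ → ℝ} (hw : IsWeight w) (α : ℝ) {f : ℂ → ℂ}
    (hf : Continuous f) :
    ∫⁻ z, ‖f z‖ₑ ^ 2 ∂(fockMeasure α w) = ∫⁻ z, fockDensity α f z ∂(weightMeasure w) := by
  rw [hw.fockMeasure_eq, lintegral_withDensity_eq_lintegral_mul _ (by fun_prop)
    (hf.enorm.measurable.pow_const 2)]
  refine lintegral_congr fun z => ?_
  rw [Pi.mul_apply, fockDensity, mul_comm]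

/-- The norm of the Fock space. -/
lemma IsWeight.lintegral_fockDensity {w : ℂ → ℝ} (hw : IsWeight w) {α : ℝ} (f : FockSpace α w) :
    ∫⁻ z, fockDensity α (entireRep f) z ∂(weightMeasure w) = ‖f‖ₑ ^ 2 := by
  rw [← hw.lintegral_fockMeasure α (differentiable_entireRep f).continuous]
  have h1 : ‖f‖ₑ = eLpNorm (entireRep f) 2 (fockMeasure α w) := by
    rw [← eLpNorm_congr_ae (coeFn_ae_eq_entireRep f)]
    exact Lp.enorm_def (f : Lp ℂ 2 (fockMeasure α w))
  rw [h1, eLpNorm_eq_lintegral_rpow_enorm_toReal (by norm_num) (by norm_num),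
    ← ENNReal.rpow_natCast, ← ENNReal.rpow_mul]
  simp

section Fock

variable {α : ℝ} {w : ℂ → ℝ}

/-- Two entire functions that agree almost everywhere with respect to the Fock measure agree. -/
lemma RestrictedAInfty.eq_of_ae_eq (hw : RestrictedAInfty w) (hα : 0 < α) {f g : ℂ → ℂ}
    (hf : Differentiable ℂ f) (hg : Differentiable ℂ g) (h : f =ᵐ[fockMeasure α w] g) : f = g := by
  obtain ⟨C, hC⟩ := hw.exists_fockDensity_le hα one_pos
  have h1 : ∫⁻ z, fockDensity α (f - g) z ∂(weightMeasure w) = 0 := by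
    rw [← hw.isWeight.lintegral_fockMeasure α (hf.sub hg).continuous]
    rw [lintegral_eq_zero_iff' ((hf.sub hg).continuous.enorm.measurable.pow_const 2).aemeasurable]
    filter_upwards [h] with z hz
    simp [hz]
  funext z
  have h2 := hC _ (hf.sub hg) z
  have h3 : ∫⁻ u in Metric.ball z 1, fockDensity α (f - g) u ∂(weightMeasure w) = 0 :=
    le_antisymm ((setLIntegral_le_lintegral _ _).trans h1.le) zero_le
  rw [h3, mul_zero] at h2
  have h4 := (mul_eq_zero.1 (le_antisymm h2 zero_le)).resolve_right (hw.ball_ne_zero z one_pos)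
  rw [fockDensity_eq_ofReal, ENNReal.ofReal_eq_zero] at h4
  have h5 := (Real.exp_pos (-α * ‖z‖ ^ 2))
  have h6 : ‖(f - g) z‖ ^ 2 ≤ 0 := by nlinarith [sq_nonneg ‖(f - g) z‖]
  have h7 : ‖(f - g) z‖ = 0 := by nlinarith [norm_nonneg ((f - g) z)]
  exact sub_eq_zero.1 (norm_eq_zero.1 h7)

lemma RestrictedAInfty.entireRep_eq (hw : RestrictedAInfty w) (hα : 0 < α) {f : FockSpace α w}
    {g : ℂ → ℂ} (hg : Differentiable ℂ g)
    (h : (f : Lp ℂ 2 (fockMeasure α w)) =ᵐ[fockMeasure α w] g) : entireRep f = g :=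
  hw.eq_of_ae_eq hα (differentiable_entireRep f) hg ((coeFn_ae_eq_entireRep f).symm.trans h)

lemma RestrictedAInfty.entireRep_add (hw : RestrictedAInfty w) (hα : 0 < α)
    (f g : FockSpace α w) : entireRep (f + g) = entireRep f + entireRep g :=
  hw.entireRep_eq hα ((differentiable_entireRep f).add (differentiable_entireRep g))
    ((Lp.coeFn_add _ _).trans ((coeFn_ae_eq_entireRep f).add (coeFn_ae_eq_entireRep g)))

lemma RestrictedAInfty.entireRep_smul (hw : RestrictedAInfty w) (hα : 0 < α)
    (c : ℂ) (f : FockSpace α w) : entireRep (c • f) = c • entireRep f :=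
  hw.entireRep_eq hα ((differentiable_entireRep f).const_smul c)
    ((Lp.coeFn_smul _ _).trans ((coeFn_ae_eq_entireRep f).const_smul c))

/-- The passage to the entire representative, as a linear map. -/
def RestrictedAInfty.toEntire (hw : RestrictedAInfty w) (hα : 0 < α) :
    FockSpace α w →ₗ[ℂ] ℂ → ℂ where
  toFun := entireRep
  map_add' := hw.entireRep_add hα
  map_smul' := hw.entireRep_smul hα

lemma RestrictedAInfty.entireRep_sub (hw : RestrictedAInfty w) (hα : 0 < α)
    (f g : FockSpace α w) : entireRep (f - g) = entireRep f - entireRep g :=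
  (hw.toEntire hα).map_sub f g

/-- An entire function with finite weighted norm belongs to the Fock space. -/
lemma RestrictedAInfty.exists_entireRep_eq (hw : RestrictedAInfty w) (hα : 0 < α) {g : ℂ → ℂ}
    (hg : Differentiable ℂ g) (h : ∫⁻ z, fockDensity α g z ∂(weightMeasure w) ≠ ∞) :
    ∃ f : FockSpace α w, entireRep f = g := by
  have hm : MemLp g 2 (fockMeasure α w) := by
    refine ⟨hg.continuous.aestronglyMeasurable, ?_⟩
    rw [eLpNorm_lt_top_iff_lintegral_rpow_enorm_lt_top (by norm_num) (by norm_num)]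
    rw [← hw.isWeight.lintegral_fockMeasure α hg.continuous] at h
    simpa using lt_top_iff_ne_top.2 h
  exact ⟨⟨hm.toLp g, g, hg, hm.coeFn_toLp⟩, hw.entireRep_eq hα hg hm.coeFn_toLp⟩

/-- The pointwise estimate in the Fock space. -/
lemma RestrictedAInfty.exists_pointwise_le (hw : RestrictedAInfty w) (hα : 0 < α) :
    ∃ C : ℝ≥0, ∀ (f : FockSpace α w) (z : ℂ),
      fockDensity α (entireRep f) z * weightMeasure w (Metric.ball z 1) ≤ C * ‖f‖ₑ ^ 2 := by
  obtain ⟨C, hC⟩ := hw.exists_fockDensity_le hα one_pos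
  refine ⟨C, fun f z => (hC _ (differentiable_entireRep f) z).trans ?_⟩
  rw [← hw.isWeight.lintegral_fockDensity f]
  exact mul_le_mul' le_rfl (setLIntegral_le_lintegral _ _)

/-- Point evaluations are bounded, uniformly on bounded sets. -/
lemma RestrictedAInfty.exists_norm_entireRep_le (hw : RestrictedAInfty w) (hα : 0 < α) (R : ℝ) :
    ∃ M : ℝ, 0 ≤ M ∧ ∀ (f : FockSpace α w) (z : ℂ), ‖z‖ ≤ R → ‖entireRep f z‖ ≤ M * ‖f‖ := by
  obtain ⟨C, hC⟩ := hw.exists_pointwise_le hα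
  obtain ⟨D, hD⟩ := hw.exists_ball_le_ball 1 one_pos R
  set v := (weightMeasure w (Metric.ball (0 : ℂ) 1)).toReal with hv
  have hvp : 0 < v := ENNReal.toReal_pos (hw.ball_ne_zero _ one_pos) (hw.ball_ne_top _ _)
  refine ⟨Real.sqrt (Real.exp (α * R ^ 2) * D * C / v), Real.sqrt_nonneg _, fun f z hz => ?_⟩
  have h1 := hC f z
  have h2 := hD 0 z (by simpa using hz)
  have h3 : fockDensity α (entireRep f) z * weightMeasure w (Metric.ball (0 : ℂ) 1) ≤
      D * C * ‖f‖ₑ ^ 2 := by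
    calc _ ≤ fockDensity α (entireRep f) z * (D * weightMeasure w (Metric.ball z 1)) := by gcongr
      _ = D * (fockDensity α (entireRep f) z * weightMeasure w (Metric.ball z 1)) := by ring
      _ ≤ D * (C * ‖f‖ₑ ^ 2) := by gcongr
      _ = _ := by ring
  rw [← ENNReal.ofReal_toReal (hw.ball_ne_top 0 1), ← hv, fockDensity_eq_ofReal,
    ← ENNReal.ofReal_mul (by positivity), ← ofReal_norm, ← ENNReal.ofReal_coe_nnreal,
    ← ENNReal.ofReal_coe_nnreal, ← ENNReal.ofReal_mul (by positivity),
    ← ENNReal.ofReal_pow (by positivity), ← ENNReal.ofReal_mul (by positivity),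
    ENNReal.ofReal_le_ofReal_iff (by positivity)] at h3
  rw [← Real.sqrt_sq (norm_nonneg f), ← Real.sqrt_mul (by positivity)]
  refine Real.le_sqrt_of_sq_le ?_
  rw [div_mul_eq_mul_div, le_div_iff₀ hvp]
  have h4 : Real.exp (-α * R ^ 2) ≤ Real.exp (-α * ‖z‖ ^ 2) := by
    refine Real.exp_le_exp.2 ?_
    have : ‖z‖ ^ 2 ≤ R ^ 2 := by gcongr
    nlinarith
  have h5 : Real.exp (α * R ^ 2) * Real.exp (-α * R ^ 2) = 1 := by
    rw [← Real.exp_add]; simp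
  calc ‖entireRep f z‖ ^ 2 * v
      = Real.exp (α * R ^ 2) * (‖entireRep f z‖ ^ 2 * Real.exp (-α * R ^ 2) * v) := by
        rw [show Real.exp (α * R ^ 2) * (‖entireRep f z‖ ^ 2 * Real.exp (-α * R ^ 2) * v) =
          (Real.exp (α * R ^ 2) * Real.exp (-α * R ^ 2)) * (‖entireRep f z‖ ^ 2 * v) by ring, h5,
          one_mul]
    _ ≤ Real.exp (α * R ^ 2) * (‖entireRep f z‖ ^ 2 * Real.exp (-α * ‖z‖ ^ 2) * v) := by gcongr
    _ ≤ Real.exp (α * R ^ 2) * (D * C * ‖f‖ ^ 2) := by gcongr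
    _ = _ := by ring

/-- The Fock space is closed in the weighted Lebesgue space. -/
lemma RestrictedAInfty.isClosed_fockSpace (hw : RestrictedAInfty w) (hα : 0 < α) :
    IsClosed (FockSpace α w : Set (Lp ℂ 2 (fockMeasure α w))) := by
  refine IsSeqClosed.isClosed fun F f hF hf => ?_
  set g : ℕ → FockSpace α w := fun n => ⟨F n, hF n⟩ with hg
  have hgn : ∀ n m, ‖g n - g m‖ = ‖F n - F m‖ := fun n m => rfl
  have hcau : CauchySeq g := by
    have h1 := hf.cauchySeq
    rw [Metric.cauchySeq_iff] at h1 ⊢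
    exact h1
  have hlim : ∀ z, ∃ y, Tendsto (fun n => entireRep (g n) z) atTop (𝓝 y) := fun z => by
    refine cauchySeq_tendsto_of_complete ?_
    obtain ⟨M, hM0, hM⟩ := hw.exists_norm_entireRep_le hα ‖z‖
    rw [Metric.cauchySeq_iff] at hcau ⊢
    intro ε hε
    obtain ⟨N, hN⟩ := hcau (ε / (M + 1)) (by positivity)
    refine ⟨N, fun m hm n hn => ?_⟩
    have h2 := hM (g m - g n) z le_rfl
    rw [hw.entireRep_sub hα, Pi.sub_apply, ← dist_eq_norm, ← dist_eq_norm] at h2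
    have h3 := hN m hm n hn
    rw [lt_div_iff₀ (by positivity)] at h3
    nlinarith [dist_nonneg (x := g m) (y := g n)]
  choose G hG using hlim
  have hbound : ∀ R : ℝ, ∃ M : ℝ, 0 ≤ M ∧ ∀ n z, ‖z‖ ≤ R →
      ‖entireRep (g n) z - G z‖ ≤ M * ‖F n - f‖ := fun R => by
    obtain ⟨M, hM0, hM⟩ := hw.exists_norm_entireRep_le hα R
    refine ⟨M, hM0, fun n z hz => ?_⟩
    have h1 : Tendsto (fun m => ‖entireRep (g n) z - entireRep (g m) z‖) atTop
        (𝓝 ‖entireRep (g n) z - G z‖) := (tendsto_const_nhds.sub (hG z)).norm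
    have h2 : Tendsto (fun m => M * ‖F n - F m‖) atTop (𝓝 (M * ‖F n - f‖)) :=
      ((tendsto_const_nhds.sub hf).norm).const_mul M
    refine le_of_tendsto_of_tendsto' h1 h2 fun m => ?_
    have h3 := hM (g n - g m) z hz
    rwa [hw.entireRep_sub hα, Pi.sub_apply, hgn] at h3
  -- Norm convergence is locally uniform convergence of the representatives, so the pointwise limit
  -- is entire.
  have hdiff : Differentiable ℂ G := by
    have h1 : TendstoLocallyUniformlyOn (fun n => entireRep (g n)) G atTop univ := by
      rw [tendstoLocallyUniformlyOn_iff_forall_isCompact isOpen_univ]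
      intro K _ hK
      obtain ⟨R, hR⟩ := hK.isBounded.exists_norm_le
      obtain ⟨M, hM0, hM⟩ := hbound R
      rw [Metric.tendstoUniformlyOn_iff]
      intro ε hε
      have h2 : Tendsto (fun n => M * ‖F n - f‖) atTop (𝓝 0) := by
        simpa using ((hf.sub_const f).norm).const_mul M
      filter_upwards [h2.eventually (gt_mem_nhds hε)] with n hn z hz
      rw [dist_comm, dist_eq_norm]
      exact (hM n z (hR z hz)).trans_lt hn
    have h2 := h1.differentiableOn (Eventually.of_forall fun n =>
      (differentiable_entireRep (g n)).differentiableOn) isOpen_univ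
    exact fun z => (h2 z (mem_univ z)).differentiableAt univ_mem
  refine ⟨G, hdiff, ?_⟩
  -- An almost everywhere convergent subsequence identifies the `L²` limit with `G`.
  have hmeas : TendstoInMeasure (fockMeasure α w) (fun n => ((F n : Lp ℂ 2 _) : ℂ → ℂ)) atTop f :=
    tendstoInMeasure_of_tendsto_Lp hf
  obtain ⟨ns, hns, hae⟩ := hmeas.exists_seq_tendsto_ae
  have hall : ∀ᵐ z ∂(fockMeasure α w), ∀ n, (F n : ℂ → ℂ) z = entireRep (g n) z :=
    ae_all_iff.2 fun n => coeFn_ae_eq_entireRep (g n)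
  filter_upwards [hae, hall] with z hz1 hz2
  simp_rw [hz2] at hz1
  exact tendsto_nhds_unique hz1 ((hG z).comp hns.tendsto_atTop)

lemma RestrictedAInfty.completeSpace (hw : RestrictedAInfty w) (hα : 0 < α) :
    CompleteSpace (FockSpace α w) :=
  (hw.isClosed_fockSpace hα).completeSpace_coe

/-- The reproducing property. -/
lemma RestrictedAInfty.entireRep_eq_inner (hw : RestrictedAInfty w) (hα : 0 < α) (z : ℂ)
    (f : FockSpace α w) : entireRep f z = inner ℂ (reproKernel α w z) f := by
  have := hw.completeSpace hα
  have hex : ∃ B : FockSpace α w, ∀ f : FockSpace α w, entireRep f z = inner ℂ B f := by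
    obtain ⟨M, hM0, hM⟩ := hw.exists_norm_entireRep_le hα ‖z‖
    let E : FockSpace α w →L[ℂ] ℂ :=
      ((LinearMap.proj z).comp (hw.toEntire hα)).mkContinuous M fun f => hM f z le_rfl
    refine ⟨(InnerProductSpace.toDual ℂ _).symm E, fun f => ?_⟩
    rw [InnerProductSpace.toDual_symm_apply]
    rfl
  rw [reproKernel, dif_pos hex]
  exact Classical.choose_spec hex f

end Fock

/-! ### Estimates of the reproducing kernel -/

section Kernel

variable {α : ℝ} {w : ℂ → ℝ}

lemma RestrictedAInfty.entireRep_reproKernel_self (hw : RestrictedAInfty w) (hα : 0 < α) (z : ℂ) :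
    entireRep (reproKernel α w z) z = ((‖reproKernel α w z‖ ^ 2 : ℝ) : ℂ) := by
  rw [hw.entireRep_eq_inner hα, inner_self_eq_norm_sq_to_K]
  norm_cast

lemma RestrictedAInfty.norm_entireRep_le (hw : RestrictedAInfty w) (hα : 0 < α) (z : ℂ)
    (f : FockSpace α w) : ‖entireRep f z‖ ≤ ‖reproKernel α w z‖ * ‖f‖ := by
  rw [hw.entireRep_eq_inner hα]
  exact norm_inner_le_norm _ _

/-- The functions `e^{α ξ conj z}` belong to the Fock space. -/
lemma RestrictedAInfty.exists_exponential (hw : RestrictedAInfty w) (hα : 0 < α) :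
    ∃ C : ℝ≥0, ∀ z : ℂ, ∃ f : FockSpace α w, (entireRep f = fun ξ => Complex.exp (α * ξ * conj z)) ∧
      ‖f‖ₑ ^ 2 ≤ ENNReal.ofReal (Real.exp (α * ‖z‖ ^ 2)) *
        (C * weightMeasure w (Metric.ball z 1)) := by
  obtain ⟨C, hC⟩ := hw.exists_gaussian_le hα
  refine ⟨C, fun z => ?_⟩
  set g : ℂ → ℂ := fun ξ => Complex.exp (α * ξ * conj z) with hg
  have hgd : Differentiable ℂ g := by fun_prop
  have hnorm : ∀ ξ, fockDensity α g ξ = ENNReal.ofReal (Real.exp (α * ‖z‖ ^ 2)) *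
      ENNReal.ofReal (Real.exp (-α * ‖ξ - z‖ ^ 2)) := fun ξ => by
    have h1 := norm_cexp_mul_conj (-α) z ξ
    push_cast at h1
    rw [neg_neg] at h1
    rw [fockDensity_eq_ofReal, ← ENNReal.ofReal_mul (by positivity), hg, h1, neg_neg]
    congr 1
    rw [← Real.exp_add, ← Real.exp_add, ← Real.exp_add, ← Real.exp_add]
    congr 1; ring
  have hint : ∫⁻ ξ, fockDensity α g ξ ∂(weightMeasure w) ≤
      ENNReal.ofReal (Real.exp (α * ‖z‖ ^ 2)) * (C * weightMeasure w (Metric.ball z 1)) := by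
    simp_rw [hnorm]
    rw [lintegral_const_mul _ (by fun_prop)]
    gcongr
    exact hC z
  obtain ⟨f, hf⟩ := hw.exists_entireRep_eq hα hgd (ne_top_of_le_ne_top (ENNReal.mul_ne_top
    ENNReal.ofReal_ne_top (ENNReal.mul_ne_top ENNReal.coe_ne_top (hw.ball_ne_top z 1))) hint)
  refine ⟨f, hf, ?_⟩
  rw [← hw.isWeight.lintegral_fockDensity f, hf]
  exact hint

/-- Two-sided estimate of the norm of the reproducing kernel. -/
lemma RestrictedAInfty.exists_norm_reproKernel (hw : RestrictedAInfty w) (hα : 0 < α) :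
    ∃ c C : ℝ, 0 < c ∧ 0 < C ∧ ∀ z : ℂ,
      c ≤ ‖reproKernel α w z‖ ^ 2 * Real.exp (-α * ‖z‖ ^ 2) *
        (weightMeasure w (Metric.ball z 1)).toReal ∧
      ‖reproKernel α w z‖ ^ 2 * Real.exp (-α * ‖z‖ ^ 2) *
        (weightMeasure w (Metric.ball z 1)).toReal ≤ C := by
  obtain ⟨C, hC⟩ := hw.exists_pointwise_le hα
  obtain ⟨D, hD⟩ := hw.exists_exponential hα
  refine ⟨(D + 1 : ℝ)⁻¹, C + 1, by positivity, by positivity, fun z => ?_⟩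
  set v := (weightMeasure w (Metric.ball z 1)).toReal with hv
  have hvp : 0 < v := ENNReal.toReal_pos (hw.ball_ne_zero _ one_pos) (hw.ball_ne_top _ _)
  have hv' : weightMeasure w (Metric.ball z 1) = ENNReal.ofReal v :=
    (ENNReal.ofReal_toReal (hw.ball_ne_top z 1)).symm
  set N := ‖reproKernel α w z‖ with hN
  have hE : Real.exp (α * ‖z‖ ^ 2) * Real.exp (-α * ‖z‖ ^ 2) = 1 := by
    rw [← Real.exp_add]; simp
  have hE0 := Real.exp_pos (α * ‖z‖ ^ 2)
  have hE1 := Real.exp_pos (-α * ‖z‖ ^ 2)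
  -- The test function `e^{αξ z̄}` takes the value `e^{α|z|²}` at `z`, while its squared norm is at
  -- most `D e^{α|z|²} w(D(z,1))`.
  have hlow : 1 ≤ D * (N ^ 2 * Real.exp (-α * ‖z‖ ^ 2) * v) := by
    obtain ⟨f, hf, hfn⟩ := hD z
    have h1 := hw.norm_entireRep_le hα z f
    have h2 : ‖entireRep f z‖ = Real.exp (α * ‖z‖ ^ 2) := by
      rw [hf]
      simp only
      rw [Complex.norm_exp, mul_assoc, Complex.re_ofReal_mul, Complex.mul_conj,
        Complex.normSq_eq_norm_sq, Complex.ofReal_re]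
    rw [h2] at h1
    have h3 : ‖f‖ ^ 2 ≤ Real.exp (α * ‖z‖ ^ 2) * (D * v) := by
      rw [hv', ← ENNReal.ofReal_coe_nnreal, ← ENNReal.ofReal_mul (by positivity),
        ← ENNReal.ofReal_mul (by positivity), ← ofReal_norm, ← ENNReal.ofReal_pow (by positivity),
        ENNReal.ofReal_le_ofReal_iff (by positivity)] at hfn
      exact hfn
    have h4 : Real.exp (α * ‖z‖ ^ 2) ^ 2 ≤ N ^ 2 * (Real.exp (α * ‖z‖ ^ 2) * (D * v)) := by
      calc Real.exp (α * ‖z‖ ^ 2) ^ 2 ≤ (N * ‖f‖) ^ 2 := by gcongr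
        _ = N ^ 2 * ‖f‖ ^ 2 := by ring
        _ ≤ _ := by gcongr
    have h5 : Real.exp (α * ‖z‖ ^ 2) ≤ N ^ 2 * (D * v) := by
      refine le_of_mul_le_mul_left ?_ hE0
      nlinarith
    calc (1 : ℝ) = Real.exp (α * ‖z‖ ^ 2) * Real.exp (-α * ‖z‖ ^ 2) := hE.symm
      _ ≤ N ^ 2 * (D * v) * Real.exp (-α * ‖z‖ ^ 2) := by gcongr
      _ = _ := by ring
  have hNpos : 0 < N ^ 2 * Real.exp (-α * ‖z‖ ^ 2) * v := by
    by_contra hcon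
    have : D * (N ^ 2 * Real.exp (-α * ‖z‖ ^ 2) * v) ≤ 0 :=
      mul_nonpos_of_nonneg_of_nonpos D.2 (not_lt.1 hcon)
    linarith
  constructor
  · rw [inv_le_iff_one_le_mul₀ (by positivity)]
    nlinarith
  -- The pointwise estimate for `B_z` at `z` itself, where `B_z(z) = ‖B_z‖²`; one factor `‖B_z‖²`
  -- cancels.
  · have h1 := hC (reproKernel α w z) z
    rw [fockDensity_eq_ofReal, hv', ← ENNReal.ofReal_mul (by positivity), ← ofReal_norm,
      ← ENNReal.ofReal_coe_nnreal, ← ENNReal.ofReal_pow (by positivity),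
      ← ENNReal.ofReal_mul (by positivity), ENNReal.ofReal_le_ofReal_iff (by positivity),
      hw.entireRep_reproKernel_self hα, Complex.norm_real, Real.norm_of_nonneg (by positivity)] at h1
    have hN2 : 0 < N ^ 2 := by
      rcases eq_or_lt_of_le (sq_nonneg N) with h | h
      · rw [← h] at hNpos; simp at hNpos
      · exact h
    have h2 : N ^ 2 * Real.exp (-α * ‖z‖ ^ 2) * v ≤ C := by
      refine le_of_mul_le_mul_left ?_ hN2
      nlinarith
    linarith

lemma RestrictedAInfty.norm_reproKernel_pos (hw : RestrictedAInfty w) (hα : 0 < α) (z : ℂ) :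
    0 < ‖reproKernel α w z‖ := by
  obtain ⟨c, C, hc, -, h⟩ := hw.exists_norm_reproKernel hα
  refine (norm_nonneg _).lt_of_ne' fun h0 => ?_
  have := (h z).1
  rw [h0] at this
  simp at this
  linarith

/-- A lower bound of the reproducing kernel near the diagonal. -/
lemma RestrictedAInfty.exists_isKernelRadius (hw : RestrictedAInfty w) (hα : 0 < α) :
    ∃ δ : ℝ, IsKernelRadius α w δ := by
  obtain ⟨c, C, hc, hC, hN⟩ := hw.exists_norm_reproKernel hα
  obtain ⟨D, hD⟩ := hw.exists_ball_le_ball 1 one_pos 1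
  set v : ℂ → ℝ := fun z => (weightMeasure w (Metric.ball z 1)).toReal with hv
  have hvp : ∀ z, 0 < v z := fun z =>
    ENNReal.toReal_pos (hw.ball_ne_zero _ one_pos) (hw.ball_ne_top _ _)
  have hvD : ∀ a z, ‖a - z‖ ≤ 1 → v a ≤ D * v z := fun a z h => by
    have := ENNReal.toReal_mono (ENNReal.mul_ne_top ENNReal.coe_ne_top (hw.ball_ne_top _ _))
      (hD a z h)
    simpa using this
  set M := Real.sqrt (C ^ 2 * D * Real.exp α) with hM
  have hM0 : 0 ≤ M := Real.sqrt_nonneg _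
  -- For `|z - a| < 1`, `|G a z|` is comparable to `|B_a(z)| e^{-α(|a|²+|z|²)/2}` and is holomorphic
  -- in `z`: bounded by `M / w(D(a,1))` there, and at least `c / w(D(a,1))` at `z = a`.
  set G : ℂ → ℂ → ℂ := fun a z => entireRep (reproKernel α w a) z * Complex.exp (-α * z * conj a)
    with hG
  have hGd : ∀ a, Differentiable ℂ (G a) := fun a =>
    (differentiable_entireRep _).mul (by fun_prop)
  have hGn : ∀ a z, ‖G a z‖ ^ 2 = ‖entireRep (reproKernel α w a) z‖ ^ 2 *
      (Real.exp (-α * ‖z‖ ^ 2) * Real.exp (-α * ‖a‖ ^ 2) * Real.exp (α * ‖z - a‖ ^ 2)) :=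
    fun a z => by rw [hG, norm_mul, mul_pow, norm_cexp_mul_conj]
  have hGup : ∀ a z, ‖z - a‖ < 1 → ‖G a z‖ * v a ≤ M := fun a z hz => by
    refine Real.le_sqrt_of_sq_le ?_
    have h1 := hw.norm_entireRep_le hα z (reproKernel α w a)
    have h2 : ‖z - a‖ ^ 2 ≤ 1 := by nlinarith [norm_nonneg (z - a)]
    have h3 := hvD a z (by rw [norm_sub_rev]; exact hz.le)
    have h4 : Real.exp (α * ‖z - a‖ ^ 2) ≤ Real.exp α := by
      refine Real.exp_le_exp.2 ?_; nlinarith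
    have hva := hvp a
    have hvz := hvp z
    calc (‖G a z‖ * v a) ^ 2 = ‖entireRep (reproKernel α w a) z‖ ^ 2 *
          (Real.exp (-α * ‖z‖ ^ 2) * Real.exp (-α * ‖a‖ ^ 2) * Real.exp (α * ‖z - a‖ ^ 2)) *
          v a ^ 2 := by rw [mul_pow, hGn]
      _ ≤ (‖reproKernel α w z‖ * ‖reproKernel α w a‖) ^ 2 *
          (Real.exp (-α * ‖z‖ ^ 2) * Real.exp (-α * ‖a‖ ^ 2) * Real.exp α) *
          (v a * (D * v z)) := by
          rw [sq (v a)]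
          gcongr
      _ = (‖reproKernel α w z‖ ^ 2 * Real.exp (-α * ‖z‖ ^ 2) * v z) *
          (‖reproKernel α w a‖ ^ 2 * Real.exp (-α * ‖a‖ ^ 2) * v a) * (D * Real.exp α) := by ring
      _ ≤ C * C * (D * Real.exp α) := by
          gcongr
          · exact (hN z).2
          · exact (hN a).2
      _ = _ := by ring
  have hGlow : ∀ a, c ≤ ‖G a a‖ * v a := fun a => by
    have h1 : ‖G a a‖ = ‖reproKernel α w a‖ ^ 2 * Real.exp (-α * ‖a‖ ^ 2) := by
      rw [← sq_eq_sq₀ (norm_nonneg _) (by positivity), hGn, hw.entireRep_reproKernel_self hα,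
        Complex.norm_real, Real.norm_of_nonneg (by positivity)]
      simp
      ring
    rw [h1]
    exact (hN a).1
  have hcM : c ≤ M := (hGlow 0).trans (hGup 0 0 (by simp))
  have hM1 : 0 < M := hc.trans_le hcM
  -- By the Schwarz lemma `G a` moves by at most `3M |z - a| / w(D(a,1))` from its value at `a`; for
  -- `|z - a| < δ` this is at most half of the lower bound there.
  set δ := c / (6 * M) with hδ
  have hδ0 : 0 < δ := by positivity
  have hδ1 : δ < 1 := by rw [hδ, div_lt_one (by positivity)]; linarith
  have hlow : ∀ a z, ‖z - a‖ < δ → c / 2 ≤ ‖G a z‖ * v a := fun a z hz => by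
    have hva := hvp a
    have hmaps : MapsTo (G a) (Metric.ball a 1) (Metric.closedBall (G a a) (3 * M / v a)) := by
      intro u hu
      rw [mem_ball_iff_norm] at hu
      rw [mem_closedBall_iff_norm, le_div_iff₀ hva]
      have h1 := hGup a u hu
      have h2 := hGup a a (by simp)
      have h3 := norm_sub_le (G a u) (G a a)
      nlinarith
    have hz1 : z ∈ Metric.ball a 1 := by rw [mem_ball_iff_norm]; linarith
    have h4 := Complex.dist_le_div_mul_dist_of_mapsTo_ball (hGd a).differentiableOn hmaps hz1
    rw [div_one, dist_eq_norm, dist_eq_norm] at h4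
    have h5 : ‖G a z - G a a‖ * v a ≤ c / 2 := by
      calc ‖G a z - G a a‖ * v a ≤ 3 * M / v a * ‖z - a‖ * v a := by gcongr
        _ = 3 * M * ‖z - a‖ := by field_simp
        _ ≤ 3 * M * δ := by gcongr
        _ = c / 2 := by rw [hδ]; field_simp; norm_num
    have h6 : ‖G a a‖ ≤ ‖G a z‖ + ‖G a z - G a a‖ := by
      have := norm_sub_le (G a z) (G a z - G a a)
      simpa using this
    have h7 := hGlow a
    nlinarith
  refine ⟨δ, hδ0, hδ1, fun r hr => ?_⟩
  obtain ⟨D', hD'⟩ := hw.exists_ball_le_ball 1 hr 0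
  -- `D' + 1` passes from `D(a,1)` to `D(a,r)`; `e^{-α/2}` pays for the factor `e^{α|z-a|²/2}` in
  -- the modulus of `G`.
  refine ⟨c / 2 / (D' + 1) * Real.exp (-α / 2), by positivity, fun a z hz => ?_⟩
  rw [mem_ball_iff_norm] at hz
  have h1 := hlow a z hz
  set y := (weightMeasure w (Metric.ball a r)).toReal with hy
  have hyp : 0 < y := ENNReal.toReal_pos (hw.ball_ne_zero _ hr) (hw.ball_ne_top _ _)
  have hvy : v a ≤ (D' + 1) * y := by
    have := ENNReal.toReal_mono (ENNReal.mul_ne_top ENNReal.coe_ne_top (hw.ball_ne_top _ _))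
      (hD' a a (by simp))
    rw [ENNReal.toReal_mul, ENNReal.coe_toReal] at this
    nlinarith
  have h2 : c / 2 ≤ ‖G a z‖ * ((D' + 1) * y) := h1.trans (by gcongr)
  have hva := hvp a
  have hz2 : ‖z - a‖ ^ 2 ≤ 1 := by nlinarith [norm_nonneg (z - a)]
  have h4 : ‖entireRep (reproKernel α w a) z‖ ^ 2 =
      ‖G a z‖ ^ 2 * (Real.exp (α * ‖z‖ ^ 2 + α * ‖a‖ ^ 2 - α * ‖z - a‖ ^ 2)) := by
    rw [hGn, ← Real.exp_add, ← Real.exp_add, mul_assoc, ← Real.exp_add]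
    ring_nf
    simp
  refine (sq_le_sq₀ (by positivity) (norm_nonneg _)).1 ?_
  rw [h4]
  calc (c / 2 / (D' + 1) * Real.exp (-α / 2) *
        (Real.exp (α / 2 * ‖a‖ ^ 2 + α / 2 * ‖z‖ ^ 2) / y)) ^ 2
      = (c / 2 / ((D' + 1) * y)) ^ 2 * Real.exp (α * ‖z‖ ^ 2 + α * ‖a‖ ^ 2 - α) := by
        have : Real.exp (α * ‖z‖ ^ 2 + α * ‖a‖ ^ 2 - α) =
            (Real.exp (-α / 2) * Real.exp (α / 2 * ‖a‖ ^ 2 + α / 2 * ‖z‖ ^ 2)) ^ 2 := by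
          rw [← Real.exp_add, ← Real.exp_nat_mul]; congr 1; push_cast; ring
        rw [this]
        field_simp
    _ ≤ ‖G a z‖ ^ 2 * Real.exp (α * ‖z‖ ^ 2 + α * ‖a‖ ^ 2 - α * ‖z - a‖ ^ 2) := by
        have h5 : c / 2 / ((D' + 1) * y) ≤ ‖G a z‖ := by
          rw [div_le_iff₀ (by positivity)]; exact h2
        have h6 : α * ‖z - a‖ ^ 2 ≤ α := by nlinarith
        gcongr

/-- The Fock space is infinite-dimensional: it contains the exponentials `e^{nαξ}`. -/
lemma RestrictedAInfty.not_finiteDimensional (hw : RestrictedAInfty w) (hα : 0 < α) :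
    ¬ FiniteDimensional ℂ (FockSpace α w) := by
  intro hfin
  obtain ⟨C, hC⟩ := hw.exists_exponential hα
  choose f hf _ using hC
  -- The exponentials are characters of `(ℂ, +)`, distinct because they take the values `eⁿ` at
  -- `1/α`; distinct characters are linearly independent.
  let χ : ℕ → Multiplicative ℂ →* ℂ := fun n =>
    { toFun := fun ξ => Complex.exp (α * ξ.toAdd * n)
      map_one' := by simp
      map_mul' := fun x y => by simp [mul_add, add_mul, Complex.exp_add] }
  have hχ : Function.Injective χ := by
    intro m n hmn
    have h1 : Complex.exp (α * ((α⁻¹ : ℝ) : ℂ) * m) = Complex.exp (α * ((α⁻¹ : ℝ) : ℂ) * n) :=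
      DFunLike.congr_fun hmn (Multiplicative.ofAdd ((α⁻¹ : ℝ) : ℂ))
    have h2 : (α : ℂ) * ((α⁻¹ : ℝ) : ℂ) = 1 := by
      rw [← Complex.ofReal_mul, mul_inv_cancel₀ hα.ne', Complex.ofReal_one]
    rw [h2, one_mul, one_mul, ← Complex.ofReal_natCast, ← Complex.ofReal_natCast,
      ← Complex.ofReal_exp, ← Complex.ofReal_exp] at h1
    exact_mod_cast Real.exp_injective (Complex.ofReal_injective h1)
  have hli : LinearIndependent ℂ fun n : ℕ => (χ n : Multiplicative ℂ → ℂ) :=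
    (linearIndependent_monoidHom (Multiplicative ℂ) ℂ).comp χ hχ
  have hli' : LinearIndependent ℂ fun n : ℕ => f (n : ℂ) := by
    refine LinearIndependent.of_comp (hw.toEntire hα) ?_
    have h3 : (hw.toEntire hα) ∘ (fun n : ℕ => f (n : ℂ)) =
        fun n : ℕ => ((χ n : Multiplicative ℂ → ℂ) : ℂ → ℂ) := by
      funext n
      change entireRep (f n) = _
      rw [hf]
      funext ξ
      simp only [Complex.conj_natCast]
      rfl
    rw [h3]
    exact hli
  exact not_finite_iff_infinite.2 (inferInstance : Infinite ℕ) hli'.finite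

/-- The reproducing kernels span a dense subspace. -/
lemma RestrictedAInfty.dense_span_reproKernel (hw : RestrictedAInfty w) (hα : 0 < α) :
    Dense (Submodule.span ℂ (range (reproKernel α w)) : Set (FockSpace α w)) := by
  have := hw.completeSpace hα
  rw [Submodule.dense_iff_topologicalClosure_eq_top, Submodule.topologicalClosure_eq_top_iff,
    Submodule.eq_bot_iff]
  intro f hf
  rw [Submodule.mem_orthogonal] at hf
  have h1 : entireRep f = 0 := by
    funext z
    rw [hw.entireRep_eq_inner hα]
    exact hf _ (Submodule.subset_span ⟨z, rfl⟩)
  have h2 := hw.isWeight.lintegral_fockDensity f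
  rw [h1] at h2
  have h3 : ‖f‖ₑ ^ 2 = 0 := by
    rw [← h2]; simp [fockDensity]
  exact enorm_eq_zero.1 (pow_eq_zero_iff two_ne_zero |>.1 h3)

end Kernel

/-! ### Canonical decomposition of a positive compact operator -/

section Spectral

variable {H : Type*} [NormedAddCommGroup H] [InnerProductSpace ℂ H]

/-- A positive compact operator on a nontrivial Hilbert space has its norm as an eigenvalue. -/
lemma exists_unit_eigenvector [CompleteSpace H] [Nontrivial H] {S : H →L[ℂ] H}
    (hS : IsCompactOperator S) (hsymm : S.IsSymmetric) (hpos : ∀ x, 0 ≤ (inner ℂ (S x) x).re) :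
    ∃ v : H, ‖v‖ = 1 ∧ S v = (‖S‖ : ℂ) • v := by
  have hunit : ∀ v : H, v ≠ 0 → S v = (‖S‖ : ℂ) • v →
      ∃ v : H, ‖v‖ = 1 ∧ S v = (‖S‖ : ℂ) • v := fun v hv h => by
    refine ⟨((‖v‖⁻¹ : ℝ) : ℂ) • v, ?_, ?_⟩
    · rw [norm_smul, Complex.norm_real, Real.norm_of_nonneg (by positivity),
        inv_mul_cancel₀ (norm_ne_zero_iff.2 hv)]
    · rw [map_smul, h, smul_comm]
  by_cases h0 : S = 0
  · obtain ⟨v, hv⟩ := exists_ne (0 : H)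
    exact hunit v hv (by simp [h0])
  have hne : (‖S‖ : ℂ) ≠ 0 := by exact_mod_cast norm_ne_zero_iff.2 h0
  -- By compactness `‖S‖` is an eigenvalue or a regular point. In the second case the Rayleigh
  -- quotients stay below `‖S‖ - ε`, but for a symmetric operator the supremum of their moduli is
  -- `‖S‖`.
  have heig : Module.End.HasEigenvalue (S : Module.End ℂ H) (‖S‖ : ℂ) := by
    refine (hS.hasEigenvalue_or_mem_resolventSet hne).resolve_right fun hres => ?_
    obtain ⟨ε, hε, hle⟩ := S.rayleighQuotient_le_of_norm_mem_resolventSet hres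
    have h1 := S.norm_eq_iSup_rayleighQuotient hsymm
    have h2 : ⨆ x, |S.rayleighQuotient x| ≤ ‖S‖ - ε := ciSup_le fun x => by
      rw [abs_of_nonneg]
      · exact hle x
      · refine div_nonneg ?_ (by positivity)
        exact hpos x
    linarith
  obtain ⟨v, hv⟩ := heig.exists_hasEigenvector
  exact hunit v hv.2 hv.apply_eq_smul

/-- An eigenvector of a positive compact operator that is orthogonal to a given invariant
finite-dimensional subspace, with the largest possible eigenvalue. -/
lemma exists_eigenvector_orthogonal [CompleteSpace H] (hH : ¬ FiniteDimensional ℂ H)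
    {T : H →L[ℂ] H} (hT : IsCompactOperator T) (hsymm : T.IsSymmetric)
    (hpos : ∀ x, 0 ≤ (inner ℂ (T x) x).re) (U : Submodule ℂ H) [FiniteDimensional ℂ U]
    (hU : ∀ x ∈ U, T x ∈ U) :
    ∃ (v : H) (s : ℝ), v ∈ Uᗮ ∧ ‖v‖ = 1 ∧ 0 ≤ s ∧ T v = (s : ℂ) • v ∧
      ∀ x ∈ Uᗮ, ‖T x‖ ≤ s * ‖x‖ := by
  have hinv : ∀ x ∈ Uᗮ, T x ∈ Uᗮ := fun x hx => by
    rw [Submodule.mem_orthogonal] at hx ⊢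
    intro u hu
    have h1 : inner ℂ (T u) x = inner ℂ u (T x) := hsymm u x
    rw [← h1]
    exact hx _ (hU u hu)
  have hnt : Nontrivial Uᗮ := by
    rw [Submodule.nontrivial_iff_ne_bot]
    intro h
    have h1 : U = ⊤ := by rwa [Submodule.orthogonal_eq_bot_iff] at h
    refine hH ?_
    have : FiniteDimensional ℂ (⊤ : Submodule ℂ H) := h1 ▸ inferInstance
    exact Module.finite_def.2 (Module.Finite.iff_fg.1 this)
  let S : Uᗮ →L[ℂ] Uᗮ := T.restrict hinv
  have hSapp : ∀ x : Uᗮ, ((S x : Uᗮ) : H) = T x := fun x => rfl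
  have hSc : IsCompactOperator S := hT.restrict' hinv
  have hSs : S.IsSymmetric := hsymm.restrict_invariant hinv
  obtain ⟨v, hv1, hv2⟩ := exists_unit_eigenvector hSc hSs fun x => hpos x
  refine ⟨v, ‖S‖, v.2, hv1, S.opNorm_nonneg, ?_, fun x hx => ?_⟩
  · rw [← hSapp, hv2]; rfl
  · exact S.le_opNorm ⟨x, hx⟩

/-- A positive compact operator on an infinite-dimensional Hilbert space has a sequence of singular
values. -/
theorem exists_isSingularValueSeq [CompleteSpace H] (hH : ¬ FiniteDimensional ℂ H)
    {T : H →L[ℂ] H} (hT : IsCompactOperator T) (hsymm : T.IsSymmetric)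
    (hpos : ∀ x, 0 ≤ (inner ℂ (T x) x).re) : ∃ s, IsSingularValueSeq T s := by
  -- Starting from `⊥`, the subspace is enlarged repeatedly by a top eigenvector of `T` on its
  -- orthogonal complement. The eigenvalue `0` is allowed, so the process never stops, even for
  -- finite rank.
  let A := {U : Submodule ℂ H // FiniteDimensional ℂ U ∧ ∀ x ∈ U, T x ∈ U}
  have hstep : ∀ U : A, ∃ (v : H) (s : ℝ), v ∈ (U : Submodule ℂ H)ᗮ ∧ ‖v‖ = 1 ∧ 0 ≤ s ∧
      T v = (s : ℂ) • v ∧ ∀ x ∈ (U : Submodule ℂ H)ᗮ, ‖T x‖ ≤ s * ‖x‖ := fun U => by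
    have := U.2.1
    exact exists_eigenvector_orthogonal hH hT hsymm hpos U.1 U.2.2
  choose v σ hv hv1 hσ0 hTv hbd using hstep
  let next : A → A := fun U => ⟨U.1 ⊔ Submodule.span ℂ {v U}, by
    have := U.2.1
    infer_instance, fun x hx => by
    obtain ⟨y, hy, z, hz, rfl⟩ := Submodule.mem_sup.1 hx
    obtain ⟨c, rfl⟩ := Submodule.mem_span_singleton.1 hz
    rw [map_add, map_smul, hTv]
    exact Submodule.add_mem_sup (U.2.2 y hy) (Submodule.smul_mem _ _ (Submodule.smul_mem _ _
      (Submodule.mem_span_singleton_self _)))⟩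
  let U : ℕ → A := fun n => next^[n] ⟨⊥, inferInstance, fun x hx => by
    rw [(Submodule.mem_bot ℂ).1 hx, map_zero]; exact Submodule.zero_mem _⟩
  have hUs : ∀ n, (U (n + 1)).1 = (U n).1 ⊔ Submodule.span ℂ {v (U n)} := fun n => by
    simp only [U, Function.iterate_succ_apply']
    rfl
  have hU0 : (U 0).1 = ⊥ := rfl
  have hUmono : Monotone fun n => (U n).1 := monotone_nat_of_le_succ fun n => by
    rw [hUs]; exact le_sup_left
  set e : ℕ → H := fun n => v (U n) with he
  set s : ℕ → ℝ := fun n => σ (U n) with hs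
  have heU : ∀ n, e n ∈ (U (n + 1)).1 := fun n => by
    rw [hUs]; exact Submodule.mem_sup_right (Submodule.mem_span_singleton_self _)
  have heo : ∀ {n m}, n ≤ m → e m ∈ (U n).1ᗮ := fun {n m} h =>
    Submodule.orthogonal_le (hUmono h) (hv (U m))
  have hTe : ∀ n, T (e n) = (s n : ℂ) • e n := fun n => hTv (U n)
  have hs0 : ∀ n, 0 ≤ s n := fun n => hσ0 (U n)
  have horth : Orthonormal ℂ e := by
    refine ⟨fun n => hv1 (U n), fun n m hnm => ?_⟩
    rcases lt_or_gt_of_ne hnm with h | h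
    · exact (Submodule.mem_orthogonal _ _).1 (heo (Nat.succ_le_of_lt h)) _ (heU n)
    · exact (Submodule.mem_orthogonal' _ _).1 (heo (Nat.succ_le_of_lt h)) _ (heU m)
  have hnT : ∀ n, ‖T (e n)‖ = s n := fun n => by
    rw [hTe, norm_smul, horth.1, mul_one, Complex.norm_real, Real.norm_of_nonneg (hs0 n)]
  have hanti : Antitone s := antitone_nat_of_succ_le fun n => by
    have h1 := hbd (U n) (e (n + 1)) (heo n.le_succ)
    rw [hnT, horth.1, mul_one] at h1
    exact h1
  have hlim : Tendsto s atTop (𝓝 0) := by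
    have hbb : BddBelow (range s) := ⟨0, by rintro _ ⟨n, rfl⟩; exact hs0 n⟩
    have h1 := tendsto_atTop_ciInf hanti hbb
    set L := ⨅ n, s n with hL
    have hLs : ∀ n, L ≤ s n := fun n => ciInf_le hbb n
    have hL0 : 0 ≤ L := le_ciInf hs0
    obtain h | h := hL0.eq_or_lt
    · rwa [← h] at h1
    exfalso
    -- If `s_n ≥ L > 0`, the vectors `T e_n` are orthogonal with norms at least `L`, so no
    -- subsequence converges.
    have hK := hT.isCompact_closure_image_closedBall (f := (T : H →ₗ[ℂ] H)) 1
    obtain ⟨y, -, φ, hφ, hy⟩ := hK.tendsto_subseq (x := fun n => T (e n)) fun n =>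
      subset_closure ⟨e n, by simp [horth.1], rfl⟩
    have h2 : Tendsto (fun n => ‖T (e (φ n)) - T (e (φ (n + 1)))‖) atTop (𝓝 ‖y - y‖) :=
      (hy.sub (hy.comp (tendsto_add_atTop_nat 1))).norm
    rw [sub_self, norm_zero] at h2
    obtain ⟨n, hn⟩ := (h2.eventually (gt_mem_nhds h)).exists
    have h3 : inner ℂ (T (e (φ n))) (T (e (φ (n + 1)))) = 0 := by
      rw [hTe, hTe, inner_smul_left, inner_smul_right,
        horth.2 (hφ (Nat.lt_succ_self n)).ne, mul_zero, mul_zero]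
    have h4 := norm_sub_sq (𝕜 := ℂ) (T (e (φ n))) (T (e (φ (n + 1))))
    have h3' : @inner ℂ H InnerProductSpace.toInner (T (e (φ n))) (T (e (φ (n + 1)))) = 0 := h3
    rw [h3', hnT, hnT, map_zero, mul_zero, sub_zero] at h4
    nlinarith [hLs (φ n), hLs (φ (n + 1)), norm_nonneg (T (e (φ n)) - T (e (φ (n + 1))))]
  refine ⟨s, hs0, hanti, hlim, e, e, horth, horth, fun x => ?_⟩
  have hsum : Summable fun n => ((s n : ℂ) * inner ℂ (e n) x) • e n := by
    have h1 := horth.orthogonalFamily.summable_iff_norm_sq_summable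
      fun n => (s n : ℂ) * inner ℂ (e n) x
    refine h1.2 (Summable.of_nonneg_of_le (fun n => by positivity) (fun n => ?_)
      ((horth.inner_products_summable x).mul_left (s 0 ^ 2)))
    rw [norm_mul, mul_pow, Complex.norm_real, Real.norm_of_nonneg (hs0 n)]
    have h2 := hanti (Nat.zero_le n)
    have h3 := hs0 n
    gcongr
  rw [hsum.hasSum_iff_tendsto_nat]
  -- `x - P n` is orthogonal to `U n`, so `T` maps it to a vector of norm at most `s n * ‖x‖`; this
  -- is the error of the partial sum.
  set P : ℕ → H := fun n => ∑ k ∈ Finset.range n, (inner ℂ (e k) x : ℂ) • e k with hP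
  have hPU : ∀ n, P n ∈ (U n).1 := fun n => Submodule.sum_mem _ fun k hk =>
    Submodule.smul_mem _ _ (hUmono (Nat.succ_le_of_lt (Finset.mem_range.1 hk)) (heU k))
  have hPo : ∀ n, x - P n ∈ (U n).1ᗮ := fun n => by
    induction n with
    | zero => rw [hU0]; simp
    | succ n ih =>
      have hPs : x - P (n + 1) = (x - P n) - (inner ℂ (e n) x : ℂ) • e n := by
        rw [hP]; simp only [Finset.sum_range_succ]; abel
      rw [Submodule.mem_orthogonal] at ih ⊢
      intro y hy
      rw [hUs] at hy
      obtain ⟨y1, hy1, y2, hy2, rfl⟩ := Submodule.mem_sup.1 hy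
      obtain ⟨c, rfl⟩ := Submodule.mem_span_singleton.1 hy2
      have h1 : inner ℂ (e n) (e n) = (1 : ℂ) := inner_self_eq_one_of_norm_eq_one (horth.1 n)
      have h2 : inner ℂ (e n) (P n) = (0 : ℂ) :=
        (Submodule.mem_orthogonal' _ _).1 (heo le_rfl) _ (hPU n)
      have h3 : inner ℂ y1 (e n) = (0 : ℂ) := (Submodule.mem_orthogonal _ _).1 (heo le_rfl) _ hy1
      have h4 : inner ℂ (e n) (x - P (n + 1)) = (0 : ℂ) := by
        rw [hPs, inner_sub_right, inner_sub_right, inner_smul_right, h1, h2]; ring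
      have h5 : inner ℂ y1 (x - P (n + 1)) = (0 : ℂ) := by
        rw [hPs, inner_sub_right, inner_smul_right, h3, mul_zero, sub_zero]; exact ih y1 hy1
      rw [inner_add_left, inner_smul_left, h5]
      have h6 : inner ℂ (v (U n)) (x - P (n + 1)) = (0 : ℂ) := h4
      rw [h6]; simp
  have hres : ∀ n, ‖x - P n‖ ≤ ‖x‖ := fun n => by
    have h1 : inner ℂ (x - P n) (P n) = (0 : ℂ) :=
      (Submodule.mem_orthogonal' _ _).1 (hPo n) _ (hPU n)
    have h2 := norm_add_sq_eq_norm_sq_add_norm_sq_of_inner_eq_zero (𝕜 := ℂ) _ _ h1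
    rw [sub_add_cancel] at h2
    nlinarith [norm_nonneg x, norm_nonneg (x - P n), norm_nonneg (P n)]
  rw [tendsto_iff_norm_sub_tendsto_zero]
  refine squeeze_zero (fun n => norm_nonneg _) (fun n => ?_)
    (by simpa using hlim.mul_const ‖x‖ : Tendsto (fun n => s n * ‖x‖) atTop (𝓝 0))
  have h1 : ∑ k ∈ Finset.range n, ((s k : ℂ) * inner ℂ (e k) x) • e k = T (P n) := by
    rw [hP, map_sum]
    refine Finset.sum_congr rfl fun k _ => ?_
    rw [map_smul, hTe, smul_smul, mul_comm]
  rw [h1, ← map_sub, ← norm_neg, ← map_neg, neg_sub]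
  calc ‖T (x - P n)‖ ≤ s n * ‖x - P n‖ := hbd (U n) _ (hPo n)
    _ ≤ s n * ‖x‖ := by
      have := hs0 n
      have := hres n
      gcongr

end Spectral

/-! ### Convex profiles -/

section Profile

/-- A convex function on `[0,∞)` has a supporting line at each interior point. -/
lemma exists_supporting_slope {h : ℝ → ℝ} (hc : ConvexOn ℝ (Ici 0) h) {m : ℝ} (hm : 0 < m) :
    ∃ a : ℝ, ∀ x, 0 ≤ x → h m + a * (x - m) ≤ h x := by
  -- Slopes to the left of `m` are at most slopes to the right, so their supremum is a supporting
  -- slope.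
  set S := slope h m '' Ico 0 m with hS
  have hbd : ∀ y, m < y → ∀ b ∈ S, b ≤ slope h m y := by
    rintro y hy _ ⟨x, hx, rfl⟩
    exact hc.slope_mono hm.le ⟨hx.1, hx.2.ne⟩ ⟨hm.le.trans hy.le, hy.ne'⟩ (hx.2.trans hy).le
  have hne : S.Nonempty := ⟨_, 0, ⟨le_rfl, hm⟩, rfl⟩
  have hba : BddAbove S := ⟨_, hbd (m + 1) (by linarith)⟩
  refine ⟨sSup S, fun x hx => ?_⟩
  rcases lt_trichotomy x m with h1 | rfl | h1
  · have h2 : slope h m x ≤ sSup S := le_csSup hba ⟨x, ⟨hx, h1⟩, rfl⟩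
    rw [slope_def_field, div_le_iff_of_neg (by linarith)] at h2
    linarith
  · simp
  · have h2 : sSup S ≤ slope h m x := csSup_le hne (hbd x h1)
    rw [slope_def_field, le_div_iff₀ (by linarith)] at h2
    linarith

variable {η h : ℝ → ℝ}

lemma extendTop_ofReal (h : ℝ → ℝ) {x : ℝ} (hx : 0 ≤ x) :
    extendTop h (ENNReal.ofReal x) = ENNReal.ofReal (h x) := by
  rw [extendTop, if_neg ENNReal.ofReal_ne_top, ENNReal.toReal_ofReal hx]

lemma extendTop_top (h : ℝ → ℝ) : extendTop h ∞ = ∞ := if_pos rfl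

namespace IsConvexProfile

lemma map_mul_le (hh : IsConvexProfile η h) {t x : ℝ} (ht0 : 0 ≤ t) (ht1 : t ≤ 1) (hx : 0 ≤ x) :
    h (t * x) ≤ t * h x := by
  have h1 := hh.convexOn.2 (show (0 : ℝ) ∈ Ici 0 from self_mem_Ici) (show x ∈ Ici 0 from hx)
    (sub_nonneg.2 ht1) ht0 (sub_add_cancel 1 t)
  simpa [hh.zero] using h1

lemma monotoneOn (hh : IsConvexProfile η h) : MonotoneOn h (Ici 0) := by
  intro x hx y hy hxy
  have hx' : 0 ≤ x := hx
  obtain h0 | h0 := (hx'.trans hxy).eq_or_lt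
  · have : x = 0 := le_antisymm (h0 ▸ hxy) hx'
    rw [this, ← h0]
  · have h1 := hh.map_mul_le (t := x / y) (by positivity) (by rwa [div_le_one h0]) h0.le
    rw [div_mul_cancel₀ _ h0.ne'] at h1
    have h2 : x / y * h y ≤ 1 * h y :=
      mul_le_mul_of_nonneg_right (by rwa [div_le_one h0]) (hh.nonneg y h0.le)
    linarith

lemma extendTop_mono (hh : IsConvexProfile η h) : Monotone (extendTop h) := by
  intro x y hxy
  by_cases hy : y = ∞
  · rw [hy, extendTop_top]; exact le_top
  have hx : x ≠ ∞ := ne_top_of_le_ne_top hy hxy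
  rw [extendTop, extendTop, if_neg hx, if_neg hy]
  exact ENNReal.ofReal_le_ofReal (hh.monotoneOn ENNReal.toReal_nonneg ENNReal.toReal_nonneg
    (ENNReal.toReal_mono hy hxy))

lemma extendTop_zero (hh : IsConvexProfile η h) : extendTop h 0 = 0 := by
  simp [extendTop, hh.zero]

lemma measurable_extendTop (hh : IsConvexProfile η h) : Measurable (extendTop h) :=
  hh.extendTop_mono.measurable

/-- A convex profile grows at least linearly. -/
lemma le_add_one (hη : IsDecayRate η) (hh : IsConvexProfile η h) {x : ℝ} (hx : 0 ≤ x) :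
    x / η 1 ≤ h x + 1 := by
  have h1 := hη.pos 1 le_rfl
  have h2 := hh.apply_rate 1 le_rfl
  have h3 := hh.nonneg x hx
  rcases le_total x (η 1) with h4 | h4
  · have : x / η 1 ≤ 1 := by rwa [div_le_one h1]
    linarith
  · have hx0 : 0 < x := h1.trans_le h4
    have h5 := hh.map_mul_le (t := η 1 / x) (by positivity) (by rwa [div_le_one hx0]) hx
    rw [div_mul_cancel₀ _ hx0.ne', h2, div_mul_eq_mul_div, le_div_iff₀ hx0] at h5
    rw [div_le_iff₀ h1]
    nlinarith

/-- **Jensen's inequality** for a convex profile and a measure of mass at most one. -/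
lemma extendTop_lintegral_le (hη : IsDecayRate η) (hh : IsConvexProfile η h) {X : Type*}
    [MeasurableSpace X] {P : Measure X} (hP : P univ ≤ 1) {φ : X → ℝ≥0∞} (hφ : Measurable φ) :
    extendTop h (∫⁻ x, φ x ∂P) ≤ ∫⁻ x, extendTop h (φ x) ∂P := by
  have hPt : P univ ≠ ∞ := ne_top_of_le_ne_top ENNReal.one_ne_top hP
  set m := ∫⁻ x, φ x ∂P with hm
  set J := ∫⁻ x, extendTop h (φ x) ∂P with hJ
  by_cases hJt : J = ∞
  · rw [hJt]; exact le_top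
  have hη1 := hη.pos 1 le_rfl
  -- An infinite mean is excluded, since `h(y) ≥ y/η(1) - 1` and the mass is finite.
  by_cases hmt : m = ∞
  · exfalso
    have h1 : ∀ y : ℝ≥0∞, ENNReal.ofReal (η 1)⁻¹ * y ≤ extendTop h y + 1 := fun y => by
      by_cases hy : y = ∞
      · rw [hy, extendTop_top]; simp
      rw [← ENNReal.ofReal_toReal hy, extendTop_ofReal h ENNReal.toReal_nonneg,
        ← ENNReal.ofReal_mul (by positivity), ← ENNReal.ofReal_one,
        ← ENNReal.ofReal_add (hh.nonneg _ ENNReal.toReal_nonneg) zero_le_one]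
      refine ENNReal.ofReal_le_ofReal ?_
      rw [mul_comm, ← div_eq_mul_inv]
      exact hh.le_add_one hη ENNReal.toReal_nonneg
    have h2 : ENNReal.ofReal (η 1)⁻¹ * m ≤ J + P univ := by
      rw [hm, hJ, ← lintegral_const_mul _ hφ]
      refine (lintegral_mono fun x => h1 (φ x)).trans ?_
      rw [lintegral_add_right _ measurable_const]
      simp
    rw [hmt, ENNReal.mul_top (by simpa using hη1)] at h2
    exact (ENNReal.add_ne_top.2 ⟨hJt, hPt⟩) (top_le_iff.1 h2)
  set M := m.toReal with hM
  have hmM : m = ENNReal.ofReal M := (ENNReal.ofReal_toReal hmt).symm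
  have hMnn : 0 ≤ M := ENNReal.toReal_nonneg
  obtain h0 | h0 := hMnn.eq_or_lt
  · rw [hmM, ← h0, ENNReal.ofReal_zero, hh.extendTop_zero]; exact zero_le
  obtain ⟨a, ha⟩ := exists_supporting_slope hh.convexOn h0
  -- The supporting line is at most `h 0 = 0` at the origin. This makes mass below one harmless:
  -- integration gives `J ≥ θ h(M) + (1 - θ) a M ≥ h(M)`.
  have ha0 : h M ≤ a * M := by
    have := ha 0 le_rfl
    rw [hh.zero] at this
    linarith
  have ha1 : 0 ≤ a := by
    have := hh.nonneg M h0.le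
    by_contra hneg
    nlinarith
  have hpt : ∀ y : ℝ≥0∞, ENNReal.ofReal (h M) + ENNReal.ofReal a * y ≤
      extendTop h y + ENNReal.ofReal (a * M) := fun y => by
    by_cases hy : y = ∞
    · rw [hy, extendTop_top]; simp
    have hy0 : 0 ≤ y.toReal := ENNReal.toReal_nonneg
    have hM0 := hh.nonneg M h0.le
    rw [← ENNReal.ofReal_toReal hy, extendTop_ofReal h hy0, ← ENNReal.ofReal_mul ha1,
      ← ENNReal.ofReal_add hM0 (by positivity),
      ← ENNReal.ofReal_add (hh.nonneg _ hy0) (by positivity)]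
    refine ENNReal.ofReal_le_ofReal ?_
    linarith [ha y.toReal hy0]
  have hint : ENNReal.ofReal (h M) * P univ + ENNReal.ofReal a * m ≤
      J + ENNReal.ofReal (a * M) * P univ := by
    have h1 : ∫⁻ x, (ENNReal.ofReal (h M) + ENNReal.ofReal a * φ x) ∂P ≤
        ∫⁻ x, (extendTop h (φ x) + ENNReal.ofReal (a * M)) ∂P := lintegral_mono fun x => hpt (φ x)
    rwa [lintegral_add_left measurable_const, lintegral_add_right _ measurable_const,
      lintegral_const, lintegral_const, lintegral_const_mul _ hφ] at h1
  set θ := (P univ).toReal with hθ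
  have hθ1 : θ ≤ 1 := by
    have := ENNReal.toReal_mono ENNReal.one_ne_top hP
    simpa using this
  have hθ0 : 0 ≤ θ := ENNReal.toReal_nonneg
  have hJ0 : 0 ≤ J.toReal := ENNReal.toReal_nonneg
  have hM0 := hh.nonneg M h0.le
  rw [hmM, ← ENNReal.ofReal_toReal hPt, ← ENNReal.ofReal_toReal hJt,
    ← ENNReal.ofReal_mul hM0, ← ENNReal.ofReal_mul ha1, ← ENNReal.ofReal_mul (by positivity),
    ← ENNReal.ofReal_add (by positivity) (by positivity),
    ← ENNReal.ofReal_add (by positivity) (by positivity),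
    ENNReal.ofReal_le_ofReal_iff (by positivity)] at hint
  rw [hmM, extendTop_ofReal h h0.le, ← ENNReal.ofReal_toReal hJt]
  refine ENNReal.ofReal_le_ofReal ?_
  rw [← hθ] at hint
  nlinarith

/-- **Jensen's inequality** for a convex profile and sums. -/
lemma extendTop_tsum_le (hη : IsDecayRate η) (hh : IsConvexProfile η h) {c φ : ℕ → ℝ≥0∞}
    (hc : ∑' n, c n ≤ 1) :
    extendTop h (∑' n, c n * φ n) ≤ ∑' n, c n * extendTop h (φ n) := by
  set P : Measure ℕ := Measure.sum fun n => c n • Measure.dirac n with hP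
  have hint : ∀ f : ℕ → ℝ≥0∞, ∫⁻ n, f n ∂P = ∑' n, c n * f n := fun f => by
    rw [hP, lintegral_sum_measure]
    refine tsum_congr fun n => ?_
    rw [lintegral_smul_measure, lintegral_dirac, smul_eq_mul]
  rw [← hint φ, ← hint fun n => extendTop h (φ n)]
  refine hh.extendTop_lintegral_le hη ?_ (measurable_of_countable φ)
  have := hint fun _ => 1
  simp only [mul_one, lintegral_one] at this
  rwa [this]

end IsConvexProfile

/-- Cauchy condensation reduces this to `∑ 1/k²`. The terms `n = 0, 1` are zero by the conventions
for division and `log`. -/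
lemma summable_one_div_mul_log_sq :
    Summable fun n : ℕ => 1 / ((n : ℝ) * Real.log n ^ 2) := by
  refine (summable_condensed_iff_of_eventually_nonneg
    (Eventually.of_forall fun n => by simp only [Pi.zero_apply]; positivity) ?_).1 ?_
  · filter_upwards [eventually_ge_atTop 2] with k hk
    have hk' : (2 : ℝ) ≤ k := by exact_mod_cast hk
    have h1 : 0 < Real.log k := Real.log_pos (by linarith)
    have h2 : Real.log k ≤ Real.log ((k + 1 : ℕ) : ℝ) :=
      Real.log_le_log (by linarith) (by push_cast; linarith)
    push_cast at h2 ⊢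
    gcongr
    linarith
  · have h1 : Summable fun k : ℕ => (1 / (k : ℝ) ^ 2) * (1 / Real.log 2 ^ 2) :=
      (Real.summable_one_div_nat_pow.2 one_lt_two).mul_right _
    refine h1.congr fun k => ?_
    push_cast
    rw [Real.log_pow]
    have : (2 : ℝ) ^ k ≠ 0 := by positivity
    field_simp

/-! ### Decay at the rate `η` versus summability of the profile. -/

namespace IsDecayRate

/-- Iterating `η(t log t) ≍ η(t)`. -/
lemma exists_le_mul_log_sq (hη : IsDecayRate η) :
    ∃ c : ℝ, 0 < c ∧ ∀ᶠ t : ℝ in atTop, 1 ≤ t * Real.log t ^ 2 ∧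
      η t ≤ c * η (t * Real.log t ^ 2) := by
  obtain ⟨c, hc, hle⟩ := hη.isTheta.2.exists_pos
  rw [IsBigOWith] at hle
  have hg : Tendsto (fun t : ℝ => t * Real.log t) atTop atTop :=
    tendsto_id.atTop_mul_atTop₀ Real.tendsto_log_atTop
  refine ⟨c * c, by positivity, ?_⟩
  filter_upwards [hle, hg.eventually hle, eventually_ge_atTop 1,
    Real.tendsto_log_atTop.eventually (eventually_ge_atTop 1)] with t h1 h2 h3 h4
  have h5 : t ≤ t * Real.log t := by nlinarith
  have h6 : Real.log t ≤ Real.log (t * Real.log t) := Real.log_le_log (by linarith) h5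
  -- The second iterate of `t ↦ t log t` dominates `t log² t`, and `η` is decreasing.
  have h7 : t * Real.log t ^ 2 ≤ t * Real.log t * Real.log (t * Real.log t) := by
    have : 0 ≤ t * Real.log t := by linarith
    nlinarith
  have h8 : 1 ≤ t * Real.log t ^ 2 := by nlinarith
  have p1 := hη.pos t h3
  have p2 := hη.pos (t * Real.log t) (h3.trans h5)
  have p3 := hη.pos _ (h8.trans h7)
  rw [Real.norm_of_nonneg p1.le, Real.norm_of_nonneg p2.le] at h1
  rw [Real.norm_of_nonneg p2.le, Real.norm_of_nonneg p3.le] at h2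
  have h9 := hη.antitoneOn (show _ ∈ Ici (1 : ℝ) from h8) (show _ ∈ Ici (1 : ℝ) from h8.trans h7) h7
  refine ⟨h8, ?_⟩
  calc η t ≤ c * η (t * Real.log t) := h1
    _ ≤ c * (c * η (t * Real.log t ^ 2)) := by
      gcongr
      exact h2.trans (by gcongr)
    _ = _ := by ring

/-- A sequence dominated by the rate has a summable profile. -/
lemma exists_tsum_lt_top (hη : IsDecayRate η) (hh : IsConvexProfile η h) {s : ℕ → ℝ}
    (hs0 : ∀ n, 0 ≤ s n) {K : ℝ} (hK : 0 < K) (hs : ∀ n : ℕ, s n ≤ K * η ((n : ℝ) + 1)) :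
    ∃ C : ℝ, 0 < C ∧ ∑' n, ENNReal.ofReal (h (C * s n)) < ∞ := by
  obtain ⟨c, hc, hev⟩ := hη.exists_le_mul_log_sq
  -- With `t = n + 1`, `s n ≤ K η(t) ≤ K c η(t log² t)`, so `h((K c)⁻¹ s n) ≤ 1/(t log² t)`
  -- eventually.
  refine ⟨(K * c)⁻¹, by positivity, Summable.tsum_ofReal_lt_top ?_⟩
  have hsum := (summable_nat_add_iff 1).2 summable_one_div_mul_log_sq
  refine hsum.of_norm_bounded_eventually_nat ?_
  have ht : Tendsto (fun n : ℕ => (n : ℝ) + 1) atTop atTop :=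
    tendsto_atTop_add_const_right _ _ tendsto_natCast_atTop_atTop
  filter_upwards [ht.eventually hev] with n hn
  have h0 : 0 ≤ (K * c)⁻¹ * s n := mul_nonneg (by positivity) (hs0 n)
  rw [Real.norm_of_nonneg (hh.nonneg _ h0)]
  have h1 : (K * c)⁻¹ * s n ≤ η (((n : ℝ) + 1) * Real.log ((n : ℝ) + 1) ^ 2) := by
    rw [inv_mul_le_iff₀ (by positivity), mul_assoc]
    exact (hs n).trans (mul_le_mul_of_nonneg_left hn.2 hK.le)
  have h2 := hh.monotoneOn (show _ ∈ Ici (0 : ℝ) from h0) (show _ ∈ Ici (0 : ℝ) from h0.trans h1) h1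
  rw [hh.apply_rate _ hn.1] at h2
  push_cast
  exact h2

/-- A non-increasing sequence with summable profile is dominated by the rate. -/
lemma exists_le_of_tsum_lt_top (hη : IsDecayRate η) (hh : IsConvexProfile η h) {s : ℕ → ℝ}
    (hs0 : ∀ n, 0 ≤ s n) (hs : Antitone s) {C : ℝ} (hC : 0 < C)
    (hsum : ∑' n, ENNReal.ofReal (h (C * s n)) < ∞) :
    ∃ K : ℝ, 0 < K ∧ ∀ n : ℕ, s n ≤ K * η ((n : ℝ) + 1) := by
  set M := (∑' n, ENNReal.ofReal (h (C * s n))).toReal with hM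
  have hM0 : 0 ≤ M := ENNReal.toReal_nonneg
  -- Monotonicity gives `(n+1) h(C s n) ≤ M`. Dividing the argument by `M + 1` divides the value at
  -- least as much, so it falls strictly below `1/(n+1) = h(η(n+1))`; as `h` is monotone, `C s n /
  -- (M + 1) ≤ η(n+1)`.
  refine ⟨(M + 1) / C, by positivity, fun n => ?_⟩
  have hCs : ∀ k, 0 ≤ C * s k := fun k => mul_nonneg hC.le (hs0 k)
  have h1 : ((n : ℝ) + 1) * h (C * s n) ≤ M := by
    have h2 : ∑ k ∈ Finset.range (n + 1), ENNReal.ofReal (h (C * s n)) ≤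
        ∑' n, ENNReal.ofReal (h (C * s n)) := by
      refine le_trans (Finset.sum_le_sum fun k hk => ?_)
        (ENNReal.sum_le_tsum (Finset.range (n + 1)))
      exact ENNReal.ofReal_le_ofReal (hh.monotoneOn (hCs n) (hCs k) (mul_le_mul_of_nonneg_left
        (hs (Nat.lt_succ_iff.1 (Finset.mem_range.1 hk))) hC.le))
    rw [Finset.sum_const, Finset.card_range, nsmul_eq_mul, ← ENNReal.ofReal_natCast,
      ← ENNReal.ofReal_mul (by positivity)] at h2
    have h3 := ENNReal.toReal_mono hsum.ne h2
    rw [ENNReal.toReal_ofReal (mul_nonneg (by positivity) (hh.nonneg _ (hCs n)))] at h3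
    push_cast at h3
    exact h3
  have hn : (1 : ℝ) ≤ (n : ℝ) + 1 := by linarith [(Nat.cast_nonneg n : (0 : ℝ) ≤ n)]
  set y := η ((n : ℝ) + 1) with hy
  have hy0 : 0 < y := hη.pos _ hn
  have hhy : h y = 1 / ((n : ℝ) + 1) := hh.apply_rate _ hn
  by_contra hcon
  rw [not_le] at hcon
  set x := C * s n / (M + 1) with hx
  have hx0 : 0 ≤ x := div_nonneg (hCs n) (by positivity)
  have hxy : y < x := by
    rw [hx, lt_div_iff₀ (by positivity)]
    rw [div_mul_eq_mul_div, div_lt_iff₀ hC] at hcon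
    linarith
  have h4 : h x ≤ M / (M + 1) * (1 / ((n : ℝ) + 1)) := by
    have h5 := hh.map_mul_le (t := 1 / (M + 1)) (by positivity)
      (by rw [div_le_one (by positivity)]; linarith) (hCs n)
    rw [show 1 / (M + 1) * (C * s n) = x by rw [hx]; ring] at h5
    refine h5.trans ?_
    rw [div_mul_div_comm, mul_one, div_mul_eq_mul_div, one_mul, div_le_div_iff₀ (by positivity)
      (by positivity)]
    nlinarith
  have h6 := hh.monotoneOn (show y ∈ Ici (0 : ℝ) from hy0.le) (show x ∈ Ici (0 : ℝ) from hx0) hxy.le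
  rw [hhy] at h6
  have h7 : M / (M + 1) < 1 := by rw [div_lt_one (by positivity)]; linarith
  have h8 : 0 < 1 / ((n : ℝ) + 1) := by positivity
  nlinarith

end IsDecayRate

end Profile

/-! ### Toeplitz operators -/

section Toeplitz

variable {α : ℝ} {w : ℂ → ℝ} {μ : Measure ℂ} {T : FockSpace α w →L[ℂ] FockSpace α w}

/-- The local lower estimate of the reproducing kernel, squared. -/
lemma IsKernelRadius.exists_le_sq {δ : ℝ} (hδ : IsKernelRadius α w δ) {r : ℝ} (hr : 0 < r) :
    ∃ c : ℝ, 0 < c ∧ ∀ z ξ : ℂ, ξ ∈ Metric.ball z δ →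
      c * (Real.exp (α * ‖z‖ ^ 2) / (weightMeasure w (Metric.ball z r)).toReal ^ 2) ≤
        ‖entireRep (reproKernel α w z) ξ‖ ^ 2 * Real.exp (-α * ‖ξ‖ ^ 2) := by
  obtain ⟨c, hc, h⟩ := hδ.2.2 r hr
  refine ⟨c ^ 2, by positivity, fun z ξ hξ => ?_⟩
  have h1 := h z ξ hξ
  set y := (weightMeasure w (Metric.ball z r)).toReal
  have hy : 0 ≤ y := ENNReal.toReal_nonneg
  have h2 : Real.exp (α * ‖z‖ ^ 2) =
      Real.exp (α / 2 * ‖z‖ ^ 2 + α / 2 * ‖ξ‖ ^ 2) ^ 2 * Real.exp (-α * ‖ξ‖ ^ 2) := by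
    rw [← Real.exp_nat_mul, ← Real.exp_add]; congr 1; push_cast; ring
  calc c ^ 2 * (Real.exp (α * ‖z‖ ^ 2) / y ^ 2)
      = (c * (Real.exp (α / 2 * ‖z‖ ^ 2 + α / 2 * ‖ξ‖ ^ 2) / y)) ^ 2 *
          Real.exp (-α * ‖ξ‖ ^ 2) := by rw [h2]; ring
    _ ≤ _ := by gcongr

lemma fockDensity_smul (c : ℂ) (f : ℂ → ℂ) (z : ℂ) :
    fockDensity α (c • f) z = ‖c‖ₑ ^ 2 * fockDensity α f z := by
  rw [fockDensity, fockDensity, Pi.smul_apply, enorm_smul, mul_pow, mul_assoc]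

lemma berezin_eq (z : ℂ) :
    berezin α w μ z = ∫⁻ ξ, fockDensity α (entireRep (normalizedKernel α w z)) ξ ∂μ := by
  simp_rw [berezin, fockDensity_eq_ofReal]

lemma RestrictedAInfty.berezin_eq_mul (hw : RestrictedAInfty w) (hα : 0 < α) (z : ℂ) :
    berezin α w μ z = (‖reproKernel α w z‖ₑ ^ 2)⁻¹ *
      ∫⁻ ξ, fockDensity α (entireRep (reproKernel α w z)) ξ ∂μ := by
  have hN := hw.norm_reproKernel_pos hα z
  have h0 : ‖reproKernel α w z‖ₑ ≠ 0 := by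
    rw [← ofReal_norm]; simpa using hN
  rw [berezin_eq, normalizedKernel, hw.entireRep_smul hα]
  simp_rw [fockDensity_smul]
  rw [lintegral_const_mul _ (measurable_fockDensity_entireRep _)]
  congr 1
  rw [← ofReal_norm, Complex.norm_real, Real.norm_of_nonneg (by positivity),
    ENNReal.ofReal_inv_of_pos hN, ofReal_norm, ENNReal.inv_pow]

/-- A Toeplitz operator has a locally finite symbol. -/
lemma IsToeplitz.isLocallyFiniteMeasure (hw : RestrictedAInfty w) {δ : ℝ}
    (hδ : IsKernelRadius α w δ) (hT : IsToeplitz μ T) : IsLocallyFiniteMeasure μ := by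
  refine ⟨fun z => ⟨Metric.ball z δ, Metric.ball_mem_nhds z hδ.1, ?_⟩⟩
  obtain ⟨c, hc, h⟩ := hδ.exists_le_sq one_pos
  set k := c * (Real.exp (α * ‖z‖ ^ 2) / (weightMeasure w (Metric.ball z 1)).toReal ^ 2) with hk
  have hy : 0 < (weightMeasure w (Metric.ball z 1)).toReal :=
    ENNReal.toReal_pos (hw.ball_ne_zero _ one_pos) (hw.ball_ne_top _ _)
  have hk0 : 0 < k := by positivity
  -- The defining integral for `f = B_z` at the point `z` has integrand `|B_z|² e^{-α|ξ|²}`, which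
  -- is bounded below on `D(z,δ)`.
  have h1 := (hT (reproKernel α w z) z).1.2
  rw [hasFiniteIntegral_iff_enorm] at h1
  have h2 : ENNReal.ofReal k * μ (Metric.ball z δ) < ∞ := by
    refine lt_of_le_of_lt ?_ h1
    rw [← setLIntegral_const]
    refine (setLIntegral_mono' measurableSet_ball fun ξ hξ => ?_).trans
      (setLIntegral_le_lintegral (Metric.ball z δ) _)
    refine (ENNReal.ofReal_le_ofReal (h z ξ hξ)).trans (le_of_eq ?_)
    rw [← ofReal_norm, norm_mul, norm_mul, RCLike.norm_conj, Complex.norm_real,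
      Real.norm_of_nonneg (Real.exp_pos _).le, sq]
  rcases ENNReal.mul_lt_top_iff.1 h2 with h3 | h3 | h3
  · exact h3.2
  · exact absurd h3 (by simpa using hk0)
  · rw [h3]; exact ENNReal.zero_lt_top

/-- The sesquilinear form of a Toeplitz operator. -/
lemma IsToeplitz.inner_eq_integral (hw : RestrictedAInfty w) (hα : 0 < α) (hT : IsToeplitz μ T)
    (f : FockSpace α w) {g : FockSpace α w}
    (hg : g ∈ Submodule.span ℂ (range (reproKernel α w))) :
    Integrable (fun ξ => entireRep f ξ * conj (entireRep g ξ) *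
      (Real.exp (-α * ‖ξ‖ ^ 2) : ℂ)) μ ∧
    inner ℂ g (T f) = ∫ ξ, entireRep f ξ * conj (entireRep g ξ) *
      (Real.exp (-α * ‖ξ‖ ^ 2) : ℂ) ∂μ := by
  induction hg using Submodule.span_induction with
  | mem x hx =>
    obtain ⟨z, rfl⟩ := hx
    rw [← hw.entireRep_eq_inner hα]
    exact hT f z
  | zero =>
    have h0 : entireRep (0 : FockSpace α w) = 0 := (hw.toEntire hα).map_zero
    simp [h0]
  | add x y _ _ hx hy =>
    have h1 : (fun ξ => entireRep f ξ * conj (entireRep (x + y) ξ) *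
        (Real.exp (-α * ‖ξ‖ ^ 2) : ℂ)) = fun ξ => entireRep f ξ * conj (entireRep x ξ) *
        (Real.exp (-α * ‖ξ‖ ^ 2) : ℂ) + entireRep f ξ * conj (entireRep y ξ) *
        (Real.exp (-α * ‖ξ‖ ^ 2) : ℂ) := by
      funext ξ
      rw [hw.entireRep_add hα, Pi.add_apply, map_add]; ring
    rw [h1, integral_add hx.1 hy.1, inner_add_left, hx.2, hy.2]
    exact ⟨hx.1.add hy.1, rfl⟩
  | smul a x _ hx =>
    have h1 : (fun ξ => entireRep f ξ * conj (entireRep (a • x) ξ) *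
        (Real.exp (-α * ‖ξ‖ ^ 2) : ℂ)) = fun ξ => conj a * (entireRep f ξ * conj (entireRep x ξ) *
        (Real.exp (-α * ‖ξ‖ ^ 2) : ℂ)) := by
      funext ξ
      rw [hw.entireRep_smul hα, Pi.smul_apply, smul_eq_mul, map_mul]; ring
    rw [h1, integral_const_mul, inner_smul_left, hx.2]
    exact ⟨hx.1.const_mul _, rfl⟩

/-- The quadratic form of a Toeplitz operator on the span of the kernels. -/
lemma IsToeplitz.inner_self_eq (hw : RestrictedAInfty w) (hα : 0 < α) (hT : IsToeplitz μ T)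
    {g : FockSpace α w} (hg : g ∈ Submodule.span ℂ (range (reproKernel α w))) :
    ∃ t : ℝ, 0 ≤ t ∧ inner ℂ g (T g) = (t : ℂ) ∧
      ∫⁻ ξ, fockDensity α (entireRep g) ξ ∂μ = ENNReal.ofReal t := by
  obtain ⟨h1, h2⟩ := hT.inner_eq_integral hw hα g hg
  have h3 : (fun ξ => entireRep g ξ * conj (entireRep g ξ) * (Real.exp (-α * ‖ξ‖ ^ 2) : ℂ)) =
      fun ξ => ((‖entireRep g ξ‖ ^ 2 * Real.exp (-α * ‖ξ‖ ^ 2) : ℝ) : ℂ) := by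
    funext ξ
    rw [Complex.mul_conj, Complex.normSq_eq_norm_sq]
    push_cast; ring
  rw [h3] at h1 h2
  have h4 : Integrable (fun ξ => ‖entireRep g ξ‖ ^ 2 * Real.exp (-α * ‖ξ‖ ^ 2)) μ := by
    exact h1.re.congr (ae_of_all _ fun ξ => Complex.ofReal_re _)
  refine ⟨∫ ξ, ‖entireRep g ξ‖ ^ 2 * Real.exp (-α * ‖ξ‖ ^ 2) ∂μ,
    integral_nonneg fun ξ => by positivity, ?_, ?_⟩
  · rw [h2]; exact integral_ofReal
  · rw [ofReal_integral_eq_lintegral_ofReal h4 (ae_of_all _ fun ξ => by positivity)]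
    simp_rw [fockDensity_eq_ofReal]

/-- The integral formula for the form of `T_μ` is available only against combinations of kernels;
closed conditions extend from there to the whole space. -/
lemma RestrictedAInfty.induction_dense (hw : RestrictedAInfty w) (hα : 0 < α)
    {p : FockSpace α w → Prop} (hp : IsClosed {f | p f})
    (h : ∀ f ∈ Submodule.span ℂ (range (reproKernel α w)), p f) (f : FockSpace α w) : p f :=
  closure_minimal (s := (Submodule.span ℂ (range (reproKernel α w)) : Set (FockSpace α w)))
    (fun f hf => h f hf) hp (hw.dense_span_reproKernel hα f)

/-- A Toeplitz operator is positive. -/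
lemma IsToeplitz.inner_self_nonneg (hw : RestrictedAInfty w) (hα : 0 < α) (hT : IsToeplitz μ T)
    (f : FockSpace α w) : 0 ≤ (inner ℂ f (T f)).re ∧ (inner ℂ f (T f)).im = 0 := by
  have hc : Continuous fun f : FockSpace α w => inner ℂ f (T f) :=
    continuous_id.inner T.continuous
  refine hw.induction_dense hα (p := fun f => 0 ≤ (inner ℂ f (T f)).re ∧ (inner ℂ f (T f)).im = 0)
    ?_ (fun f hf => ?_) f
  · exact (isClosed_le continuous_const (Complex.continuous_re.comp hc)).inter
      (isClosed_eq (Complex.continuous_im.comp hc) continuous_const)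
  · obtain ⟨t, ht, h1, -⟩ := hT.inner_self_eq hw hα hf
    rw [h1]
    exact ⟨ht, rfl⟩

/-- Over `ℂ`, an operator with real quadratic form is symmetric. -/
lemma IsToeplitz.isSymmetric (hw : RestrictedAInfty w) (hα : 0 < α) (hT : IsToeplitz μ T) :
    T.IsSymmetric := by
  refine (LinearMap.isSymmetric_iff_inner_map_self_real _).2 fun f => ?_
  have h1 : inner ℂ (T f) f = conj (inner ℂ f (T f)) := (inner_conj_symm _ _).symm
  have h2 : conj (inner ℂ f (T f)) = inner ℂ f (T f) :=
    Complex.conj_eq_iff_im.2 (hT.inner_self_nonneg hw hα f).2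
  change conj (inner ℂ (T f) f) = inner ℂ (T f) f
  rw [h1, h2, h2]

/-- The sesquilinear form of a Toeplitz operator is dominated by the `L²(μ)` norms. -/
lemma IsToeplitz.two_mul_enorm_inner_le (hw : RestrictedAInfty w) (hα : 0 < α)
    (hT : IsToeplitz μ T) (f g : FockSpace α w) :
    2 * ‖(inner ℂ g (T f) : ℂ)‖ₑ ≤ ∫⁻ ξ, fockDensity α (entireRep f) ξ ∂μ +
      ∫⁻ ξ, fockDensity α (entireRep g) ξ ∂μ := by
  -- The density argument in `g` needs a right-hand side continuous in `g`. Hence `⟨T g, g⟩` stands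
  -- here in place of `∫ |g|² e^{-α|ξ|²} dμ`; on the span they agree.
  have key : ∀ f g : FockSpace α w, 2 * ‖(inner ℂ g (T f) : ℂ)‖ₑ ≤
      ∫⁻ ξ, fockDensity α (entireRep f) ξ ∂μ + ENNReal.ofReal (inner ℂ g (T g)).re := fun f g => by
    refine hw.induction_dense hα (p := fun g => 2 * ‖(inner ℂ g (T f) : ℂ)‖ₑ ≤
      ∫⁻ ξ, fockDensity α (entireRep f) ξ ∂μ + ENNReal.ofReal (inner ℂ g (T g)).re)
      ?_ (fun g hg => ?_) g
    · have hc1 : Continuous fun g : FockSpace α w => (inner ℂ g (T f) : ℂ) :=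
        continuous_id.inner continuous_const
      have hc2 : Continuous fun g : FockSpace α w => (inner ℂ g (T g) : ℂ) :=
        continuous_id.inner T.continuous
      refine isClosed_le ?_ ?_
      · exact (ENNReal.continuous_const_mul (by simp)).comp hc1.enorm
      · exact continuous_const.add
          (ENNReal.continuous_ofReal.comp (Complex.continuous_re.comp hc2))
    · obtain ⟨-, h2⟩ := hT.inner_eq_integral hw hα f hg
      obtain ⟨t, -, h3, h4⟩ := hT.inner_self_eq hw hα hg
      rw [h3, Complex.ofReal_re, ← h4, h2,
        ← lintegral_add_left (measurable_fockDensity_entireRep f)]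
      refine (mul_le_mul' le_rfl (enorm_integral_le_lintegral_enorm _)).trans ?_
      rw [← lintegral_const_mul' _ _ (by simp)]
      refine lintegral_mono fun ξ => ?_
      rw [fockDensity_eq_ofReal, fockDensity_eq_ofReal, ← ENNReal.ofReal_add (by positivity)
        (by positivity), ← ofReal_norm, norm_mul, norm_mul, RCLike.norm_conj, Complex.norm_real,
        Real.norm_of_nonneg (Real.exp_pos _).le, ← ENNReal.ofReal_ofNat,
        ← ENNReal.ofReal_mul (by norm_num)]
      refine ENNReal.ofReal_le_ofReal ?_
      nlinarith [sq_nonneg (‖entireRep f ξ‖ - ‖entireRep g ξ‖), Real.exp_pos (-α * ‖ξ‖ ^ 2)]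
  -- Taking `f = g` in `key` and cancelling one finite copy of `⟨T g, g⟩` puts the integral back.
  have hself : ENNReal.ofReal (inner ℂ g (T g)).re ≤ ∫⁻ ξ, fockDensity α (entireRep g) ξ ∂μ := by
    have h1 := key g g
    have h2 : ENNReal.ofReal (inner ℂ g (T g)).re ≤ ‖(inner ℂ g (T g) : ℂ)‖ₑ := by
      rw [← ofReal_norm]
      exact ENNReal.ofReal_le_ofReal (Complex.re_le_norm _)
    have h3 : ENNReal.ofReal (inner ℂ g (T g)).re + ENNReal.ofReal (inner ℂ g (T g)).re ≤
        ∫⁻ ξ, fockDensity α (entireRep g) ξ ∂μ + ENNReal.ofReal (inner ℂ g (T g)).re := by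
      rw [← two_mul]
      exact (mul_le_mul' le_rfl h2).trans h1
    exact (ENNReal.add_le_add_iff_right ENNReal.ofReal_ne_top).1 h3
  exact (key f g).trans (add_le_add le_rfl hself)

/-- A compact Toeplitz operator has singular values. -/
lemma IsToeplitz.isSingularValueSeq (hw : RestrictedAInfty w) (hα : 0 < α) (hT : IsToeplitz μ T)
    (hTc : IsCompactOperator T) : IsSingularValueSeq T (singularValue T) := by
  have := hw.completeSpace hα
  have hex : ∃ s, IsSingularValueSeq T s := by
    refine exists_isSingularValueSeq (hw.not_finiteDimensional hα) hTc (hT.isSymmetric hw hα)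
      fun f => ?_
    have h1 : inner ℂ (T f) f = conj (inner ℂ f (T f)) := (inner_conj_symm _ _).symm
    rw [h1, Complex.conj_re]
    exact (hT.inner_self_nonneg hw hα f).1
  rw [singularValue, dif_pos hex]
  exact Classical.choose_spec hex

end Toeplitz

/-! ### Singular values, averages and the Berezin transform -/

section Decomposition

variable {H : Type*} [NormedAddCommGroup H] [InnerProductSpace ℂ H]

lemma tsum_enorm_inner_sq_le {e : ℕ → H} (he : Orthonormal ℂ e) (x : H) :
    ∑' n, ‖(inner ℂ (e n) x : ℂ)‖ₑ ^ 2 ≤ ‖x‖ₑ ^ 2 := by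
  have h1 : ∀ n, ‖(inner ℂ (e n) x : ℂ)‖ₑ ^ 2 = ENNReal.ofReal (‖(inner ℂ (e n) x : ℂ)‖ ^ 2) :=
    fun n => by rw [ENNReal.ofReal_pow (norm_nonneg _), ofReal_norm]
  simp_rw [h1]
  rw [← ENNReal.ofReal_tsum_of_nonneg (fun n => by positivity) (he.inner_products_summable x),
    ← ofReal_norm, ← ENNReal.ofReal_pow (norm_nonneg _)]
  exact ENNReal.ofReal_le_ofReal (he.tsum_inner_products_le x)

lemma enorm_sq_of_orthonormal {e : ℕ → H} (he : Orthonormal ℂ e) (n : ℕ) : ‖e n‖ₑ ^ 2 = 1 := by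
  rw [← ofReal_norm, he.1 n]; simp

/-- The quadratic form of an operator with a canonical decomposition. -/
lemma enorm_inner_le_tsum {T : H →L[ℂ] H} {s : ℕ → ℝ} (hs0 : ∀ n, 0 ≤ s n) {e σ : ℕ → H}
    (hT : ∀ x, HasSum (fun n => ((s n : ℂ) * inner ℂ (e n) x) • σ n) (T x)) (x : H) :
    ‖(inner ℂ x (T x) : ℂ)‖ₑ ≤ ∑' n, (2⁻¹ * (‖(inner ℂ (e n) x : ℂ)‖ₑ ^ 2 +
      ‖(inner ℂ (σ n) x : ℂ)‖ₑ ^ 2)) * ENNReal.ofReal (s n) := by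
  have h1 : HasSum (fun n => (inner ℂ x (((s n : ℂ) * inner ℂ (e n) x) • σ n) : ℂ))
      (inner ℂ x (T x)) := (hT x).mapL (innerSL ℂ x)
  rw [← h1.tsum_eq]
  refine enorm_tsum_le_tsum_enorm.trans (ENNReal.tsum_le_tsum fun n => ?_)
  have h2 : ‖(inner ℂ x (σ n) : ℂ)‖ = ‖(inner ℂ (σ n) x : ℂ)‖ := norm_inner_symm _ _
  set a := ‖(inner ℂ (e n) x : ℂ)‖ with ha
  set b := ‖(inner ℂ (σ n) x : ℂ)‖ with hb
  have ha0 : 0 ≤ a := norm_nonneg _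
  have hb0 : 0 ≤ b := norm_nonneg _
  have h3 : (2⁻¹ * (‖(inner ℂ (e n) x : ℂ)‖ₑ ^ 2 + ‖(inner ℂ (σ n) x : ℂ)‖ₑ ^ 2)) *
      ENNReal.ofReal (s n) = ENNReal.ofReal (2⁻¹ * (a ^ 2 + b ^ 2) * s n) := by
    rw [ENNReal.ofReal_mul (by positivity), ENNReal.ofReal_mul (by positivity),
      ENNReal.ofReal_add (by positivity) (by positivity), ENNReal.ofReal_pow ha0,
      ENNReal.ofReal_pow hb0, ha, hb, ofReal_norm, ofReal_norm, ENNReal.ofReal_inv_of_pos (by norm_num)]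
    simp
  rw [h3, inner_smul_right, ← ofReal_norm, norm_mul, norm_mul, h2, Complex.norm_real,
    Real.norm_of_nonneg (hs0 n)]
  refine ENNReal.ofReal_le_ofReal ?_
  have := hs0 n
  nlinarith [sq_nonneg (a - b), mul_nonneg this (sq_nonneg (a - b))]

/-- Orthonormality gives `T e_n = s_n σ_n`. The decomposition is arbitrary, so `e` and `σ` need not
coincide. -/
lemma inner_eq_of_hasSum {T : H →L[ℂ] H} {s : ℕ → ℝ} {e σ : ℕ → H} (he : Orthonormal ℂ e)
    (hσ : Orthonormal ℂ σ)
    (hT : ∀ x, HasSum (fun n => ((s n : ℂ) * inner ℂ (e n) x) • σ n) (T x)) (n : ℕ) :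
    inner ℂ (σ n) (T (e n)) = (s n : ℂ) := by
  have h1 : T (e n) = (s n : ℂ) • σ n := by
    refine (hT (e n)).unique ?_
    convert hasSum_single n fun m hm => ?_ using 1
    · have : inner ℂ (e n) (e n) = (1 : ℂ) := inner_self_eq_one_of_norm_eq_one (he.1 n)
      rw [this, mul_one]
    · have : inner ℂ (e m) (e n) = (0 : ℂ) := he.2 hm
      rw [this, mul_zero, zero_smul]
  have h2 : inner ℂ (σ n) (σ n) = (1 : ℂ) := inner_self_eq_one_of_norm_eq_one (hσ.1 n)
  rw [h1, inner_smul_right, h2, mul_one]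

end Decomposition

/-! ### The estimates behind the implications. -/

section Main

variable {α : ℝ} {w : ℂ → ℝ} {μ : Measure ℂ} {T : FockSpace α w →L[ℂ] FockSpace α w}
  {η h : ℝ → ℝ}

lemma measurable_averageFn (w : ℂ → ℝ) (μ : Measure ℂ) [SFinite μ] (r : ℝ) :
    Measurable (averageFn w μ r) :=
  (measurable_measure_ball μ r).div (measurable_measure_ball (weightMeasure w) r)

/-- Upper bound of the weighted kernel norm, in `[0,∞]`. -/
lemma RestrictedAInfty.exists_enorm_reproKernel_le (hw : RestrictedAInfty w) (hα : 0 < α) :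
    ∃ C : ℝ≥0, ∀ z : ℂ, ‖reproKernel α w z‖ₑ ^ 2 * ENNReal.ofReal (Real.exp (-α * ‖z‖ ^ 2)) ≤
      C * (weightMeasure w (Metric.ball z 1))⁻¹ := by
  obtain ⟨_, C, _, hC, h⟩ := hw.exists_norm_reproKernel hα
  refine ⟨C.toNNReal, fun z => ?_⟩
  rw [← div_eq_mul_inv, ENNReal.le_div_iff_mul_le (Or.inl (hw.ball_ne_zero z one_pos))
    (Or.inl (hw.ball_ne_top z 1)), ← ENNReal.ofReal_toReal (hw.ball_ne_top z 1), ← ofReal_norm,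
    ← ENNReal.ofReal_pow (norm_nonneg _), ← ENNReal.ofReal_mul (by positivity),
    ← ENNReal.ofReal_mul (by positivity)]
  exact ENNReal.ofReal_le_ofReal (h z).2

/-- Lower bound of the weighted kernel norm, in `[0,∞]`. -/
lemma RestrictedAInfty.exists_inv_enorm_reproKernel_le (hw : RestrictedAInfty w) (hα : 0 < α) :
    ∃ C : ℝ≥0, ∀ z : ℂ, (‖reproKernel α w z‖ₑ ^ 2)⁻¹ ≤
      C * (ENNReal.ofReal (Real.exp (-α * ‖z‖ ^ 2)) * weightMeasure w (Metric.ball z 1)) := by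
  obtain ⟨c, _, hc, _, h⟩ := hw.exists_norm_reproKernel hα
  refine ⟨c⁻¹.toNNReal, fun z => ?_⟩
  have hN := hw.norm_reproKernel_pos hα z
  rw [← ENNReal.ofReal_toReal (hw.ball_ne_top z 1), ← ofReal_norm,
    ← ENNReal.ofReal_pow (norm_nonneg _), ← ENNReal.ofReal_mul (by positivity),
    ← ENNReal.ofReal_inv_of_pos (by positivity)]
  change _ ≤ ENNReal.ofReal c⁻¹ * _
  rw [← ENNReal.ofReal_mul (by positivity)]
  refine ENNReal.ofReal_le_ofReal ?_
  rw [← div_eq_inv_mul, le_div_iff₀ hc, inv_mul_le_iff₀ (by positivity)]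
  have := (h z).1
  linarith

/-- The weighted density of an element of the Fock space, integrated against the weights of unit
disks. -/
lemma RestrictedAInfty.exists_lintegral_mul_ball_le (hw : RestrictedAInfty w) (hα : 0 < α) :
    ∃ C : ℝ≥0, ∀ f : FockSpace α w, ∫⁻ z, fockDensity α (entireRep f) z *
      weightMeasure w (Metric.ball z 1) ≤ C * ‖f‖ₑ ^ 2 := by
  obtain ⟨C, hC⟩ := hw.exists_fockDensity_le hα one_pos
  refine ⟨(C * volume (Metric.ball (0 : ℂ) 1)).toNNReal, fun f => ?_⟩
  rw [ENNReal.coe_toNNReal (ENNReal.mul_ne_top ENNReal.coe_ne_top volume_ball_ne_top),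
    ← hw.isWeight.lintegral_fockDensity f, mul_assoc,
    ← lintegral_lintegral_ball_volume (measurable_fockDensity_entireRep f),
    ← lintegral_const_mul' _ _ ENNReal.coe_ne_top]
  exact lintegral_mono fun z => hC _ (differentiable_entireRep f) z

/-- Decay of the singular values implies integrability of the Berezin transform. -/
lemma IsToeplitz.exists_lintegral_berezin_lt_top (hw : RestrictedAInfty w) (hα : 0 < α)
    (hT : IsToeplitz μ T) (hη : IsDecayRate η) (hh : IsConvexProfile η h) {s : ℕ → ℝ}
    (hs : IsSingularValueSeq T s) {C : ℝ} (hC : 0 < C)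
    (hsum : ∑' n, ENNReal.ofReal (h (C * s n)) < ∞) :
    ∫⁻ z : ℂ, extendTop h (ENNReal.ofReal C * berezin α w μ z) < ∞ := by
  obtain ⟨hs0, -, -, e, σ, he, hσ, hTs⟩ := hs
  obtain ⟨D, hD⟩ := hw.exists_inv_enorm_reproKernel_le hα
  obtain ⟨D', hD'⟩ := hw.exists_lintegral_mul_ball_le hα
  set V : ℂ → ℝ≥0∞ := fun z => weightMeasure w (Metric.ball z 1) with hV
  have hVm : Measurable V := measurable_measure_ball _ 1
  -- `|⟨f, b_z⟩|² = |f(z)|² / ‖B_z‖²`, and the lower bound of `‖B_z‖²` applies; the right-hand side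
  -- has integral `≲ ‖f‖²`.
  have hcoef : ∀ (z : ℂ) (f : FockSpace α w),
      ‖(inner ℂ f (normalizedKernel α w z) : ℂ)‖ₑ ^ 2 ≤ D * (fockDensity α (entireRep f) z * V z) := by
    intro z f
    have hN := hw.norm_reproKernel_pos hα z
    have h1 : ‖(inner ℂ f (normalizedKernel α w z) : ℂ)‖ₑ ^ 2 =
        (‖reproKernel α w z‖ₑ ^ 2)⁻¹ * ‖entireRep f z‖ₑ ^ 2 := by
      have h0 : (inner ℂ f (normalizedKernel α w z) : ℂ) =
          ((‖reproKernel α w z‖⁻¹ : ℝ) : ℂ) * inner ℂ f (reproKernel α w z) :=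
        inner_smul_right (𝕜 := ℂ) (E := FockSpace α w) f (reproKernel α w z)
          ((‖reproKernel α w z‖⁻¹ : ℝ) : ℂ)
      rw [h0, enorm_mul, mul_pow, ENNReal.inv_pow]
      congr 2
      · rw [← ofReal_norm, Complex.norm_real, Real.norm_of_nonneg (by positivity),
          ENNReal.ofReal_inv_of_pos hN, ofReal_norm]
      · rw [hw.entireRep_eq_inner hα, ← ofReal_norm, ← ofReal_norm]
        congr 1
        exact norm_inner_symm _ _
    rw [h1]
    calc _ ≤ (D * (ENNReal.ofReal (Real.exp (-α * ‖z‖ ^ 2)) * V z)) * ‖entireRep f z‖ₑ ^ 2 :=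
          mul_le_mul' (hD z) le_rfl
      _ = _ := by rw [fockDensity]; ring
  have hb : ∀ z, ‖normalizedKernel α w z‖ₑ = 1 := fun z => by
    have hN := hw.norm_reproKernel_pos hα z
    rw [normalizedKernel, enorm_smul, ← ofReal_norm, Complex.norm_real,
      Real.norm_of_nonneg (by positivity), ← ofReal_norm, ← ENNReal.ofReal_mul (by positivity),
      inv_mul_cancel₀ hN.ne', ENNReal.ofReal_one]
  have hpt : ∀ z, extendTop h (ENNReal.ofReal C * berezin α w μ z) ≤
      ∑' n, (D * 2⁻¹ * (fockDensity α (entireRep (e n)) z * V z +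
        fockDensity α (entireRep (σ n)) z * V z)) * ENNReal.ofReal (h (C * s n)) := by
    intro z
    set b := normalizedKernel α w z with hbdef
    -- These weights come from `|xy| ≤ (|x|² + |y|²)/2`; as `‖b_z‖ = 1`, Bessel's inequality for `e`
    -- and `σ` bounds their sum by one, as Jensen's inequality requires.
    set c : ℕ → ℝ≥0∞ := fun n =>
      2⁻¹ * (‖(inner ℂ (e n) b : ℂ)‖ₑ ^ 2 + ‖(inner ℂ (σ n) b : ℂ)‖ₑ ^ 2) with hc
    have hc1 : ∑' n, c n ≤ 1 := by
      have h1 := tsum_enorm_inner_sq_le he b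
      have h2 := tsum_enorm_inner_sq_le hσ b
      rw [hb, one_pow] at h1 h2
      rw [hc, ENNReal.tsum_mul_left, ENNReal.tsum_add]
      calc _ ≤ (2 : ℝ≥0∞)⁻¹ * (1 + 1) := by gcongr
        _ = 1 := by rw [one_add_one_eq_two]; exact ENNReal.inv_mul_cancel (by simp) (by simp)
    have hber : berezin α w μ z ≤ ∑' n, c n * ENNReal.ofReal (s n) := by
      refine le_trans ?_ (enorm_inner_le_tsum hs0 hTs b)
      have hmem : b ∈ Submodule.span ℂ (range (reproKernel α w)) :=
        Submodule.smul_mem _ _ (Submodule.subset_span ⟨z, rfl⟩)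
      obtain ⟨t, ht, h1, h2⟩ := hT.inner_self_eq hw hα hmem
      rw [berezin_eq, h2, h1, ← ofReal_norm, Complex.norm_real, Real.norm_of_nonneg ht]
    calc extendTop h (ENNReal.ofReal C * berezin α w μ z)
        ≤ extendTop h (∑' n, c n * ENNReal.ofReal (C * s n)) := by
          refine hh.extendTop_mono ((mul_le_mul' le_rfl hber).trans (le_of_eq ?_))
          rw [← ENNReal.tsum_mul_left]
          refine tsum_congr fun n => ?_
          rw [ENNReal.ofReal_mul hC.le]; ring
      _ ≤ ∑' n, c n * extendTop h (ENNReal.ofReal (C * s n)) := hh.extendTop_tsum_le hη hc1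
      _ ≤ _ := by
          refine ENNReal.tsum_le_tsum fun n => ?_
          rw [extendTop_ofReal h (mul_nonneg hC.le (hs0 n))]
          refine mul_le_mul' ?_ le_rfl
          calc c n ≤ 2⁻¹ * (D * (fockDensity α (entireRep (e n)) z * V z) +
                D * (fockDensity α (entireRep (σ n)) z * V z)) :=
                mul_le_mul' le_rfl (add_le_add (hcoef z _) (hcoef z _))
            _ = _ := by ring
  have hdm : ∀ f : FockSpace α w, Measurable fun z => fockDensity α (entireRep f) z * V z :=
    fun f => (measurable_fockDensity_entireRep f).mul hVm
  have hsm : ∀ n, Measurable fun z => fockDensity α (entireRep (e n)) z * V z +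
      fockDensity α (entireRep (σ n)) z * V z := fun n => (hdm _).add (hdm _)
  have hcm : ∀ n, Measurable fun z => D * 2⁻¹ * (fockDensity α (entireRep (e n)) z * V z +
      fockDensity α (entireRep (σ n)) z * V z) := fun n => (hsm n).const_mul _
  refine (lintegral_mono hpt).trans_lt ?_
  rw [lintegral_tsum fun n => ((hcm n).mul_const _).aemeasurable]
  have hterm : ∀ n, ∫⁻ z, (D * 2⁻¹ * (fockDensity α (entireRep (e n)) z * V z +
      fockDensity α (entireRep (σ n)) z * V z)) * ENNReal.ofReal (h (C * s n)) ≤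
      (D * 2⁻¹ * (D' + D')) * ENNReal.ofReal (h (C * s n)) := fun n => by
    rw [lintegral_mul_const _ (hcm n), lintegral_const_mul _ (hsm n), lintegral_add_left (hdm _)]
    have h1 := hD' (e n)
    have h2 := hD' (σ n)
    rw [enorm_sq_of_orthonormal he, mul_one] at h1
    rw [enorm_sq_of_orthonormal hσ, mul_one] at h2
    gcongr
  refine (ENNReal.tsum_le_tsum hterm).trans_lt ?_
  rw [ENNReal.tsum_mul_left]
  refine ENNReal.mul_lt_top ?_ hsum
  refine ENNReal.mul_lt_top (ENNReal.mul_lt_top ENNReal.coe_lt_top (by simp)) ?_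
  exact ENNReal.add_lt_top.2 ⟨ENNReal.coe_lt_top, ENNReal.coe_lt_top⟩

/-- The averages are dominated by the Berezin transform. -/
lemma RestrictedAInfty.exists_averageFn_le (hw : RestrictedAInfty w) (hα : 0 < α) {δ : ℝ}
    (hδ : IsKernelRadius α w δ) (μ : Measure ℂ) {r : ℝ} (hr : 0 < r) (hrδ : r < δ) :
    ∃ c : ℝ, 0 < c ∧ ∀ z, ENNReal.ofReal c * averageFn w μ r z ≤ berezin α w μ z := by
  obtain ⟨c, hc, hlow⟩ := hδ.exists_le_sq hr
  obtain ⟨_, C, _, hC, hN⟩ := hw.exists_norm_reproKernel hα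
  obtain ⟨D, hD⟩ := hw.exists_ball_le_ball r one_pos 0
  -- `c` comes from the lower bound of the kernel on `D(z,δ)`, `C` from the upper bound of its norm,
  -- and `D + 1` compares `w(D(z,r))` with `w(D(z,1))`.
  refine ⟨c / (C * (D + 1)), by positivity, fun z => ?_⟩
  set y := (weightMeasure w (Metric.ball z r)).toReal with hy
  set v := (weightMeasure w (Metric.ball z 1)).toReal with hv
  have hyp : 0 < y := ENNReal.toReal_pos (hw.ball_ne_zero _ hr) (hw.ball_ne_top _ _)
  have hvp : 0 < v := ENNReal.toReal_pos (hw.ball_ne_zero _ one_pos) (hw.ball_ne_top _ _)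
  have hyv : y ≤ (D + 1) * v := by
    have := ENNReal.toReal_mono (ENNReal.mul_ne_top ENNReal.coe_ne_top (hw.ball_ne_top _ _))
      (hD z z (by simp))
    rw [ENNReal.toReal_mul, ENNReal.coe_toReal] at this
    nlinarith
  have hNp := hw.norm_reproKernel_pos hα z
  set N := ‖reproKernel α w z‖ with hNdef
  have hN2 : N ^ 2 ≤ C * Real.exp (α * ‖z‖ ^ 2) / v := by
    have h1 := (hN z).2
    have h2 : Real.exp (α * ‖z‖ ^ 2) * Real.exp (-α * ‖z‖ ^ 2) = 1 := by
      rw [← Real.exp_add]; simp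
    rw [le_div_iff₀ hvp]
    calc N ^ 2 * v = Real.exp (α * ‖z‖ ^ 2) * (N ^ 2 * Real.exp (-α * ‖z‖ ^ 2) * v) := by
          linear_combination (-(N ^ 2 * v)) * h2
      _ ≤ Real.exp (α * ‖z‖ ^ 2) * C := by gcongr
      _ = _ := mul_comm _ _
  have hkey : c / (C * (D + 1)) * y⁻¹ ≤ (N ^ 2)⁻¹ * (c * (Real.exp (α * ‖z‖ ^ 2) / y ^ 2)) := by
    have h3 : N ^ 2 ≤ C * Real.exp (α * ‖z‖ ^ 2) * (D + 1) / y := by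
      refine hN2.trans ?_
      rw [div_le_div_iff₀ hvp hyp]
      calc C * Real.exp (α * ‖z‖ ^ 2) * y ≤ C * Real.exp (α * ‖z‖ ^ 2) * ((D + 1) * v) := by gcongr
        _ = _ := by ring
    have h4 : (C * Real.exp (α * ‖z‖ ^ 2) * (D + 1) / y)⁻¹ ≤ (N ^ 2)⁻¹ :=
      inv_anti₀ (by positivity) h3
    calc c / (C * (D + 1)) * y⁻¹ = (C * Real.exp (α * ‖z‖ ^ 2) * (D + 1) / y)⁻¹ *
          (c * (Real.exp (α * ‖z‖ ^ 2) / y ^ 2)) := by field_simp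
      _ ≤ _ := by gcongr
  have hyE : weightMeasure w (Metric.ball z r) = ENNReal.ofReal y :=
    (ENNReal.ofReal_toReal (hw.ball_ne_top z r)).symm
  rw [hw.berezin_eq_mul hα, averageFn, hyE, ENNReal.div_eq_inv_mul,
    ← ENNReal.ofReal_inv_of_pos hyp, ← mul_assoc, ← ENNReal.ofReal_mul (by positivity)]
  calc _ ≤ ENNReal.ofReal ((N ^ 2)⁻¹ * (c * (Real.exp (α * ‖z‖ ^ 2) / y ^ 2))) *
        μ (Metric.ball z r) := mul_le_mul' (ENNReal.ofReal_le_ofReal hkey) le_rfl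
    _ = (‖reproKernel α w z‖ₑ ^ 2)⁻¹ * ∫⁻ _ in Metric.ball z r,
          ENNReal.ofReal (c * (Real.exp (α * ‖z‖ ^ 2) / y ^ 2)) ∂μ := by
        rw [ENNReal.ofReal_mul (by positivity), setLIntegral_const, mul_assoc,
          ENNReal.ofReal_inv_of_pos (by positivity), ENNReal.ofReal_pow hNp.le, ofReal_norm]
    _ ≤ _ := by
        refine mul_le_mul' le_rfl ((setLIntegral_mono' measurableSet_ball fun ξ hξ => ?_).trans
          (setLIntegral_le_lintegral (Metric.ball z r) _))
        rw [fockDensity_eq_ofReal]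
        exact ENNReal.ofReal_le_ofReal (hlow z ξ (Metric.ball_subset_ball hrδ.le hξ))

/-- The `L²(μ)` norm of an entire function is dominated by a weighted norm with the averages of
`μ` as a density. -/
lemma RestrictedAInfty.exists_lintegral_fockDensity_le (hw : RestrictedAInfty w) (hα : 0 < α)
    (μ : Measure ℂ) [SFinite μ] {ρ : ℝ} (hρ : 0 < ρ) :
    ∃ C : ℝ≥0, ∀ f : ℂ → ℂ, Differentiable ℂ f → ∫⁻ ξ, fockDensity α f ξ ∂μ ≤
      C * ∫⁻ u, fockDensity α f u * (μ (Metric.ball u ρ) / weightMeasure w (Metric.ball u 1))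
        ∂(weightMeasure w) := by
  obtain ⟨C, hC⟩ := hw.exists_fockDensity_le hα hρ
  obtain ⟨D, hD⟩ := hw.exists_ball_le_ball 1 one_pos ρ
  refine ⟨C * D, fun f hf => ?_⟩
  set V : ℂ → ℝ≥0∞ := fun z => weightMeasure w (Metric.ball z 1) with hV
  have hVm : Measurable V := measurable_measure_ball _ 1
  have hV0 : ∀ z, V z ≠ 0 := fun z => hw.ball_ne_zero z one_pos
  have hVt : ∀ z, V z ≠ ∞ := fun z => hw.ball_ne_top z 1
  have hfm := measurable_fockDensity α hf.continuous
  have hFm : Measurable fun u => fockDensity α f u * (V u)⁻¹ := hfm.mul hVm.inv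
  -- The factor `1/w(D(ξ,1))` is exchanged for `1/w(D(u,1))` inside the integral. Only the disk then
  -- depends on `ξ`, and integration in `dμ(ξ)` produces `μ(D(u,ρ))`.
  have hpt : ∀ ξ, fockDensity α f ξ ≤ (C * D : ℝ≥0) *
      ∫⁻ u in Metric.ball ξ ρ, fockDensity α f u * (V u)⁻¹ ∂(weightMeasure w) := fun ξ => by
    have h1 : fockDensity α f ξ ≤ (V ξ)⁻¹ *
        (C * ∫⁻ u in Metric.ball ξ ρ, fockDensity α f u ∂(weightMeasure w)) := by
      calc fockDensity α f ξ = (V ξ)⁻¹ * (fockDensity α f ξ * V ξ) := by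
            rw [mul_comm, mul_assoc, ENNReal.mul_inv_cancel (hV0 ξ) (hVt ξ), mul_one]
        _ ≤ _ := mul_le_mul' le_rfl (hC f hf ξ)
    refine h1.trans ?_
    rw [← mul_assoc, mul_comm _ (C : ℝ≥0∞), mul_assoc, ENNReal.coe_mul, mul_assoc]
    refine mul_le_mul' le_rfl ?_
    rw [← lintegral_const_mul _ hfm, ← lintegral_const_mul _ hFm]
    refine setLIntegral_mono' measurableSet_ball fun u hu => ?_
    have h2 : V u ≤ D * V ξ := hD u ξ (mem_ball_iff_norm.1 hu).le
    have h3 : (V ξ)⁻¹ ≤ D * (V u)⁻¹ := by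
      rw [← div_eq_mul_inv, ENNReal.le_div_iff_mul_le (Or.inl (hV0 u)) (Or.inl (hVt u))]
      calc (V ξ)⁻¹ * V u ≤ (V ξ)⁻¹ * (D * V ξ) := mul_le_mul' le_rfl h2
        _ = D * ((V ξ)⁻¹ * V ξ) := by ring
        _ = D := by rw [ENNReal.inv_mul_cancel (hV0 ξ) (hVt ξ), mul_one]
    calc (V ξ)⁻¹ * fockDensity α f u ≤ D * (V u)⁻¹ * fockDensity α f u := mul_le_mul' h3 le_rfl
      _ = _ := by ring
  refine (lintegral_mono hpt).trans ?_
  rw [lintegral_const_mul' _ _ ENNReal.coe_ne_top, lintegral_lintegral_ball hFm]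
  refine mul_le_mul' le_rfl (le_of_eq (lintegral_congr fun u => ?_))
  rw [ENNReal.div_eq_inv_mul, mul_assoc]

/-- Integrability of the averages implies summability along orthonormal sequences. -/
lemma RestrictedAInfty.exists_tsum_extendTop_lt_top (hw : RestrictedAInfty w) (hα : 0 < α)
    (μ : Measure ℂ) [SFinite μ] (hη : IsDecayRate η) (hh : IsConvexProfile η h) {r : ℝ}
    (hr : 0 < r) {C : ℝ} (hC : 0 < C)
    (hint : ∫⁻ z : ℂ, extendTop h (ENNReal.ofReal C * averageFn w μ r z) < ∞) :
    ∃ c : ℝ, 0 < c ∧ ∀ e : ℕ → FockSpace α w, Orthonormal ℂ e →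
      ∑' n, extendTop h (ENNReal.ofReal c * ∫⁻ ξ, fockDensity α (entireRep (e n)) ξ ∂μ) < ∞ := by
  -- With half the radius, `D(u,ρ) ⊆ D(v,r)` whenever `|u - v| ≤ ρ`. So `Φ u` is bounded by the
  -- averages at all nearby `v`, and `h(Φ u)` by an area mean of `G`.
  set ρ := r / 2 with hρdef
  have hρ : 0 < ρ := by positivity
  obtain ⟨K, hK⟩ := hw.exists_lintegral_fockDensity_le hα μ hρ
  obtain ⟨D, hD⟩ := hw.exists_ball_le_ball r one_pos ρ
  obtain ⟨N, hN⟩ := hw.exists_enorm_reproKernel_le hα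
  obtain ⟨E, hE⟩ := hw.exists_ball_le_ball 1 one_pos ρ
  obtain ⟨F, hF⟩ := hw.exists_ball_le_ball ρ one_pos 0
  set V : ℂ → ℝ≥0∞ := fun z => weightMeasure w (Metric.ball z 1) with hV
  have hVm : Measurable V := measurable_measure_ball _ 1
  have hV0 : ∀ z, V z ≠ 0 := fun z => hw.ball_ne_zero z one_pos
  have hVt : ∀ z, V z ≠ ∞ := fun z => hw.ball_ne_top z 1
  set G : ℂ → ℝ≥0∞ := fun v => extendTop h (ENNReal.ofReal C * averageFn w μ r v) with hG
  have hGm : Measurable G :=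
    hh.measurable_extendTop.comp ((measurable_averageFn w μ r).const_mul _)
  set a := C / (D + 1) with ha
  have ha0 : 0 < a := by positivity
  set Φ : ℂ → ℝ≥0∞ := fun u => ENNReal.ofReal a * (μ (Metric.ball u ρ) / V u) with hΦ
  have hΦm : Measurable Φ := ((measurable_measure_ball μ ρ).div hVm).const_mul _
  have hHΦm : Measurable fun u => extendTop h (Φ u) := hh.measurable_extendTop.comp hΦm
  have hΦle : ∀ u v, ‖v - u‖ ≤ ρ → Φ u ≤ ENNReal.ofReal C * averageFn w μ r v := by
    intro u v huv
    have h1 : weightMeasure w (Metric.ball v r) ≤ (D + 1 : ℝ≥0) * V u :=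
      (hD v u huv).trans (mul_le_mul' (by exact_mod_cast le_self_add) le_rfl)
    have h2 : Metric.ball u ρ ⊆ Metric.ball v r := by
      refine Metric.ball_subset_ball' ?_
      rw [dist_comm, dist_eq_norm]; linarith
    have h3 : ENNReal.ofReal a * (V u)⁻¹ ≤
        ENNReal.ofReal C * (weightMeasure w (Metric.ball v r))⁻¹ := by
      have h4 : ((D + 1 : ℝ≥0) * V u)⁻¹ ≤ (weightMeasure w (Metric.ball v r))⁻¹ :=
        ENNReal.inv_le_inv.2 h1
      have h5 : ENNReal.ofReal a = ENNReal.ofReal C * ((D + 1 : ℝ≥0) : ℝ≥0∞)⁻¹ := by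
        rw [ha, div_eq_mul_inv, ENNReal.ofReal_mul hC.le, ENNReal.ofReal_inv_of_pos (by positivity)]
        congr 2
        exact_mod_cast ENNReal.ofReal_coe_nnreal (p := D + 1)
      rw [ENNReal.mul_inv (Or.inr (hVt u)) (Or.inr (hV0 u))] at h4
      rw [h5, mul_assoc]
      exact mul_le_mul' le_rfl h4
    rw [hΦ, averageFn]
    simp only
    rw [ENNReal.div_eq_inv_mul, ENNReal.div_eq_inv_mul, ← mul_assoc, ← mul_assoc]
    exact mul_le_mul' h3 (measure_mono h2)
  set vol := volume (Metric.ball (0 : ℂ) ρ) with hvol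
  have hvol0 : vol ≠ 0 := volume_ball_ne_zero hρ
  have hvolt : vol ≠ ∞ := volume_ball_ne_top
  have havg : ∀ u, extendTop h (Φ u) ≤ vol⁻¹ * ∫⁻ v in Metric.ball u ρ, G v := fun u => by
    have h1 : vol * extendTop h (Φ u) ≤ ∫⁻ v in Metric.ball u ρ, G v := by
      rw [hvol, ← volume_ball_eq u, mul_comm, ← setLIntegral_const]
      exact setLIntegral_mono' measurableSet_ball fun v hv =>
        hh.extendTop_mono (hΦle u v (mem_ball_iff_norm.1 hv).le)
    calc extendTop h (Φ u) = vol⁻¹ * (vol * extendTop h (Φ u)) := by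
          rw [← mul_assoc, ENNReal.inv_mul_cancel hvol0 hvolt, one_mul]
      _ ≤ _ := mul_le_mul' le_rfl h1
  refine ⟨a / (K + 1), by positivity, fun e he => ?_⟩
  have hterm : ∀ n, extendTop h (ENNReal.ofReal (a / (K + 1)) *
      ∫⁻ ξ, fockDensity α (entireRep (e n)) ξ ∂μ) ≤
      ∫⁻ u, fockDensity α (entireRep (e n)) u * extendTop h (Φ u) ∂(weightMeasure w) := fun n => by
    have hdm := measurable_fockDensity_entireRep (e n)
    -- As `‖e_n‖ = 1`, this is a probability measure, and Jensen's inequality moves `h` inside the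
    -- integral.
    set P := (weightMeasure w).withDensity (fockDensity α (entireRep (e n))) with hP
    have hP1 : P univ ≤ 1 := by
      rw [hP, withDensity_apply _ MeasurableSet.univ, Measure.restrict_univ,
        hw.isWeight.lintegral_fockDensity, enorm_sq_of_orthonormal he]
    have h1 := hh.extendTop_lintegral_le hη hP1 hΦm
    rw [hP, lintegral_withDensity_eq_lintegral_mul _ hdm hΦm,
      lintegral_withDensity_eq_lintegral_mul _ hdm hHΦm] at h1
    refine le_trans (hh.extendTop_mono ?_) h1
    have h2 : ∫⁻ u, (fockDensity α (entireRep (e n)) * Φ) u ∂(weightMeasure w) =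
        ENNReal.ofReal a * ∫⁻ u, fockDensity α (entireRep (e n)) u * (μ (Metric.ball u ρ) / V u)
          ∂(weightMeasure w) := by
      have h3 : Measurable fun u => fockDensity α (entireRep (e n)) u *
          (μ (Metric.ball u ρ) / V u) := hdm.mul ((measurable_measure_ball μ ρ).div hVm)
      rw [← lintegral_const_mul _ h3]
      refine lintegral_congr fun u => ?_
      simp only [hΦ, Pi.mul_apply]; ring
    rw [h2]
    calc _ ≤ ENNReal.ofReal (a / (K + 1)) * (K * ∫⁻ u, fockDensity α (entireRep (e n)) u *
          (μ (Metric.ball u ρ) / V u) ∂(weightMeasure w)) :=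
          mul_le_mul' le_rfl (hK _ (differentiable_entireRep (e n)))
      _ = (ENNReal.ofReal (a / (K + 1)) * K) * ∫⁻ u, fockDensity α (entireRep (e n)) u *
          (μ (Metric.ball u ρ) / V u) ∂(weightMeasure w) := by rw [mul_assoc]
      _ ≤ _ := by
          refine mul_le_mul' ?_ le_rfl
          rw [← ENNReal.ofReal_coe_nnreal, ← ENNReal.ofReal_mul (by positivity)]
          refine ENNReal.ofReal_le_ofReal ?_
          rw [div_mul_eq_mul_div, div_le_iff₀ (by positivity)]
          nlinarith
  have hbessel : ∀ u, ∑' n, fockDensity α (entireRep (e n)) u ≤ N * (V u)⁻¹ := fun u => by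
    refine le_trans ?_ (hN u)
    simp_rw [fockDensity]
    rw [ENNReal.tsum_mul_right]
    refine mul_le_mul' ?_ le_rfl
    refine le_trans (le_of_eq (tsum_congr fun n => ?_)) (tsum_enorm_inner_sq_le he (reproKernel α w u))
    rw [hw.entireRep_eq_inner hα, ← ofReal_norm, ← ofReal_norm]
    congr 2
    exact norm_inner_symm _ _
  refine (ENNReal.tsum_le_tsum hterm).trans_lt ?_
  have hem : ∀ n, Measurable fun u => fockDensity α (entireRep (e n)) u * extendTop h (Φ u) :=
    fun n => (measurable_fockDensity_entireRep (e n)).mul hHΦm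
  rw [← lintegral_tsum fun n => (hem n).aemeasurable]
  have hGVm : Measurable fun v => G v * (V v)⁻¹ := hGm.mul hVm.inv
  -- Bessel's inequality supplies `1/w(D(u,1))`, the mean over `D(u,ρ)` supplies `G`. After Fubini
  -- the factor `w(D(v,ρ)) / w(D(v,1))` is bounded, leaving `∫ G dA`.
  have hpt : ∀ u, ∑' n, fockDensity α (entireRep (e n)) u * extendTop h (Φ u) ≤
      (N * vol⁻¹ * E) * ∫⁻ v in Metric.ball u ρ, G v * (V v)⁻¹ := fun u => by
    rw [ENNReal.tsum_mul_right]
    have h1 : (V u)⁻¹ * ∫⁻ v in Metric.ball u ρ, G v ≤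
        E * ∫⁻ v in Metric.ball u ρ, G v * (V v)⁻¹ := by
      rw [← lintegral_const_mul _ hGm, ← lintegral_const_mul _ hGVm]
      refine setLIntegral_mono' measurableSet_ball fun v hv => ?_
      have h2 : V v ≤ E * V u := hE v u (mem_ball_iff_norm.1 hv).le
      have h3 : (V u)⁻¹ ≤ E * (V v)⁻¹ := by
        rw [← div_eq_mul_inv, ENNReal.le_div_iff_mul_le (Or.inl (hV0 v)) (Or.inl (hVt v))]
        calc (V u)⁻¹ * V v ≤ (V u)⁻¹ * (E * V u) := mul_le_mul' le_rfl h2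
          _ = E * ((V u)⁻¹ * V u) := by ring
          _ = E := by rw [ENNReal.inv_mul_cancel (hV0 u) (hVt u), mul_one]
      calc (V u)⁻¹ * G v ≤ E * (V v)⁻¹ * G v := mul_le_mul' h3 le_rfl
        _ = _ := by ring
    calc _ ≤ (N * (V u)⁻¹) * (vol⁻¹ * ∫⁻ v in Metric.ball u ρ, G v) :=
          mul_le_mul' (hbessel u) (havg u)
      _ = N * vol⁻¹ * ((V u)⁻¹ * ∫⁻ v in Metric.ball u ρ, G v) := by ring
      _ ≤ N * vol⁻¹ * (E * ∫⁻ v in Metric.ball u ρ, G v * (V v)⁻¹) := mul_le_mul' le_rfl h1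
      _ = _ := by ring
  refine (lintegral_mono hpt).trans_lt ?_
  have hct : (N * vol⁻¹ * E : ℝ≥0∞) ≠ ∞ := ENNReal.mul_ne_top
    (ENNReal.mul_ne_top ENNReal.coe_ne_top (ENNReal.inv_ne_top.2 hvol0)) ENNReal.coe_ne_top
  rw [lintegral_const_mul' _ _ hct, lintegral_lintegral_ball hGVm]
  refine ENNReal.mul_lt_top hct.lt_top ?_
  have hfin : ∫⁻ v, G v * (V v)⁻¹ * weightMeasure w (Metric.ball v ρ) ≤ F * ∫⁻ v, G v := by
    rw [← lintegral_const_mul _ hGm]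
    refine lintegral_mono fun v => ?_
    calc G v * (V v)⁻¹ * weightMeasure w (Metric.ball v ρ) ≤ G v * (V v)⁻¹ * (F * V v) :=
          mul_le_mul' le_rfl (hF v v (by simp))
      _ = F * G v * ((V v)⁻¹ * V v) := by ring
      _ = F * G v := by rw [ENNReal.inv_mul_cancel (hV0 v) (hVt v), mul_one]
  exact hfin.trans_lt (ENNReal.mul_lt_top ENNReal.coe_lt_top hint)

/-- Integrability of the averages implies summability of the profile of the singular values. -/
lemma IsToeplitz.exists_tsum_lt_top (hw : RestrictedAInfty w) (hα : 0 < α) [SFinite μ]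
    (hT : IsToeplitz μ T) (hη : IsDecayRate η) (hh : IsConvexProfile η h) {s : ℕ → ℝ}
    (hs : IsSingularValueSeq T s) {r : ℝ} (hr : 0 < r) {C : ℝ} (hC : 0 < C)
    (hint : ∫⁻ z : ℂ, extendTop h (ENNReal.ofReal C * averageFn w μ r z) < ∞) :
    ∃ c : ℝ, 0 < c ∧ ∑' n, ENNReal.ofReal (h (c * s n)) < ∞ := by
  obtain ⟨hs0, -, -, e, σ, he, hσ, hTs⟩ := hs
  obtain ⟨c, hc, hsum⟩ := hw.exists_tsum_extendTop_lt_top hα μ hη hh hr hC hint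
  refine ⟨c, hc, ?_⟩
  set q : FockSpace α w → ℝ≥0∞ := fun f => ∫⁻ ξ, fockDensity α (entireRep f) ξ ∂μ with hq
  have hle : ∀ n, ENNReal.ofReal (h (c * s n)) ≤ extendTop h (ENNReal.ofReal c * q (e n)) +
      extendTop h (ENNReal.ofReal c * q (σ n)) := fun n => by
    have h1 := hT.two_mul_enorm_inner_le hw hα (e n) (σ n)
    have h2 : inner ℂ (σ n) (T (e n)) = (s n : ℂ) := inner_eq_of_hasSum he hσ hTs n
    rw [h2, ← ofReal_norm, Complex.norm_real, Real.norm_of_nonneg (hs0 n)] at h1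
    -- Bounding by the maximum lets `h` act on one term at a time, so `h(c s_n)` is at most the sum
    -- of the two values.
    have h3 : ENNReal.ofReal (s n) ≤ max (q (e n)) (q (σ n)) := by
      have h4 : 2 * ENNReal.ofReal (s n) ≤ 2 * max (q (e n)) (q (σ n)) := by
        refine h1.trans ?_
        rw [two_mul]
        exact add_le_add (le_max_left _ _) (le_max_right _ _)
      exact (ENNReal.mul_le_mul_iff_right (by simp) (by simp)).1 h4
    rw [← extendTop_ofReal h (mul_nonneg hc.le (hs0 n)), ENNReal.ofReal_mul hc.le]
    refine (hh.extendTop_mono (mul_le_mul' le_rfl h3)).trans ?_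
    rcases le_total (q (e n)) (q (σ n)) with h5 | h5
    · rw [max_eq_right h5]; exact le_add_self
    · rw [max_eq_left h5]; exact le_self_add
  refine (ENNReal.tsum_le_tsum hle).trans_lt ?_
  rw [ENNReal.tsum_add]
  exact ENNReal.add_lt_top.2 ⟨hsum e he, hsum σ hσ⟩

end Main

end WeightedFock

end

open WeightedFock in
theorem corollary5p2 (α : ℝ) (hα : 0 < α) (w : ℂ → ℝ) (hw : RestrictedAInfty w) :
    (∃ δ : ℝ, IsKernelRadius α w δ) ∧
    ∀ δ : ℝ, IsKernelRadius α w δ →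
    ∀ (μ : Measure ℂ) (T : FockSpace α w →L[ℂ] FockSpace α w),
      IsToeplitz μ T → IsCompactOperator T →
    ∀ η h : ℝ → ℝ, IsDecayRate η → IsConvexProfile η h →
      List.TFAE [
        ∃ K : ℝ, 0 < K ∧ ∀ n : ℕ, singularValue T n ≤ K * η ((n : ℝ) + 1),
        ∃ C : ℝ, 0 < C ∧ ∫⁻ z : ℂ, extendTop h (ENNReal.ofReal C * berezin α w μ z) < ∞,
        ∃ r : ℝ, 0 < r ∧ r < δ ∧
          ∃ C : ℝ, 0 < C ∧ ∫⁻ z : ℂ, extendTop h (ENNReal.ofReal C * averageFn w μ r z) < ∞,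
        ∀ r : ℝ, 0 < r → r < δ →
          ∃ C : ℝ, 0 < C ∧ ∫⁻ z : ℂ, extendTop h (ENNReal.ofReal C * averageFn w μ r z) < ∞] := by
  refine ⟨hw.exists_isKernelRadius hα, fun δ hδ μ T hT hTc η h hη hh => ?_⟩
  -- Local finiteness makes `μ` s-finite, as the Fubini arguments below require.
  have hloc : IsLocallyFiniteMeasure μ := hT.isLocallyFiniteMeasure hw hδ
  have hs := hT.isSingularValueSeq hw hα hTc
  tfae_have 1 → 2 := by
    rintro ⟨K, hK, hle⟩
    obtain ⟨C, hC, hsum⟩ := hη.exists_tsum_lt_top hh hs.1 hK hle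
    exact ⟨C, hC, hT.exists_lintegral_berezin_lt_top hw hα hη hh hs hC hsum⟩
  tfae_have 2 → 4 := by
    rintro ⟨C, hC, hint⟩ r hr hrδ
    obtain ⟨c, hc, hle⟩ := hw.exists_averageFn_le hα hδ μ hr hrδ
    refine ⟨C * c, by positivity, (lintegral_mono fun z => hh.extendTop_mono ?_).trans_lt hint⟩
    rw [ENNReal.ofReal_mul hC.le, mul_assoc]
    exact mul_le_mul' le_rfl (hle z)
  tfae_have 4 → 3 := fun hall =>
    ⟨δ / 2, half_pos hδ.1, half_lt_self hδ.1, hall _ (half_pos hδ.1) (half_lt_self hδ.1)⟩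
  tfae_have 3 → 1 := by
    rintro ⟨r, hr, -, C, hC, hint⟩
    obtain ⟨c, hc, hsum⟩ := hT.exists_tsum_lt_top hw hα hη hh hs hr hC hint
    exact hη.exists_le_of_tsum_lt_top hh hs.1 hs.2.1 hc hsum
  tfae_finish
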